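/- **Conventions.** All rings $R,S$ are commutative with $1$. For $q\in R$ put $(n)_q=1+q+\dots+q^{n-1}$ and $(n)_q!=(1)_q\cdots(n)_q$. If $A$ is an $R$-algebra, $u\in A$, and an element $m=(c)_q\in A$ is given, put $(c+j)_q:=(j)_q+q^jm$ and $$(1-tu)_q^{(-c)}:=\sum_{k\ge0}\frac{(c)_q(c+1)_q\cdots(c+k-1)_q}{(k)_q!}\,u^k\,t^k\in A[[t]]$$ ($t$ is a central formal variable; the $(k)_q$ are assumed invertible, and the factors are multiplied in the displayed order). For $q=1$ this is $(1-tu)^{-c}$. Here the parameter of a twist is always multiplied by the bookkeeping variable $t$, so that identities between formal power series in the parameters make sense. Let $A$ be a bialgebra over $R$ with comultiplication $\Delta$ and counit $\varepsilon$; extend all maps $t$-linearly. An element ${\cal F}\in(A\otimes A)[[t]]$ is called a *twist* of $A$ if it is invertible, ${\cal F}_{12}(\Delta\otimes\mathrm{id}){\cal F}={\cal F}_{23}(\mathrm{id}\otimes\Delta){\cal F}$, $(\varepsilon\otimes\mathrm{id}){\cal F}=1=(\mathrm{id}\otimes\varepsilon){\cal F}$, and the twisted comultiplication $\Delta^{\cal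 F}(x)={\cal F}\Delta(x){\cal F}^{-1}$ is coassociative with counit $\varepsilon$. (Coassociativity in $(A\otimes A\otimes A)[[t]]$ means $(\Delta^{\cal F}\otimes\mathrm{id})\Delta^{\cal F}=(\mathrm{id}\otimes\Delta^{\cal F})\Delta^{\cal F}$, where $(\Delta^{\cal F}\otimes\mathrm{id})(X)={\cal F}_{12}\,(\Delta\otimes\mathrm{id})(X)\,{\cal F}_{12}^{-1}$ and $(\mathrm{id}\otimes\Delta^{\cal F})(X)={\cal F}_{23}\,(\mathrm{id}\otimes\Delta)(X)\,{\cal F}_{23}^{-1}$.) **The algebra $U_q(\widehat{sl}_2)$** (zero central charge, no grading element), for $q\in R^\times$: generators $e_{\pm\alpha},e_{\pm(\delta-\alpha)},q^{\pm h}$, with $q^hq^{-h}=q^{-h}q^h=1$ and $$q^he_{\pm\alpha}q^{-h}=q^{\pm2}e_{\pm\alpha},\quad q^he_{\pm(\delta-\alpha)}q^{-h}=q^{\mp2}e_{\pm(\delta-\alpha)},$$ $$(q-q^{-1})[e_\alpha,e_{-\alpha}]=q^h-q^{-h},\quad (q-q^{-1})[e_{\delta-\alpha},e_{-\delta+\alpha}]=q^{-h}-q^h,$$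 $$[e_\alpha,e_{-\delta+\alpha}]=[e_{-\alpha},e_{\delta-\alpha}]=0,$$ and the Serre relations $x^3y-[3]x^2yx+[3]xyx^2-yx^3=0$, $[3]=q^2+1+q^{-2}$, for $(x,y)$ or $(y,x)$ equal to $(e_\alpha,e_{\delta-\alpha})$ or $(e_{-\alpha},e_{-\delta+\alpha})$. Its comultiplication is $$\Delta(q^{\pm h})=q^{\pm h}\otimes q^{\pm h},\quad\Delta(e_\alpha)=e_\alpha\otimes1+q^{-h}\otimes e_\alpha,\quad\Delta(e_{-\alpha})=e_{-\alpha}\otimes q^h+1\otimes e_{-\alpha},$$ $$\Delta(e_{\delta-\alpha})=e_{\delta-\alpha}\otimes1+q^h\otimes e_{\delta-\alpha},\quad\Delta(e_{-\delta+\alpha})=e_{-\delta+\alpha}\otimes q^{-h}+1\otimes e_{-\delta+\alpha},$$ and $\varepsilon(q^{\pm h})=1$, $\varepsilon(e_{\pm\alpha})=\varepsilon(e_{\pm(\delta-\alpha)})=0$. **Theorem.** **(1)** Let $q\in R^\times$ with $q^{2n}-1$ invertible for all $n\ge1$. For all $a,b\in R$ the element $${\cal F}_{a,b}=\Big(1-t\,(2)_{q^2}\big(a\,1\otimes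 e_{\delta-\alpha}+b\,q^{-h}\otimes q^{-h}e_{-\alpha}\big)\Big)_{q^2}^{\left(-\frac{h\otimes1}2\right)},\qquad (h/2)_{q^2}=\frac{q^h-1}{q^2-1},$$ is a twist of $U_q(\widehat{sl}_2)$; in particular ${\cal F}_{12}(\Delta\otimes\mathrm{id}){\cal F}={\cal F}_{23}(\mathrm{id}\otimes\Delta){\cal F}$. **(2)** Let every positive integer be invertible in $R$, and let $\eta,\xi\in R$. Let $Y(sl_2)$ be the Yangian with parameter $\eta$ in its RTT presentation: it is generated by $t_{ij}^{(r)}$ ($i,j\in\{1,2\}$, $r\ge1$); with $t_{ij}(u)=\sum_{r\ge1}t_{ij}^{(r)}u^{-r}$ and $T_{ij}(u)=\delta_{ij}+\eta\,t_{ij}(u)$ the relations are $$(u-v)[t_{ij}(u),t_{kl}(v)]=\delta_{kj}\big(t_{il}(v)-t_{il}(u)\big)+\delta_{il}\big(t_{kj}(u)-t_{kj}(v)\big)+\eta\big(t_{kj}(u)t_{il}(v)-t_{kj}(v)t_{il}(u)\big),$$ $$t_{11}(u)+t_{22}(u-\eta)+\eta\big(t_{11}(u)t_{22}(u-\eta)-t_{21}(u)t_{12}(u-\eta)\big)=0$$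 (that is, $(u-v)[T_{ij}(u),T_{kl}(v)]=\eta\,(T_{kj}(u)T_{il}(v)-T_{kj}(v)T_{il}(u))$ and $\operatorname{qdet}T(u)=1$, divided by $\eta^2$ and by $\eta$ respectively), and $\Delta(t_{ij}(u))=t_{ij}(u)\otimes1+1\otimes t_{ij}(u)+\eta\sum_kt_{ik}(u)\otimes t_{kj}(u)$, $\varepsilon(t_{ij}^{(r)})=0$. Put $h=t_{11}^{(1)}-t_{22}^{(1)}$, $f_0=t_{21}^{(1)}$, $f_1=-t_{21}^{(2)}+\eta f_0\frac h2$. Then $${\cal F}_Y=\Big(1-2t\xi\big(1\otimes f_1+\eta\tfrac h2\otimes f_0\big)\Big)^{-\frac{h\otimes1}2}$$ is a twist of $Y(sl_2)$. **(3)** *(degeneration of (1) to (2))* Let $q\in S^\times$ be such that all $(n)_{q^2}$, $n\ge1$, are invertible in $S$, and let $\eta,\xi\in S$. Let $B$ be the $S$-bialgebra generated by $q^{\pm h}$, $H=(h/2)_{q^{-2}}$, $f_0,f_1$ with relations $q^hq^{-h}=q^{-h}q^h=1$, $q^{-h}=1+(q^{-2}-1)H$, $Hq^h=q^hH$, and for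 $i=0,1$ $$q^hf_i=q^{-2}f_iq^h,\qquad Hf_i=q^2f_i(H-1),\qquad f_1f_0-q^{-2}f_0f_1=-\eta f_0^2,$$ comultiplication $$\Delta(q^{\pm h})=q^{\pm h}\otimes q^{\pm h},\quad\Delta(H)=H\otimes1+q^{-h}\otimes H,\quad\Delta(f_0)=f_0\otimes1+q^{-h}\otimes f_0,$$ $$\Delta(f_1)=f_1\otimes1+q^h\otimes f_1+\eta\,q^h(h)_{q^{-2}}\otimes f_0,\qquad q^h(h)_{q^{-2}}=H(1+q^h),$$ and counit $\varepsilon(q^{\pm h})=1$, $\varepsilon(H)=\varepsilon(f_0)=\varepsilon(f_1)=0$. Then $${\cal F}_B=\Big(1-t\,(2)_{q^2}\,\xi\big(1\otimes f_1+\eta\,(h/2)_{q^{-2}}\otimes f_0\big)\Big)_{q^2}^{\left(-\frac{h\otimes1}2\right)},\qquad (h/2)_{q^2}=q^{-2}q^hH,$$ is a twist of $B$. Moreover, for every $S$-algebra $R$ (with $q,\eta,\xi$ also denoting their images in $R$): * if $q^2-1$ is invertible in $R$, there is an $S$-algebra homomorphism $\psi:B\to U_q(\widehat{sl}_2)$,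 with $U_q(\widehat{sl}_2)$ taken over $R$, compatible with comultiplications and counits, with $$\psi(q^{\pm h})=q^{\pm h},\quad \psi(H)=\frac{q^{-h}-1}{q^{-2}-1},\quad \psi(f_0)=q^{-h}e_{-\alpha},\quad \psi(f_1)=e_{\delta-\alpha}+\frac{\eta}{q^{-2}-1}\,q^{-h}e_{-\alpha},$$ and $\psi\otimes\psi$ carries ${\cal F}_B$ to ${\cal F}_{a,b}$ with $a=\xi$, $b=\dfrac{\xi\eta}{q^{-2}-1}$; * if $q=1$ in $R$, there is an $S$-algebra homomorphism $\psi:B\to Y(sl_2)$, with $Y(sl_2)$ taken over $R$ with parameter $\eta$, compatible with comultiplications and counits, with $$\psi(q^{\pm h})=1,\quad\psi(H)=\tfrac h2,\quad\psi(f_0)=f_0,\quad\psi(f_1)=f_1,$$ and $\psi\otimes\psi$ carries ${\cal F}_B$ to ${\cal F}_Y$. -/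

import Mathlib

open scoped TensorProduct
universe u v

/-- The `q`-number `(n)_q = 1 + q + ⋯ + q^{n-1}`. -/
def qNum {R : Type*} [CommRing R] (q : R) (n : ℕ) : R := ∑ i ∈ Finset.range n, q ^ i

/-- The `q`-factorial `(n)_q! = (1)_q (2)_q ⋯ (n)_q`. -/
def qFact {R : Type*} [CommRing R] (q : R) : ℕ → R
  | 0 => 1
  | n + 1 => qFact q n * qNum q (n + 1)

/-- For `m = (c)_q`, the product `(c)_q (c+1)_q ⋯ (c+k-1)_q`, where
`(c + j)_q = (j)_q + q^j (c)_q`. -/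
def qRising {R A : Type*} [CommRing R] [Ring A] [Algebra R A] (q : R) (m : A) : ℕ → A
  | 0 => 1
  | k + 1 => qRising q m k * (algebraMap R A (qNum q k) + q ^ k • m)

/-- The `q`-power `(1 - X u)_q^{(-c)} = ∑ₖ (c)_q (c+1)_q ⋯ (c+k-1)_q / (k)_q! · u^k X^k`, where the
exponent enters only through `m = (c)_q`.  For `q = 1` this is `(1 - X u)^{-m}`. -/
noncomputable def qPower {R A : Type*} [CommRing R] [Ring A] [Algebra R A] (q : R) (m u : A) :
    PowerSeries A :=
  PowerSeries.mk fun k => Ring.inverse (qFact q k) • (qRising q m k * u ^ k)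

section Twist
variable {R A : Type*} [CommRing R] [Ring A] [Bialgebra R A]

/-- `F ↦ F₁₂ = F ⊗ 1`. -/
noncomputable def twist12 (F : PowerSeries (A ⊗[R] A)) : PowerSeries (A ⊗[R] A ⊗[R] A) :=
  PowerSeries.mapAlgHom (Algebra.TensorProduct.includeLeft : A ⊗[R] A →ₐ[R] A ⊗[R] A ⊗[R] A) F

/-- `F ↦ F₂₃ = 1 ⊗ F`. -/
noncomputable def twist23 (F : PowerSeries (A ⊗[R] A)) : PowerSeries (A ⊗[R] A ⊗[R] A) :=
  PowerSeries.mapAlgHom ((Algebra.TensorProduct.assoc R R R A A A).symm.toAlgHom.comp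
    (Algebra.TensorProduct.includeRight : A ⊗[R] A →ₐ[R] A ⊗[R] (A ⊗[R] A))) F

/-- `F ↦ (Δ ⊗ id) F`. -/
noncomputable def comulLeft (F : PowerSeries (A ⊗[R] A)) : PowerSeries (A ⊗[R] A ⊗[R] A) :=
  PowerSeries.mapAlgHom
    (Algebra.TensorProduct.map (Bialgebra.comulAlgHom R A) (AlgHom.id R A)) F

/-- `F ↦ (id ⊗ Δ) F`. -/
noncomputable def comulRight (F : PowerSeries (A ⊗[R] A)) : PowerSeries (A ⊗[R] A ⊗[R] A) :=
  PowerSeries.mapAlgHom ((Algebra.TensorProduct.assoc R R R A A A).symm.toAlgHom.comp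
    (Algebra.TensorProduct.map (AlgHom.id R A) (Bialgebra.comulAlgHom R A))) F

/-- `F ↦ (ε ⊗ id) F`. -/
noncomputable def counitLeft (F : PowerSeries (A ⊗[R] A)) : PowerSeries A :=
  PowerSeries.mapAlgHom ((Algebra.TensorProduct.lid R A).toAlgHom.comp
    (Algebra.TensorProduct.map (Bialgebra.counitAlgHom R A) (AlgHom.id R A))) F

/-- `F ↦ (id ⊗ ε) F`. -/
noncomputable def counitRight (F : PowerSeries (A ⊗[R] A)) : PowerSeries A :=
  PowerSeries.mapAlgHom ((Algebra.TensorProduct.rid R R A).toAlgHom.comp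
    (Algebra.TensorProduct.map (AlgHom.id R A) (Bialgebra.counitAlgHom R A))) F

/-- The twisted comultiplication `Δ^F(x) = F Δ(x) F⁻¹`. -/
noncomputable def twistedComul (F : PowerSeries (A ⊗[R] A)) (x : A) : PowerSeries (A ⊗[R] A) :=
  F * PowerSeries.C (Coalgebra.comul (R := R) x) * Ring.inverse F

/-- `F` is a (Drinfeld) twist of the bialgebra `A`, and `Δ^F` is again coassociative with
counit `ε`. -/
structure IsTwist (F : PowerSeries (A ⊗[R] A)) : Prop where
  isUnit : IsUnit F
  cocycle : twist12 F * comulLeft F = twist23 F * comulRight F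
  counit_left : counitLeft F = 1
  counit_right : counitRight F = 1
  twisted_coassoc : ∀ x : A,
    twist12 F * comulLeft (twistedComul F x) * Ring.inverse (twist12 F)
      = twist23 F * comulRight (twistedComul F x) * Ring.inverse (twist23 F)
  twisted_counit_left : ∀ x : A, counitLeft (twistedComul F x) = PowerSeries.C x
  twisted_counit_right : ∀ x : A, counitRight (twistedComul F x) = PowerSeries.C x

end Twist

/-- The (quantum) Serre expression `x³y - c x²yx + c xyx² - yx³`. -/
def serreExpr {R A : Type*} [CommRing R] [Ring A] [Algebra R A] (c : R) (x y : A) : A :=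
  x ^ 3 * y - c • (x ^ 2 * y * x) + c • (x * y * x ^ 2) - y * x ^ 3

theorem serreExpr_add {R A : Type*} [CommRing R] [Ring A] [Algebra R A] (p p' : R)
    (hp : p * p' = 1) (x x' y y' : A)
    (hxx : x' * x = p • (x * x'))
    (hxy : x' * y = p' • (y * x')) (hyx : y' * x = p' • (x * y'))
    (h : serreExpr (p + 1 + p') x y = 0) (h' : serreExpr (p + 1 + p') x' y' = 0) :
    serreExpr (p + 1 + p') (x + x') (y + y') = 0 := by
  have hxx2 : ∀ z, x' * (x * z) = p • (x * (x' * z)) := fun z => by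
    rw [← mul_assoc, hxx, smul_mul_assoc, mul_assoc]
  have hxy2 : ∀ z, x' * (y * z) = p' • (y * (x' * z)) := fun z => by
    rw [← mul_assoc, hxy, smul_mul_assoc, mul_assoc]
  have hyx2 : ∀ z, y' * (x * z) = p' • (x * (y' * z)) := fun z => by
    rw [← mul_assoc, hyx, smul_mul_assoc, mul_assoc]
  suffices serreExpr (p + 1 + p') (x + x') (y + y')
      = serreExpr (p + 1 + p') x y + serreExpr (p + 1 + p') x' y' by rw [this, h, h', add_zero]
  simp only [serreExpr, pow_succ, pow_zero, one_mul, add_mul, mul_add, mul_assoc, hxx, hxy,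
    hyx, hxx2, hxy2, hyx2, smul_add, smul_smul, mul_smul_comm, smul_mul_assoc]
  match_scalars <;> first | ring1 | (clear * -hp; grind)

/-- Names of the generators of `U_q(sl₂^)`: `eA = e_α`, `eNA = e_{-α}`, `eDA = e_{δ-α}`,
`eNDA = e_{-δ+α}`, `K = q^h`, `K' = q^{-h}`. -/
inductive UqGen
  | eA | eNA | eDA | eNDA | K | K'

/-- The generators in the free algebra. -/
abbrev uqι (R : Type u) [CommRing R] (g : UqGen) : FreeAlgebra R UqGen := FreeAlgebra.ι R g

/-- The defining relations of `U_q(sl₂^)` at zero central charge. -/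
inductive UqRel (R : Type u) [CommRing R] (q : Rˣ) :
    FreeAlgebra R UqGen → FreeAlgebra R UqGen → Prop
  | K_mul_K' : UqRel R q (uqι R .K * uqι R .K') 1
  | K'_mul_K : UqRel R q (uqι R .K' * uqι R .K) 1
  | K_eA : UqRel R q (uqι R .K * uqι R .eA) ((q : R) ^ 2 • (uqι R .eA * uqι R .K))
  | K_eNA : UqRel R q (uqι R .K * uqι R .eNA) ((↑q⁻¹ : R) ^ 2 • (uqι R .eNA * uqι R .K))
  | K_eDA : UqRel R q (uqι R .K * uqι R .eDA) ((↑q⁻¹ : R) ^ 2 • (uqι R .eDA * uqι R .K))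
  | K_eNDA : UqRel R q (uqι R .K * uqι R .eNDA) ((q : R) ^ 2 • (uqι R .eNDA * uqι R .K))
  | eA_eNA : UqRel R q (((q : R) - ↑q⁻¹) • (uqι R .eA * uqι R .eNA - uqι R .eNA * uqι R .eA))
      (uqι R .K - uqι R .K')
  | eDA_eNDA : UqRel R q (((q : R) - ↑q⁻¹) • (uqι R .eDA * uqι R .eNDA - uqι R .eNDA * uqι R .eDA))
      (uqι R .K' - uqι R .K)
  | eA_eNDA : UqRel R q (uqι R .eA * uqι R .eNDA) (uqι R .eNDA * uqι R .eA)
  | eNA_eDA : UqRel R q (uqι R .eNA * uqι R .eDA) (uqι R .eDA * uqι R .eNA)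
  | serre_eA_eDA : UqRel R q
      (serreExpr ((q : R) ^ 2 + 1 + (↑q⁻¹ : R) ^ 2) (uqι R .eA) (uqι R .eDA)) 0
  | serre_eDA_eA : UqRel R q
      (serreExpr ((q : R) ^ 2 + 1 + (↑q⁻¹ : R) ^ 2) (uqι R .eDA) (uqι R .eA)) 0
  | serre_eNA_eNDA : UqRel R q
      (serreExpr ((q : R) ^ 2 + 1 + (↑q⁻¹ : R) ^ 2) (uqι R .eNA) (uqι R .eNDA)) 0
  | serre_eNDA_eNA : UqRel R q
      (serreExpr ((q : R) ^ 2 + 1 + (↑q⁻¹ : R) ^ 2) (uqι R .eNDA) (uqι R .eNA)) 0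

/-- The quantum affine algebra `U_q(sl₂^)` with zero central charge over `R`. -/
def Uq (R : Type u) [CommRing R] (q : Rˣ) : Type u := RingQuot (UqRel R q)

namespace Uq

section
variable (R : Type u) [CommRing R] (q : Rˣ)

noncomputable instance : Ring (Uq R q) := inferInstanceAs (Ring (RingQuot (UqRel R q)))

noncomputable instance {S : Type*} [CommRing S] [Algebra S R] : Algebra S (Uq R q) :=
  inferInstanceAs (Algebra S (RingQuot (UqRel R q)))

instance {S : Type*} [CommRing S] [Algebra S R] : IsScalarTower S R (Uq R q) :=
  inferInstanceAs (IsScalarTower S R (RingQuot (UqRel R q)))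

/-- The generators as elements of the algebra. -/
noncomputable def gen (g : UqGen) : Uq R q :=
  RingQuot.mkAlgHom R (UqRel R q) (FreeAlgebra.ι R g)

variable {R q}

theorem mk_ι (g : UqGen) :
    (RingQuot.mkAlgHom R (UqRel R q) (FreeAlgebra.ι R g) : Uq R q) = gen R q g := rfl

/-- Universal property. -/
noncomputable def lift {A : Type*} [Ring A] [Algebra R A] (f : UqGen → A)
    (hf : ∀ ⦃x y⦄, UqRel R q x y → FreeAlgebra.lift R f x = FreeAlgebra.lift R f y) :
    Uq R q →ₐ[R] A :=
  RingQuot.liftAlgHom R ⟨FreeAlgebra.lift R f, hf⟩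

theorem lift_gen {A : Type*} [Ring A] [Algebra R A] (f : UqGen → A)
    (hf : ∀ ⦃x y⦄, UqRel R q x y → FreeAlgebra.lift R f x = FreeAlgebra.lift R f y) (g : UqGen) :
    lift f hf (gen R q g) = f g :=
  (RingQuot.liftAlgHom_mkAlgHom_apply R (FreeAlgebra.lift R f) hf (FreeAlgebra.ι R g)).trans
    (FreeAlgebra.lift_ι_apply f g)

theorem hom_ext {A : Type*} [Ring A] [Algebra R A] {f g : Uq R q →ₐ[R] A}
    (h : ∀ x, f (gen R q x) = g (gen R q x)) : f = g :=
  RingQuot.ringQuot_ext' R f g (FreeAlgebra.hom_ext (funext h))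

theorem rel {x y : FreeAlgebra R UqGen} (h : UqRel R q x y) :
    FreeAlgebra.lift R (gen R q) x = FreeAlgebra.lift R (gen R q) y := by
  have e : (FreeAlgebra.lift R (gen R q) : FreeAlgebra R UqGen →ₐ[R] Uq R q)
      = RingQuot.mkAlgHom R (UqRel R q) :=
    FreeAlgebra.hom_ext (funext fun g => FreeAlgebra.lift_ι_apply _ g)
  rw [e]
  exact RingQuot.mkAlgHom_rel R h

end


section
variable {R : Type u} [CommRing R] {q : Rˣ}

theorem K_mul_K' : gen R q .K * gen R q .K' = 1 := by
  simpa using rel (UqRel.K_mul_K' (R := R) (q := q))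
theorem K'_mul_K : gen R q .K' * gen R q .K = 1 := by
  simpa using rel (UqRel.K'_mul_K (R := R) (q := q))
theorem K_eA : gen R q .K * gen R q .eA = (q : R) ^ 2 • (gen R q .eA * gen R q .K) := by
  simpa using rel (UqRel.K_eA (R := R) (q := q))
theorem K_eNA : gen R q .K * gen R q .eNA = (↑q⁻¹ : R) ^ 2 • (gen R q .eNA * gen R q .K) := by
  simpa using rel (UqRel.K_eNA (R := R) (q := q))
theorem K_eDA : gen R q .K * gen R q .eDA = (↑q⁻¹ : R) ^ 2 • (gen R q .eDA * gen R q .K) := by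
  simpa using rel (UqRel.K_eDA (R := R) (q := q))
theorem K_eNDA : gen R q .K * gen R q .eNDA = (q : R) ^ 2 • (gen R q .eNDA * gen R q .K) := by
  simpa using rel (UqRel.K_eNDA (R := R) (q := q))
theorem eA_eNA : ((q : R) - ↑q⁻¹) • (gen R q .eA * gen R q .eNA - gen R q .eNA * gen R q .eA)
    = gen R q .K - gen R q .K' := by
  simpa only [map_smul, map_sub, map_mul, FreeAlgebra.lift_ι_apply]
    using rel (UqRel.eA_eNA (R := R) (q := q))
theorem eDA_eNDA :
    ((q : R) - ↑q⁻¹) • (gen R q .eDA * gen R q .eNDA - gen R q .eNDA * gen R q .eDA)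
    = gen R q .K' - gen R q .K := by
  simpa only [map_smul, map_sub, map_mul, FreeAlgebra.lift_ι_apply]
    using rel (UqRel.eDA_eNDA (R := R) (q := q))
theorem eA_eNDA : gen R q .eA * gen R q .eNDA = gen R q .eNDA * gen R q .eA := by
  simpa using rel (UqRel.eA_eNDA (R := R) (q := q))
theorem eNA_eDA : gen R q .eNA * gen R q .eDA = gen R q .eDA * gen R q .eNA := by
  simpa using rel (UqRel.eNA_eDA (R := R) (q := q))

theorem map_serre {A B : Type*} [Ring A] [Algebra R A] [Ring B] [Algebra R B] (f : A →ₐ[R] B)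
    (c : R) (x y : A) : f (serreExpr c x y) = serreExpr c (f x) (f y) := by
  simp only [serreExpr, map_sub, map_add, map_mul, map_pow, map_smul]

theorem serre_eA_eDA :
    serreExpr ((q : R) ^ 2 + 1 + (↑q⁻¹ : R) ^ 2) (gen R q .eA) (gen R q .eDA) = 0 := by
  simpa only [map_serre, map_zero, FreeAlgebra.lift_ι_apply]
    using rel (UqRel.serre_eA_eDA (R := R) (q := q))
theorem serre_eDA_eA :
    serreExpr ((q : R) ^ 2 + 1 + (↑q⁻¹ : R) ^ 2) (gen R q .eDA) (gen R q .eA) = 0 := by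
  simpa only [map_serre, map_zero, FreeAlgebra.lift_ι_apply]
    using rel (UqRel.serre_eDA_eA (R := R) (q := q))
theorem serre_eNA_eNDA :
    serreExpr ((q : R) ^ 2 + 1 + (↑q⁻¹ : R) ^ 2) (gen R q .eNA) (gen R q .eNDA) = 0 := by
  simpa only [map_serre, map_zero, FreeAlgebra.lift_ι_apply]
    using rel (UqRel.serre_eNA_eNDA (R := R) (q := q))
theorem serre_eNDA_eNA :
    serreExpr ((q : R) ^ 2 + 1 + (↑q⁻¹ : R) ^ 2) (gen R q .eNDA) (gen R q .eNA) = 0 := by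
  simpa only [map_serre, map_zero, FreeAlgebra.lift_ι_apply]
    using rel (UqRel.serre_eNDA_eNA (R := R) (q := q))

theorem q_mul_qinv_sq : (q : R) ^ 2 * (↑q⁻¹ : R) ^ 2 = 1 := by
  rw [← mul_pow, Units.mul_inv, one_pow]

/-- If `K x = s x K` then `K' x = s⁻¹ x K'`. -/
theorem K'_comm {A : Type*} [Ring A] [Algebra R A] {k k' x : A} {s t : R} (hst : s * t = 1)
    (h1 : k * k' = 1) (h2 : k' * k = 1) (h : k * x = s • (x * k)) : k' * x = t • (x * k') := by
  have : k' * (k * x) * k' = s • (k' * x) := by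
    rw [h, mul_smul_comm, smul_mul_assoc, mul_assoc, mul_assoc, h1, mul_one]
  rw [← mul_assoc, h2, one_mul] at this
  rw [this, smul_smul, mul_comm t s, hst, one_smul]

theorem K'_eA : gen R q .K' * gen R q .eA = (↑q⁻¹ : R) ^ 2 • (gen R q .eA * gen R q .K') :=
  K'_comm q_mul_qinv_sq K_mul_K' K'_mul_K K_eA
theorem K'_eNA : gen R q .K' * gen R q .eNA = (q : R) ^ 2 • (gen R q .eNA * gen R q .K') :=
  K'_comm ((mul_comm _ _).trans q_mul_qinv_sq) K_mul_K' K'_mul_K K_eNA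
theorem K'_eDA : gen R q .K' * gen R q .eDA = (q : R) ^ 2 • (gen R q .eDA * gen R q .K') :=
  K'_comm ((mul_comm _ _).trans q_mul_qinv_sq) K_mul_K' K'_mul_K K_eDA
theorem K'_eNDA : gen R q .K' * gen R q .eNDA = (↑q⁻¹ : R) ^ 2 • (gen R q .eNDA * gen R q .K') :=
  K'_comm q_mul_qinv_sq K_mul_K' K'_mul_K K_eNDA

/-- Values of the comultiplication on generators. -/
noncomputable def comulGen (R : Type u) [CommRing R] (q : Rˣ) : UqGen → Uq R q ⊗[R] Uq R q
  | .eA => gen R q .eA ⊗ₜ 1 + gen R q .K' ⊗ₜ gen R q .eA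
  | .eNA => gen R q .eNA ⊗ₜ gen R q .K + 1 ⊗ₜ gen R q .eNA
  | .eDA => gen R q .eDA ⊗ₜ 1 + gen R q .K ⊗ₜ gen R q .eDA
  | .eNDA => gen R q .eNDA ⊗ₜ gen R q .K' + 1 ⊗ₜ gen R q .eNDA
  | .K => gen R q .K ⊗ₜ gen R q .K
  | .K' => gen R q .K' ⊗ₜ gen R q .K'

/-- Values of the counit on generators. -/
def counitGen (R : Type u) [CommRing R] : UqGen → R
  | .K => 1
  | .K' => 1
  | _ => 0

/-- Serre expressions when a group-like commuting factor is attached on one side. -/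
theorem serre_left {c : R} (k k' x y : Uq R q) (hk : k * k' = k' * k)
    (h : serreExpr c x y = 0) : serreExpr c (k ⊗ₜ[R] x) (k' ⊗ₜ[R] y) = 0 := by
  have e : serreExpr c (k ⊗ₜ[R] x) (k' ⊗ₜ[R] y) = (k ^ 3 * k') ⊗ₜ[R] serreExpr c x y := by
    have e1 : k ^ 2 * k' * k = k ^ 3 * k' := by
      rw [mul_assoc, ← hk, ← mul_assoc, ← pow_succ]
    have e2 : k * k' * k ^ 2 = k ^ 3 * k' := by
      rw [mul_assoc, pow_two, ← mul_assoc k', ← hk, mul_assoc, ← hk]; noncomm_ring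
    have e3 : k' * k ^ 3 = k ^ 3 * k' := by
      rw [((show Commute k k' from hk).pow_left 3).eq]
    simp only [serreExpr, Algebra.TensorProduct.tmul_pow, Algebra.TensorProduct.tmul_mul_tmul,
      TensorProduct.tmul_sub, TensorProduct.tmul_add, TensorProduct.tmul_smul, e1, e2, e3]
  rw [e, h, TensorProduct.tmul_zero]

end
end Uq

namespace Uq
section
variable {R : Type u} [CommRing R] {q : Rˣ}

theorem serre_right {c : R} (k k' x y : Uq R q) (hk : k * k' = k' * k)
    (h : serreExpr c x y = 0) : serreExpr c (x ⊗ₜ[R] k) (y ⊗ₜ[R] k') = 0 := by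
  have := congrArg (Algebra.TensorProduct.comm R (Uq R q) (Uq R q))
    (serre_left k k' x y hk h)
  rwa [map_zero, show (Algebra.TensorProduct.comm R (Uq R q) (Uq R q))
    (serreExpr c (k ⊗ₜ[R] x) (k' ⊗ₜ[R] y)) = serreExpr c (x ⊗ₜ[R] k) (y ⊗ₜ[R] k') by
      simp only [serreExpr, map_sub, map_add, map_mul, map_pow, map_smul,
        Algebra.TensorProduct.comm_tmul]] at this

theorem comulGen_rel ⦃x y : FreeAlgebra R UqGen⦄ (h : UqRel R q x y) :
    FreeAlgebra.lift R (comulGen R q) x = FreeAlgebra.lift R (comulGen R q) y := by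
  have hc : (↑q⁻¹ : R) ^ 2 + 1 + (q : R) ^ 2 = (q : R) ^ 2 + 1 + (↑q⁻¹ : R) ^ 2 := by ring
  have hq := q_mul_qinv_sq (q := q)
  have hq' : (↑q⁻¹ : R) ^ 2 * (q : R) ^ 2 = 1 := (mul_comm _ _).trans hq
  have hKK : gen R q .K * gen R q .K' = gen R q .K' * gen R q .K := by rw [K_mul_K', K'_mul_K]
  have eAK : gen R q .eA * gen R q .K = (↑q⁻¹ : R) ^ 2 • (gen R q .K * gen R q .eA) := by
    rw [K_eA, smul_smul, hq', one_smul]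
  have eNAK : gen R q .eNA * gen R q .K = (q : R) ^ 2 • (gen R q .K * gen R q .eNA) := by
    rw [K_eNA, smul_smul, hq, one_smul]
  have eDAK : gen R q .eDA * gen R q .K = (q : R) ^ 2 • (gen R q .K * gen R q .eDA) := by
    rw [K_eDA, smul_smul, hq, one_smul]
  have eNDAK : gen R q .eNDA * gen R q .K = (↑q⁻¹ : R) ^ 2 • (gen R q .K * gen R q .eNDA) := by
    rw [K_eNDA, smul_smul, hq', one_smul]
  have eAK' : gen R q .eA * gen R q .K' = (q : R) ^ 2 • (gen R q .K' * gen R q .eA) := by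
    rw [K'_eA, smul_smul, hq, one_smul]
  have eNAK' : gen R q .eNA * gen R q .K' = (↑q⁻¹ : R) ^ 2 • (gen R q .K' * gen R q .eNA) := by
    rw [K'_eNA, smul_smul, hq', one_smul]
  have eDAK' : gen R q .eDA * gen R q .K' = (↑q⁻¹ : R) ^ 2 • (gen R q .K' * gen R q .eDA) := by
    rw [K'_eDA, smul_smul, hq', one_smul]
  have eNDAK' : gen R q .eNDA * gen R q .K' = (q : R) ^ 2 • (gen R q .K' * gen R q .eNDA) := by
    rw [K'_eNDA, smul_smul, hq, one_smul]
  cases h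
  case serre_eA_eDA =>
    simp only [map_serre, map_zero, FreeAlgebra.lift_ι_apply, comulGen]
    rw [← hc]
    refine serreExpr_add _ _ hq' _ _ _ _ ?_ ?_ ?_ ?_ ?_
    · simp [K'_eA, TensorProduct.smul_tmul']
    · simp [K'_eDA, TensorProduct.smul_tmul']
    · simp [K_eA, TensorProduct.smul_tmul']
    · rw [hc]; exact serre_right 1 1 _ _ rfl serre_eA_eDA
    · rw [hc]; exact serre_left _ _ _ _ hKK.symm serre_eA_eDA
  case serre_eDA_eA =>
    simp only [map_serre, map_zero, FreeAlgebra.lift_ι_apply, comulGen]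
    rw [← hc]
    refine serreExpr_add _ _ hq' _ _ _ _ ?_ ?_ ?_ ?_ ?_
    · simp [K_eDA, TensorProduct.smul_tmul']
    · simp [K_eA, TensorProduct.smul_tmul']
    · simp [K'_eDA, TensorProduct.smul_tmul']
    · rw [hc]; exact serre_right 1 1 _ _ rfl serre_eDA_eA
    · rw [hc]; exact serre_left _ _ _ _ hKK serre_eDA_eA
  case serre_eNA_eNDA =>
    simp only [map_serre, map_zero, FreeAlgebra.lift_ι_apply, comulGen]
    refine serreExpr_add _ _ hq _ _ _ _ ?_ ?_ ?_ ?_ ?_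
    · simp [eNAK]
    · simp [eNAK']
    · simp [eNDAK]
    · exact serre_right _ _ _ _ hKK serre_eNA_eNDA
    · exact serre_left 1 1 _ _ rfl serre_eNA_eNDA
  case serre_eNDA_eNA =>
    simp only [map_serre, map_zero, FreeAlgebra.lift_ι_apply, comulGen]
    refine serreExpr_add _ _ hq _ _ _ _ ?_ ?_ ?_ ?_ ?_
    · simp [eNDAK']
    · simp [eNDAK]
    · simp [eNAK']
    · exact serre_right _ _ _ _ hKK.symm serre_eNDA_eNA
    · exact serre_left 1 1 _ _ rfl serre_eNDA_eNA
  case eA_eNA =>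
    have h1 : ((q : R) - ↑q⁻¹) • ((gen R q .eA * gen R q .eNA) ⊗ₜ[R] gen R q .K
        - (gen R q .eNA * gen R q .eA) ⊗ₜ[R] gen R q .K)
        = gen R q .K ⊗ₜ gen R q .K - gen R q .K' ⊗ₜ gen R q .K := by
      rw [← TensorProduct.sub_tmul, TensorProduct.smul_tmul', eA_eNA, TensorProduct.sub_tmul]
    have h2 : ((q : R) - ↑q⁻¹) • (gen R q .K' ⊗ₜ[R] (gen R q .eA * gen R q .eNA)
        - gen R q .K' ⊗ₜ[R] (gen R q .eNA * gen R q .eA))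
        = gen R q .K' ⊗ₜ gen R q .K - gen R q .K' ⊗ₜ gen R q .K' := by
      rw [← TensorProduct.tmul_sub, ← TensorProduct.tmul_smul, eA_eNA, TensorProduct.tmul_sub]
    have h3 : (gen R q .K' * gen R q .eNA) ⊗ₜ[R] (gen R q .eA * gen R q .K)
        = (gen R q .eNA * gen R q .K') ⊗ₜ[R] (gen R q .K * gen R q .eA) := by
      rw [K'_eNA, eAK, TensorProduct.smul_tmul_smul, hq, one_smul]
    simp only [map_smul, map_sub, map_mul, FreeAlgebra.lift_ι_apply, comulGen, add_mul, mul_add,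
      Algebra.TensorProduct.tmul_mul_tmul, one_mul, mul_one, h3]
    refine Eq.trans ?_ ((congrArg₂ (· + ·) h1 h2).trans (sub_add_sub_cancel _ _ _))
    simp only [← smul_add]
    congr 1
    abel
  case eDA_eNDA =>
    have h1 : ((q : R) - ↑q⁻¹) • ((gen R q .eDA * gen R q .eNDA) ⊗ₜ[R] gen R q .K'
        - (gen R q .eNDA * gen R q .eDA) ⊗ₜ[R] gen R q .K')
        = gen R q .K' ⊗ₜ gen R q .K' - gen R q .K ⊗ₜ gen R q .K' := by
      rw [← TensorProduct.sub_tmul, TensorProduct.smul_tmul', eDA_eNDA, TensorProduct.sub_tmul]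
    have h2 : ((q : R) - ↑q⁻¹) • (gen R q .K ⊗ₜ[R] (gen R q .eDA * gen R q .eNDA)
        - gen R q .K ⊗ₜ[R] (gen R q .eNDA * gen R q .eDA))
        = gen R q .K ⊗ₜ gen R q .K' - gen R q .K ⊗ₜ gen R q .K := by
      rw [← TensorProduct.tmul_sub, ← TensorProduct.tmul_smul, eDA_eNDA, TensorProduct.tmul_sub]
    have h3 : (gen R q .K * gen R q .eNDA) ⊗ₜ[R] (gen R q .eDA * gen R q .K')
        = (gen R q .eNDA * gen R q .K) ⊗ₜ[R] (gen R q .K' * gen R q .eDA) := by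
      rw [K_eNDA, eDAK', TensorProduct.smul_tmul_smul, hq, one_smul]
    simp only [map_smul, map_sub, map_mul, FreeAlgebra.lift_ι_apply, comulGen, add_mul, mul_add,
      Algebra.TensorProduct.tmul_mul_tmul, one_mul, mul_one, h3]
    refine Eq.trans ?_ ((congrArg₂ (· + ·) h1 h2).trans (sub_add_sub_cancel _ _ _))
    simp only [← smul_add]
    congr 1
    abel
  case eA_eNDA =>
    simp only [map_mul, FreeAlgebra.lift_ι_apply, comulGen, add_mul, mul_add,
      Algebra.TensorProduct.tmul_mul_tmul, one_mul, mul_one, K'_eNDA, eAK', eA_eNDA,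
      TensorProduct.smul_tmul_smul, hq', one_smul]
    abel
  case eNA_eDA =>
    simp only [map_mul, FreeAlgebra.lift_ι_apply, comulGen, add_mul, mul_add,
      Algebra.TensorProduct.tmul_mul_tmul, one_mul, mul_one, eNA_eDA, K_eNA, eDAK,
      TensorProduct.smul_tmul_smul, hq', one_smul]
    abel
  all_goals simp [comulGen, mul_add, add_mul, K'_mul_K, K_eA, K_eNA, K_eDA, K_eNDA,
    TensorProduct.smul_tmul', hKK, Algebra.TensorProduct.one_def]

theorem counitGen_rel ⦃x y : FreeAlgebra R UqGen⦄ (h : UqRel R q x y) :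
    FreeAlgebra.lift R (counitGen R) x = FreeAlgebra.lift R (counitGen R) y := by
  cases h <;> simp [counitGen, serreExpr]

noncomputable instance instBialgebra (R : Type u) [CommRing R] (q : Rˣ) :
    Bialgebra R (Uq R q) :=
  Bialgebra.ofAlgHom (lift (comulGen R q) comulGen_rel) (lift (counitGen R) counitGen_rel)
    (hom_ext fun g => by
      cases g <;> simp [lift_gen, comulGen, TensorProduct.add_tmul, TensorProduct.tmul_add,
        Algebra.TensorProduct.one_def, add_assoc])
    (hom_ext fun g => by
      cases g <;> simp [lift_gen, comulGen, counitGen])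
    (hom_ext fun g => by
      cases g <;> simp [lift_gen, comulGen, counitGen])

end
end Uq

namespace Bq
section
variable {R A : Type*} [CommRing R] [Ring A] [Algebra R A] {s t η : R} {K K' H f g : A}

theorem aux_K' (hK' : K' = 1 + (t - 1) • H) :
    K' ⊗ₜ[R] K' = 1 + (t - 1) • (H ⊗ₜ[R] 1 + K' ⊗ₜ[R] H) := by
  rw [smul_add, TensorProduct.smul_tmul', ← TensorProduct.tmul_smul,
    show (t - 1) • H = K' - 1 by rw [hK']; abel, TensorProduct.sub_tmul, TensorProduct.tmul_sub,
    Algebra.TensorProduct.one_def]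
  abel

theorem aux_HK' (hK' : K' = 1 + (t - 1) • H) : H * K' = K' * H := by
  rw [hK']; simp [mul_add, add_mul]

theorem aux_K'f (hst : s * t = 1) (hKK' : K * K' = 1) (hK'K : K' * K = 1)
    (hKf : K * f = t • (f * K)) : K' * f = s • (f * K') := by
  have : K' * (K * f) * K' = t • (K' * f) := by
    rw [hKf, mul_smul_comm, smul_mul_assoc, mul_assoc, mul_assoc, hKK', mul_one]
  rw [← mul_assoc, hK'K, one_mul] at this
  rw [this, smul_smul, hst, one_smul]

theorem aux_Hf (hst : s * t = 1) (hKK' : K * K' = 1) (hK'K : K' * K = 1)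
    (hK' : K' = 1 + (t - 1) • H) (hKf : K * f = t • (f * K)) (hHf : H * f = s • (f * H - f)) :
    (H ⊗ₜ[R] 1 + K' ⊗ₜ[R] H) * (f ⊗ₜ[R] 1 + K' ⊗ₜ[R] f) =
    s • ((f ⊗ₜ[R] 1 + K' ⊗ₜ[R] f) * (H ⊗ₜ[R] 1 + K' ⊗ₜ[R] H) - (f ⊗ₜ[R] 1 + K' ⊗ₜ[R] f)) := by
  have hHK' : H * K' = K' * H := aux_HK' hK'
  have hK'f : K' * f = s • (f * K') := aux_K'f hst hKK' hK'K hKf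
  have h1 : (K' * K') ⊗ₜ[R] f = K' ⊗ₜ f + (t - 1) • (K' * H) ⊗ₜ f := by
    nth_rw 2 [hK']
    rw [mul_add, mul_one, mul_smul_comm, TensorProduct.add_tmul, TensorProduct.smul_tmul']
  simp only [mul_add, add_mul, Algebra.TensorProduct.tmul_mul_tmul, one_mul,
    mul_one, hHf, hHK', hK'f, TensorProduct.tmul_smul, ← TensorProduct.smul_tmul',
    TensorProduct.tmul_sub, TensorProduct.sub_tmul, h1]
  match_scalars <;> first | ring1 | (clear * -hst; grind)

theorem aux_HZ (hKK' : K * K' = 1) (hK'K : K' * K = 1) (hK' : K' = 1 + (t - 1) • H)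
    (hHK : H * K = K * H) :
    H * (1 + K) * K' = K' * (H * (1 + K)) ∧ H * (1 + K) * H = H * (H * (1 + K)) := by
  have hHK' : H * K' = K' * H := aux_HK' hK'
  constructor
  · rw [← mul_assoc, ← hHK', mul_assoc, mul_assoc, add_mul, mul_add, hKK', one_mul, mul_add, hK'K,
      mul_one, mul_add, mul_one, mul_one]
  · rw [mul_assoc, add_mul, ← hHK, mul_add, mul_add, mul_add, one_mul, mul_one]

theorem aux_Hg (hst : s * t = 1) (hKK' : K * K' = 1) (hK'K : K' * K = 1)
    (hK' : K' = 1 + (t - 1) • H) (hHK : H * K = K * H) (hHf : H * f = s • (f * H - f))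
    (hHg : H * g = s • (g * H - g)) :
    (H ⊗ₜ[R] 1 + K' ⊗ₜ[R] H) * (g ⊗ₜ[R] 1 + K ⊗ₜ[R] g + η • (H * (1 + K)) ⊗ₜ[R] f) =
    s • ((g ⊗ₜ[R] 1 + K ⊗ₜ[R] g + η • (H * (1 + K)) ⊗ₜ[R] f) * (H ⊗ₜ[R] 1 + K' ⊗ₜ[R] H)
      - (g ⊗ₜ[R] 1 + K ⊗ₜ[R] g + η • (H * (1 + K)) ⊗ₜ[R] f)) := by
  have h1 : (1 : A) ⊗ₜ[R] g = K ⊗ₜ g + (t - 1) • (K * H) ⊗ₜ g := by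
    rw [← hK'K]; nth_rw 1 [hK']
    rw [add_mul, one_mul, smul_mul_assoc, TensorProduct.add_tmul, TensorProduct.smul_tmul', hHK]
  have h1' : (1 : A) ⊗ₜ[R] (g * H) = K ⊗ₜ (g * H) + (t - 1) • (K * H) ⊗ₜ (g * H) := by
    rw [← hK'K]; nth_rw 1 [hK']
    rw [add_mul, one_mul, smul_mul_assoc, TensorProduct.add_tmul, TensorProduct.smul_tmul', hHK]
  obtain ⟨hZK', hZH⟩ := aux_HZ hKK' hK'K hK' hHK
  have hHK' : H * K' = K' * H := aux_HK' hK'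
  have hK'g : (K' * g) ⊗ₜ[R] H = s • (g * K') ⊗ₜ[R] H := by
    rw [hK', add_mul, smul_mul_assoc, hHg, mul_add, mul_smul_comm, one_mul, mul_one]
    simp only [TensorProduct.add_tmul, TensorProduct.sub_tmul, ← TensorProduct.smul_tmul']
    match_scalars <;> first | ring1 | (clear * -hst; grind)
  generalize hZ : H * (1 + K) = Z at *
  have h2 : (K' * Z) ⊗ₜ[R] f = Z ⊗ₜ f + (t - 1) • (H * Z) ⊗ₜ f := by
    rw [hK', add_mul, one_mul, smul_mul_assoc, TensorProduct.add_tmul, TensorProduct.smul_tmul']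
  simp only [mul_add, add_mul, Algebra.TensorProduct.tmul_mul_tmul, one_mul,
    mul_one, hHf, hHg, hHK, hK'g, TensorProduct.tmul_smul, ← TensorProduct.smul_tmul',
    TensorProduct.tmul_sub, TensorProduct.sub_tmul, h1, h1', mul_smul_comm, smul_mul_assoc, hK'K,
    hKK', hZK', hZH, h2]
  match_scalars <;> first | ring1 | (clear * -hst; grind)

theorem aux_Z (hK'K : K' * K = 1) (hK' : K' = 1 + (t - 1) • H) :
    (H ⊗ₜ[R] 1 + K' ⊗ₜ[R] H) * (1 + K ⊗ₜ[R] K)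
      = (H * (1 + K)) ⊗ₜ[R] K' + K ⊗ₜ[R] (H * (1 + K)) := by
  have hHK' : H * K' = K' * H := aux_HK' hK'
  have h1 : K = 1 - (t - 1) • (H * K) := by
    have : (1 : A) = K + (t - 1) • (H * K) := by
      rw [← hK'K]; nth_rw 1 [hK']
      rw [add_mul, one_mul, smul_mul_assoc]
    rw [this]; abel
  have e1 : H ⊗ₜ[R] K' = H ⊗ₜ[R] 1 + (t - 1) • H ⊗ₜ[R] H := by
    rw [hK', TensorProduct.tmul_add, TensorProduct.tmul_smul]
  have e2 : K' ⊗ₜ[R] H = 1 ⊗ₜ[R] H + (t - 1) • H ⊗ₜ[R] H := by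
    rw [hK', TensorProduct.add_tmul, TensorProduct.smul_tmul']
  have e3 : (H * K) ⊗ₜ[R] K' = (H * K) ⊗ₜ[R] 1 + (t - 1) • (H * K) ⊗ₜ[R] H := by
    rw [hK', TensorProduct.tmul_add, TensorProduct.tmul_smul]
  have e4 : K ⊗ₜ[R] H = 1 ⊗ₜ[R] H - (t - 1) • (H * K) ⊗ₜ[R] H := by
    nth_rw 1 [h1]; rw [TensorProduct.sub_tmul, TensorProduct.smul_tmul']
  have e5 : (H * K) ⊗ₜ[R] K = (H * K) ⊗ₜ[R] 1 - (t - 1) • (H * K) ⊗ₜ[R] (H * K) := by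
    nth_rw 2 [h1]; rw [TensorProduct.tmul_sub, TensorProduct.tmul_smul]
  have e6 : K ⊗ₜ[R] (H * K) = 1 ⊗ₜ[R] (H * K) - (t - 1) • (H * K) ⊗ₜ[R] (H * K) := by
    nth_rw 1 [h1]; rw [TensorProduct.sub_tmul, TensorProduct.smul_tmul']
  simp only [mul_add, add_mul, mul_one, one_mul, Algebra.TensorProduct.tmul_mul_tmul, hK'K,
    TensorProduct.tmul_add, TensorProduct.add_tmul]
  rw [e1, e2, e3, e4, e5, e6]
  module

theorem aux_gf (hst : s * t = 1) (hKK' : K * K' = 1) (hK'K : K' * K = 1)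
    (hK' : K' = 1 + (t - 1) • H) (hHK : H * K = K * H)
    (hKf : K * f = t • (f * K)) (hKg : K * g = t • (g * K))
    (hHf : H * f = s • (f * H - f)) (hgf : g * f = t • (f * g) - η • f ^ 2) :
    (g ⊗ₜ[R] 1 + K ⊗ₜ[R] g + η • (H * (1 + K)) ⊗ₜ[R] f) * (f ⊗ₜ[R] 1 + K' ⊗ₜ[R] f) =
    t • ((f ⊗ₜ[R] 1 + K' ⊗ₜ[R] f) * (g ⊗ₜ[R] 1 + K ⊗ₜ[R] g + η • (H * (1 + K)) ⊗ₜ[R] f))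
      - η • (f ⊗ₜ[R] 1 + K' ⊗ₜ[R] f) ^ 2 := by
  have hHK' : H * K' = K' * H := aux_HK' hK'
  have hK'f : K' * f = s • (f * K') := aux_K'f hst hKK' hK'K hKf
  have hK'g : K' * g = s • (g * K') := aux_K'f hst hKK' hK'K hKg
  have h1 : K = 1 - (t - 1) • (H * K) := by
    have : (1 : A) = K + (t - 1) • (H * K) := by
      rw [← hK'K]; nth_rw 1 [hK']
      rw [add_mul, one_mul, smul_mul_assoc]
    rw [this]; abel
  have hZf : H * (1 + K) * f = t • (f * (H * (1 + K))) - (1 + s) • (f * K') := by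
    have e1 : H * K * f = t • (s • (f * (H * K) - f * K)) := by
      rw [mul_assoc, hKf, mul_smul_comm, ← mul_assoc, hHf, smul_mul_assoc, sub_mul, mul_assoc]
    rw [mul_add, mul_one, add_mul, e1, hHf, hK']
    nth_rw 2 [h1]
    simp only [mul_add, mul_sub, mul_smul_comm, mul_one]
    match_scalars <;> first | ring1 | (clear * -hst; grind)
  have hZK : (H * (1 + K) * K') ⊗ₜ[R] (f ^ 2) =
      t • ((K' * (H * (1 + K))) ⊗ₜ[R] (f ^ 2)) + 1 ⊗ₜ (f ^ 2) - (K' ^ 2) ⊗ₜ (f ^ 2) := by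
    rw [(aux_HZ hKK' hK'K hK' hHK).1, ← mul_assoc, ← hHK', mul_assoc, mul_add, mul_one, hK'K]
    have : K' ^ 2 = 1 + (t - 1) • (H * (K' + 1)) := by
      rw [pow_two]; nth_rw 1 [hK']
      rw [add_mul, one_mul, smul_mul_assoc, mul_add, mul_one]
      nth_rw 1 [hK']
      module
    rw [this]
    simp only [TensorProduct.add_tmul, ← TensorProduct.smul_tmul']
    module
  generalize H * (1 + K) = Z at *
  simp only [mul_add, add_mul, Algebra.TensorProduct.tmul_mul_tmul, one_mul, pow_two,
    mul_one, hgf, hZf, TensorProduct.tmul_smul, ← TensorProduct.smul_tmul',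
    TensorProduct.tmul_sub, TensorProduct.sub_tmul, mul_smul_comm, smul_mul_assoc, hK'K,
    hKK', hK'f, hK'g, hKf] at hZK ⊢
  rw [hZK]
  match_scalars <;> first | ring1 | (clear * -hst; grind)

end
end Bq

/-- Names of generators: `K = q^h`, `K' = q^{-h}`, `H = (h/2)_{q^{-2}} = (q^{-h} - 1)/(q^{-2} - 1)`,
`f0`, `f1`. -/
inductive BqGen
  | K | K' | H | f0 | f1

/-- The generators in the free algebra. -/
abbrev bqι (R : Type u) [CommRing R] (g : BqGen) : FreeAlgebra R BqGen := FreeAlgebra.ι R g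

/-- Defining relations of the Hopf algebra generated by `h, f₁, f₀`, in a form that makes sense for
every invertible `q`, including `q = 1` (where `K = K' = 1` and `H = h/2`).  The relations
`[h, fᵢ] = -2 fᵢ` read `K fᵢ = q⁻² fᵢ K` and `H fᵢ = q² fᵢ (H - 1)`. -/
inductive BqRel (R : Type u) [CommRing R] (q : Rˣ) (η : R) :
    FreeAlgebra R BqGen → FreeAlgebra R BqGen → Prop
  | K_mul_K' : BqRel R q η (bqι R .K * bqι R .K') 1
  | K'_mul_K : BqRel R q η (bqι R .K' * bqι R .K) 1
  | K'_eq : BqRel R q η (bqι R .K') (1 + ((↑q⁻¹ : R) ^ 2 - 1) • bqι R .H)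
  | H_K : BqRel R q η (bqι R .H * bqι R .K) (bqι R .K * bqι R .H)
  | K_f0 : BqRel R q η (bqι R .K * bqι R .f0) ((↑q⁻¹ : R) ^ 2 • (bqι R .f0 * bqι R .K))
  | K_f1 : BqRel R q η (bqι R .K * bqι R .f1) ((↑q⁻¹ : R) ^ 2 • (bqι R .f1 * bqι R .K))
  | H_f0 : BqRel R q η (bqι R .H * bqι R .f0) ((q : R) ^ 2 • (bqι R .f0 * bqι R .H - bqι R .f0))
  | H_f1 : BqRel R q η (bqι R .H * bqι R .f1) ((q : R) ^ 2 • (bqι R .f1 * bqι R .H - bqι R .f1))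
  | f1_f0 : BqRel R q η (bqι R .f1 * bqι R .f0)
      ((↑q⁻¹ : R) ^ 2 • (bqι R .f0 * bqι R .f1) - η • bqι R .f0 ^ 2)

/-- The algebra generated by `h, f₁, f₀` (with `q^{±h}` and `(h/2)_{q^{-2}}`). -/
def Bq (R : Type u) [CommRing R] (q : Rˣ) (η : R) : Type u := RingQuot (BqRel R q η)

namespace Bq

section
variable (R : Type u) [CommRing R] (q : Rˣ) (η : R)

noncomputable instance instRing : Ring (Bq R q η) :=
  inferInstanceAs (Ring (RingQuot (BqRel R q η)))

noncomputable instance instAlgebra {S : Type*} [CommRing S] [Algebra S R] :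
    Algebra S (Bq R q η) :=
  inferInstanceAs (Algebra S (RingQuot (BqRel R q η)))

/-- The generators as elements of the algebra. -/
noncomputable def gen (g : BqGen) : Bq R q η :=
  RingQuot.mkAlgHom R (BqRel R q η) (FreeAlgebra.ι R g)

variable {R q η}

/-- Universal property. -/
noncomputable def lift {A : Type*} [Ring A] [Algebra R A] (f : BqGen → A)
    (hf : ∀ ⦃x y⦄, BqRel R q η x y → FreeAlgebra.lift R f x = FreeAlgebra.lift R f y) :
    Bq R q η →ₐ[R] A :=
  RingQuot.liftAlgHom R ⟨FreeAlgebra.lift R f, hf⟩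

theorem lift_gen {A : Type*} [Ring A] [Algebra R A] (f : BqGen → A)
    (hf : ∀ ⦃x y⦄, BqRel R q η x y → FreeAlgebra.lift R f x = FreeAlgebra.lift R f y)
    (g : BqGen) : lift f hf (gen R q η g) = f g :=
  (RingQuot.liftAlgHom_mkAlgHom_apply R (FreeAlgebra.lift R f) hf (FreeAlgebra.ι R g)).trans
    (FreeAlgebra.lift_ι_apply f g)

theorem hom_ext {A : Type*} [Ring A] [Algebra R A] {f g : Bq R q η →ₐ[R] A}
    (h : ∀ x, f (gen R q η x) = g (gen R q η x)) : f = g :=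
  RingQuot.ringQuot_ext' R f g (FreeAlgebra.hom_ext (funext h))

theorem rel {x y : FreeAlgebra R BqGen} (h : BqRel R q η x y) :
    FreeAlgebra.lift R (gen R q η) x = FreeAlgebra.lift R (gen R q η) y := by
  have e : (FreeAlgebra.lift R (gen R q η) : FreeAlgebra R BqGen →ₐ[R] Bq R q η)
      = RingQuot.mkAlgHom R (BqRel R q η) :=
    FreeAlgebra.hom_ext (funext fun g => FreeAlgebra.lift_ι_apply _ g)
  rw [e]
  exact RingQuot.mkAlgHom_rel R h

theorem K_mul_K' : gen R q η .K * gen R q η .K' = 1 := by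
  simpa using rel (BqRel.K_mul_K' (R := R) (q := q) (η := η))
theorem K'_mul_K : gen R q η .K' * gen R q η .K = 1 := by
  simpa using rel (BqRel.K'_mul_K (R := R) (q := q) (η := η))
theorem K'_eq : gen R q η .K' = 1 + ((↑q⁻¹ : R) ^ 2 - 1) • gen R q η .H := by
  simpa only [map_add, map_one, map_smul, FreeAlgebra.lift_ι_apply]
    using rel (BqRel.K'_eq (R := R) (q := q) (η := η))
theorem H_K : gen R q η .H * gen R q η .K = gen R q η .K * gen R q η .H := by
  simpa using rel (BqRel.H_K (R := R) (q := q) (η := η))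
theorem K_f0 : gen R q η .K * gen R q η .f0 = (↑q⁻¹ : R) ^ 2 • (gen R q η .f0 * gen R q η .K) := by
  simpa using rel (BqRel.K_f0 (R := R) (q := q) (η := η))
theorem K_f1 : gen R q η .K * gen R q η .f1 = (↑q⁻¹ : R) ^ 2 • (gen R q η .f1 * gen R q η .K) := by
  simpa using rel (BqRel.K_f1 (R := R) (q := q) (η := η))
theorem H_f0 : gen R q η .H * gen R q η .f0
    = (q : R) ^ 2 • (gen R q η .f0 * gen R q η .H - gen R q η .f0) := by
  simpa only [map_sub, map_mul, map_smul, FreeAlgebra.lift_ι_apply]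
    using rel (BqRel.H_f0 (R := R) (q := q) (η := η))
theorem H_f1 : gen R q η .H * gen R q η .f1
    = (q : R) ^ 2 • (gen R q η .f1 * gen R q η .H - gen R q η .f1) := by
  simpa only [map_sub, map_mul, map_smul, FreeAlgebra.lift_ι_apply]
    using rel (BqRel.H_f1 (R := R) (q := q) (η := η))
theorem f1_f0 : gen R q η .f1 * gen R q η .f0
    = (↑q⁻¹ : R) ^ 2 • (gen R q η .f0 * gen R q η .f1) - η • gen R q η .f0 ^ 2 := by
  simpa only [map_sub, map_mul, map_smul, map_pow, FreeAlgebra.lift_ι_apply]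
    using rel (BqRel.f1_f0 (R := R) (q := q) (η := η))

variable (R q η) in
/-- Values of the comultiplication on generators; note that
`q^h (h)_{q^{-2}} = H (1 + K)`. -/
noncomputable def comulGen : BqGen → Bq R q η ⊗[R] Bq R q η
  | .K => gen R q η .K ⊗ₜ gen R q η .K
  | .K' => gen R q η .K' ⊗ₜ gen R q η .K'
  | .H => gen R q η .H ⊗ₜ 1 + gen R q η .K' ⊗ₜ gen R q η .H
  | .f0 => gen R q η .f0 ⊗ₜ 1 + gen R q η .K' ⊗ₜ gen R q η .f0
  | .f1 => gen R q η .f1 ⊗ₜ 1 + gen R q η .K ⊗ₜ gen R q η .f1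
      + η • (gen R q η .H * (1 + gen R q η .K)) ⊗ₜ gen R q η .f0

/-- Values of the counit on generators. -/
def counitGen (R : Type u) [CommRing R] : BqGen → R
  | .K => 1
  | .K' => 1
  | _ => 0

theorem comulGen_rel ⦃x y : FreeAlgebra R BqGen⦄ (h : BqRel R q η x y) :
    FreeAlgebra.lift R (comulGen R q η) x = FreeAlgebra.lift R (comulGen R q η) y := by
  have hst : (q : R) ^ 2 * (↑q⁻¹ : R) ^ 2 = 1 := by rw [← mul_pow, Units.mul_inv, one_pow]
  have hKK' := K_mul_K' (R := R) (q := q) (η := η)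
  have hK'K := K'_mul_K (R := R) (q := q) (η := η)
  have hK' := K'_eq (R := R) (q := q) (η := η)
  have hHK := H_K (R := R) (q := q) (η := η)
  have hHK' := aux_HK' hK'
  obtain ⟨hZK', hZH⟩ := aux_HZ hKK' hK'K hK' hHK
  cases h <;> simp only [map_sub, map_add, map_one, map_mul, map_smul, map_pow,
    FreeAlgebra.lift_ι_apply, comulGen]
  case K_mul_K' => simp [hKK', Algebra.TensorProduct.one_def]
  case K'_mul_K => simp [hK'K, Algebra.TensorProduct.one_def]
  case K'_eq => exact aux_K' hK'
  case H_K => simp [mul_add, add_mul, hHK, hKK', hK'K]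
  case K_f0 => simp [mul_add, add_mul, K_f0, hKK', hK'K, TensorProduct.smul_tmul']
  case K_f1 =>
    have hZ : gen R q η .K * (gen R q η .H * (1 + gen R q η .K))
        = gen R q η .H * (1 + gen R q η .K) * gen R q η .K := by
      rw [← mul_assoc, ← hHK, mul_assoc, mul_assoc, mul_add, add_mul, one_mul, mul_one]
    generalize gen R q η .H * (1 + gen R q η .K) = Z at hZ
    simp only [mul_add, add_mul, Algebra.TensorProduct.tmul_mul_tmul, smul_add, mul_one, one_mul,
      K_f1, K_f0, TensorProduct.tmul_smul, ← TensorProduct.smul_tmul', mul_smul_comm,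
      smul_mul_assoc, smul_comm η, hZ]
  case H_f0 => exact aux_Hf hst hKK' hK'K hK' K_f0 H_f0
  case H_f1 => exact aux_Hg hst hKK' hK'K hK' hHK H_f0 H_f1
  case f1_f0 => exact aux_gf hst hKK' hK'K hK' hHK K_f0 K_f1 H_f0 f1_f0

theorem counitGen_rel ⦃x y : FreeAlgebra R BqGen⦄ (h : BqRel R q η x y) :
    FreeAlgebra.lift R (counitGen R) x = FreeAlgebra.lift R (counitGen R) y := by
  cases h <;> simp [counitGen]

end

noncomputable instance instBialgebra (R : Type u) [CommRing R] (q : Rˣ) (η : R) :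
    Bialgebra R (Bq R q η) :=
  Bialgebra.ofAlgHom (lift (comulGen R q η) comulGen_rel) (lift (counitGen R) counitGen_rel)
    (hom_ext fun g => by
      cases g
      case f1 =>
        have hZ := aux_Z (R := R) (K'_mul_K (R := R) (q := q) (η := η)) K'_eq
        simp only [AlgHom.comp_apply, lift_gen, comulGen, map_add, map_smul,
          Algebra.TensorProduct.map_tmul, map_mul, map_one, AlgHom.id_apply, hZ,
          TensorProduct.add_tmul, TensorProduct.tmul_add, TensorProduct.tmul_smul,
          ← TensorProduct.smul_tmul', smul_add]
        simp [Algebra.TensorProduct.one_def]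
        abel
      all_goals simp [lift_gen, comulGen, TensorProduct.add_tmul, TensorProduct.tmul_add,
        Algebra.TensorProduct.one_def, add_assoc])
    (hom_ext fun g => by
      cases g <;> simp [lift_gen, comulGen, counitGen])
    (hom_ext fun g => by
      cases g <;> simp [lift_gen, comulGen, counitGen])

end Bq

section
/-- `(T_kj(u) T_il(v) - T_kj(v) T_il(u)) / η`, where `T_ij = δ_ij + η a_ij(u)`; `a = a(u)`, `a' = a(v)`. -/
def yRho {R A : Type*} [CommRing R] [Ring A] [Algebra R A] (η : R) (a a' : Fin 2 → Fin 2 → A)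
    (i j k l : Fin 2) : A :=
  η • (a k j * a' i l - a' k j * a i l) + (if k = j then a' i l - a i l else 0)
    + (if i = l then a k j - a' k j else 0)

variable {R A : Type*} [CommRing R] [Ring A] [Algebra R A]

def yMul (η : R) (a b : Fin 2 → Fin 2 → A) (i j : Fin 2) : A :=
  a i j + b i j + η • (a i 0 * b 0 j + a i 1 * b 1 j)

def yOne (η : R) (a : Fin 2 → Fin 2 → A) (i j : Fin 2) : A :=
  (if i = j then 1 else 0) + η • a i j

set_option maxHeartbeats 4000000 in
theorem yMul_comm (η : R) (a a' b b' : Fin 2 → Fin 2 → A)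
    (h2 : ∀ i j k l, b' i j * a k l = a k l * b' i j)
    (h3 : ∀ i j k l, b i j * a' k l = a' k l * b i j) (i j k l : Fin 2) :
    yMul η a b i j * yMul η a' b' k l - yMul η a' b' k l * yMul η a b i j
    = ∑ m, ∑ n, ((a i m * a' k n - a' k n * a i m) * (yOne η b m j * yOne η b' n l)
       + yOne η a' k n * yOne η a i m * (b m j * b' n l - b' n l * b m j)) := by
  have h2' : ∀ i j k l z, b' i j * (a k l * z) = a k l * (b' i j * z) := fun i j k l z => by
    rw [← mul_assoc, h2, mul_assoc]
  have h3' : ∀ i j k l z, b i j * (a' k l * z) = a' k l * (b i j * z) := fun i j k l z => by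
    rw [← mul_assoc, h3, mul_assoc]
  simp only [yMul, yOne, Fin.sum_univ_two]
  fin_cases i <;> fin_cases j <;> fin_cases k <;> fin_cases l <;>
  simp only [Fin.zero_eta, Fin.mk_one, Fin.isValue, if_true, if_false, zero_ne_one, one_ne_zero, 
    mul_add, add_mul, sub_mul, mul_sub, mul_one, one_mul, zero_add, smul_mul_assoc, mul_smul_comm, smul_add, smul_sub, smul_smul,
    mul_assoc, h2, h3, h2', h3'] <;> abel

set_option maxHeartbeats 4000000 in
theorem yMul_rho (η : R) (a a' b b' : Fin 2 → Fin 2 → A)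
    (h2 : ∀ i j k l, b' i j * a k l = a k l * b' i j)
    (h3 : ∀ i j k l, b i j * a' k l = a' k l * b i j) (i j k l : Fin 2) :
    ∑ m, ∑ n, (yRho η a a' i m k n * (yOne η b m j * yOne η b' n l)
       + yOne η a' k n * yOne η a i m * yRho η b b' m j n l)
    = yRho η (yMul η a b) (yMul η a' b') i j k l := by
  have h2' : ∀ i j k l z, b' i j * (a k l * z) = a k l * (b' i j * z) := fun i j k l z => by
    rw [← mul_assoc, h2, mul_assoc]
  have h3' : ∀ i j k l z, b i j * (a' k l * z) = a' k l * (b i j * z) := fun i j k l z => by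
    rw [← mul_assoc, h3, mul_assoc]
  simp only [yMul, yOne, Fin.sum_univ_two, yRho]
  fin_cases i <;> fin_cases j <;> fin_cases k <;> fin_cases l <;>
  simp only [Fin.zero_eta, Fin.mk_one, Fin.isValue, if_true, if_false, zero_ne_one, one_ne_zero, 
    mul_add, add_mul, sub_mul, mul_sub, mul_one, one_mul, zero_add, add_zero, smul_mul_assoc, mul_smul_comm, smul_add, smul_sub, smul_smul,
    mul_assoc, h2, h3, h2', h3'] <;> abel

theorem yRel_mul {η : R} {a a' b b' : Fin 2 → Fin 2 → A}
    (h2 : ∀ i j k l, b' i j * a k l = a k l * b' i j)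
    (h3 : ∀ i j k l, b i j * a' k l = a' k l * b i j) {d w : A}
    (hd : ∀ x, d * x = x * d) (hw : ∀ x, w * x = x * w)
    (ha : ∀ i j k l, d * (a i j * a' k l - a' k l * a i j) = w * yRho η a a' i j k l)
    (hb : ∀ i j k l, d * (b i j * b' k l - b' k l * b i j) = w * yRho η b b' i j k l)
    (i j k l : Fin 2) :
    d * (yMul η a b i j * yMul η a' b' k l - yMul η a' b' k l * yMul η a b i j)
      = w * yRho η (yMul η a b) (yMul η a' b') i j k l := by
  rw [yMul_comm η a a' b b' h2 h3, ← yMul_rho η a a' b b' h2 h3, Finset.mul_sum, Finset.mul_sum]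
  refine Finset.sum_congr rfl fun m _ => ?_
  rw [Finset.mul_sum, Finset.mul_sum]
  refine Finset.sum_congr rfl fun n _ => ?_
  rw [mul_add, mul_add, ← mul_assoc, ha, ← mul_assoc d (yOne _ _ _ _ * _), hd, mul_assoc _ d, hb,
    ← mul_assoc _ w, ← hw, mul_assoc w, mul_assoc w]
end

section
variable {R A : Type*} [CommRing R] [Ring A] [Algebra R A]
open PowerSeries

/-- All the commutation relations in one formula. -/
def YComm (η : R) (t : Fin 2 → Fin 2 → ℕ → A) : Prop :=
  (∀ i j, t i j 0 = 0) ∧ ∀ i j k l r s,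
    (t i j (r + 1) * t k l s - t k l s * t i j (r + 1))
      - (t i j r * t k l (s + 1) - t k l (s + 1) * t i j r)
    = η • (t k j r * t i l s - t k j s * t i l r)
      + (if k = j then (if r = 0 then t i l s else 0) - (if s = 0 then t i l r else 0) else 0)
      + (if i = l then (if s = 0 then t k j r else 0) - (if r = 0 then t k j s else 0) else 0)

noncomputable def ySerU (f : A⟦X⟧) : A⟦X⟧⟦X⟧ := C f
noncomputable def ySerV (f : A⟦X⟧) : A⟦X⟧⟦X⟧ := map (C (R := A)) f

theorem cf_UV (f g : A⟦X⟧) (r s : ℕ) :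
    coeff r (coeff s (ySerU f * ySerV g)) = coeff r f * coeff s g := by
  simp [ySerU, ySerV, coeff_C_mul, coeff_mul_C]
theorem cf_VU (f g : A⟦X⟧) (r s : ℕ) :
    coeff r (coeff s (ySerV g * ySerU f)) = coeff s g * coeff r f := by
  simp [ySerU, ySerV, coeff_C_mul, coeff_mul_C]
theorem cf_U (f : A⟦X⟧) (r s : ℕ) :
    coeff r (coeff s (ySerU f)) = if s = 0 then coeff r f else 0 := by
  simp only [ySerU, coeff_C]; split_ifs <;> simp
theorem cf_V (f : A⟦X⟧) (r s : ℕ) :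
    coeff r (coeff s (ySerV f)) = if r = 0 then coeff s f else 0 := by
  simp only [ySerV, coeff_map, coeff_C]

theorem cf_ite (p : Prop) [Decidable p] (F : A⟦X⟧⟦X⟧) (r s : ℕ) :
    coeff r (coeff s (if p then F else 0)) = if p then coeff r (coeff s F) else 0 := by
  split_ifs <;> simp
theorem cf_XX (F : A⟦X⟧⟦X⟧) (r s : ℕ) :
    coeff (r + 1) (coeff (s + 1) ((C X * X) * F)) = coeff r (coeff s F) := by
  rw [mul_assoc, coeff_C_mul, coeff_succ_X_mul, coeff_succ_X_mul]
theorem cf_D (F : A⟦X⟧⟦X⟧) (r s : ℕ) :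
    coeff (r + 1) (coeff (s + 1) ((X - C X) * F))
      = coeff (r + 1) (coeff s F) - coeff r (coeff (s + 1) F) := by
  rw [sub_mul, map_sub, map_sub, coeff_C_mul, coeff_succ_X_mul, coeff_succ_X_mul]
theorem cf_D0 (F : A⟦X⟧⟦X⟧) (s : ℕ) :
    coeff 0 (coeff (s + 1) ((X - C X) * F)) = coeff 0 (coeff s F) := by
  rw [sub_mul, map_sub, map_sub, coeff_C_mul, coeff_succ_X_mul, coeff_zero_X_mul, sub_zero]
theorem cf_D0' (F : A⟦X⟧⟦X⟧) (r : ℕ) :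
    coeff (r + 1) (coeff 0 ((X - C X) * F)) = - coeff r (coeff 0 F) := by
  rw [sub_mul, map_sub, map_sub, coeff_C_mul, coeff_succ_X_mul, coeff_zero_X_mul, map_zero, zero_sub]
theorem cf_D00 (F : A⟦X⟧⟦X⟧) :
    coeff 0 (coeff 0 ((X - C X) * F)) = 0 := by
  rw [sub_mul, map_sub, map_sub, coeff_C_mul, coeff_zero_X_mul, coeff_zero_X_mul, map_zero, zero_sub, neg_zero]
theorem cf_XX0 (F : A⟦X⟧⟦X⟧) (s : ℕ) : coeff 0 (coeff s ((C X * X) * F)) = 0 := by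
  rw [mul_assoc, coeff_C_mul, coeff_zero_X_mul]
theorem cf_XX0' (F : A⟦X⟧⟦X⟧) (r : ℕ) : coeff r (coeff 0 ((C X * X) * F)) = 0 := by
  rw [mul_assoc, coeff_C_mul, coeff_zero_X_mul, mul_zero, map_zero]

theorem cf_rho (η : R) (f : Fin 2 → Fin 2 → A⟦X⟧) (i j k l : Fin 2) (r s : ℕ) :
    coeff r (coeff s (yRho η (fun i j => ySerU (f i j)) (fun i j => ySerV (f i j)) i j k l))
    = η • (coeff r (f k j) * coeff s (f i l) - coeff s (f k j) * coeff r (f i l))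
      + (if k = j then (if r = 0 then coeff s (f i l) else 0)
          - (if s = 0 then coeff r (f i l) else 0) else 0)
      + (if i = l then (if s = 0 then coeff r (f k j) else 0)
          - (if r = 0 then coeff s (f k j) else 0) else 0) := by
  have hs : ∀ F : A⟦X⟧⟦X⟧, coeff r (coeff s (η • F)) = η • coeff r (coeff s F) := fun F => rfl
  simp only [yRho, map_add, hs, map_sub, cf_ite, cf_UV, cf_VU, cf_U, cf_V]

theorem yComm_iff (η : R) (f : Fin 2 → Fin 2 → A⟦X⟧) (h0 : ∀ i j, coeff 0 (f i j) = 0) :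
    YComm η (fun i j n => coeff n (f i j)) ↔
    ∀ i j k l, (X - C X) * (ySerU (f i j) * ySerV (f k l) - ySerV (f k l) * ySerU (f i j))
      = (C X * X) * yRho η (fun i j => ySerU (f i j)) (fun i j => ySerV (f i j)) i j k l := by
  constructor
  · rintro h i j k l
    ext s r
    cases s <;> cases r <;> simp only [cf_D, cf_D0, cf_D0', cf_D00, cf_XX, cf_XX0, cf_XX0',
      map_sub, cf_UV, cf_VU, h0, zero_mul, mul_zero, sub_self, neg_zero, cf_rho]
    exact h.2 i j k l _ _
  · intro h
    refine ⟨h0, fun i j k l r s => ?_⟩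
    have h' := congrArg (fun F => coeff (r + 1) (coeff (s + 1) F)) (h i j k l)
    simp only [cf_D, cf_XX, map_sub, cf_UV, cf_VU, cf_rho] at h'
    exact h'

/-- The relations for a product of two commuting matrices. -/
theorem yComm_mul {η : R} {f g : Fin 2 → Fin 2 → A⟦X⟧}
    (f0 : ∀ i j, coeff 0 (f i j) = 0) (g0 : ∀ i j, coeff 0 (g i j) = 0)
    (hfg : ∀ i j k l r s, Commute (coeff r (f i j)) (coeff s (g k l)))
    (hf : YComm η (fun i j n => coeff n (f i j))) (hg : YComm η (fun i j n => coeff n (g i j))) :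
    YComm η (fun i j n => coeff n (yMul η f g i j)) := by
  have hU : ∀ i j, ySerU (yMul η f g i j)
      = yMul η (fun i j => ySerU (f i j)) (fun i j => ySerU (g i j)) i j := fun i j => by
    ext s r
    simp only [yMul, map_add, ySerU]
    simp only [coeff_C, coeff_smul, ← map_mul, ← map_add]
    split_ifs <;> simp
  have hV : ∀ i j, ySerV (yMul η f g i j)
      = yMul η (fun i j => ySerV (f i j)) (fun i j => ySerV (g i j)) i j := fun i j => by
    ext s r
    simp only [yMul, map_add, ySerV]
    simp only [coeff_smul, ← map_mul, ← map_add, coeff_map, coeff_C]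
    split_ifs <;> simp
  rw [yComm_iff _ _ f0] at hf
  rw [yComm_iff _ _ g0] at hg
  rw [yComm_iff _ _ (fun i j => by
    simp [yMul, coeff_zero_eq_constantCoeff, map_mul] 
    simp [← coeff_zero_eq_constantCoeff_apply, f0, g0])]
  simp only [hU, hV]
  refine yRel_mul ?_ ?_ (fun x => ?_) (fun x => ?_) hf hg
  · intro i j k l
    ext s r
    rw [cf_UV, cf_VU]; exact (hfg _ _ _ _ _ _).eq.symm
  · intro i j k l
    ext s r
    rw [cf_UV, cf_VU]; exact (hfg _ _ _ _ _ _).eq.symm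
  · have : C (X : A⟦X⟧) * x = x * C X := by
      ext s r
      rw [coeff_C_mul, coeff_mul_C, (commute_X _).eq]
    rw [sub_mul, mul_sub, this, (commute_X x).eq]
  · have : C (X : A⟦X⟧) * x = x * C X := by
      ext s r
      rw [coeff_C_mul, coeff_mul_C, (commute_X _).eq]
    rw [mul_assoc, ← (commute_X x).eq, ← mul_assoc, this, mul_assoc]
end

section
variable {R A : Type*} [CommRing R] [Ring A] [Algebra R A]
open PowerSeries

/-- The expansion of `(u - η)⁻¹` in powers of `u⁻¹ = X`. -/
noncomputable def shiftedInv {R : Type*} [CommRing R] (η : R) : R⟦X⟧ := X * mk fun n => η ^ n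

/-- Coefficients of `a(u - η)` in terms of those of `a(u) = ∑ a_s u^{-s}`. -/
noncomputable def yShift (η : R) (a : ℕ → A) (n : ℕ) : A :=
  ∑ s ∈ Finset.range (n + 1), coeff n (shiftedInv η ^ s) • a s

/-- The coefficient at `u^{-n}` of `(qdet T(u) - 1)/η`. -/
noncomputable def yQdet (η : R) (t : Fin 2 → Fin 2 → ℕ → A) (n : ℕ) : A :=
  t 0 0 n + yShift η (t 1 1) n
    + η • ∑ p ∈ Finset.HasAntidiagonal.antidiagonal n,
        (t 0 0 p.1 * yShift η (t 1 1) p.2 - t 1 0 p.1 * yShift η (t 0 1) p.2)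

theorem shiftedInv_coeff_lt (η : R) {n s : ℕ} (h : n < s) : coeff n (shiftedInv η ^ s) = 0 := by
  rw [shiftedInv, mul_pow]
  exact X_pow_dvd_iff.1 (Dvd.intro _ rfl) n h

theorem shiftedInv_eq (η : R) : shiftedInv η = X + η • (X * shiftedInv η) := by
  ext n
  rcases n with _ | _ | n
  · simp [shiftedInv]
  · simp only [shiftedInv, map_add, coeff_smul, zero_add]
    rw [show (1 : ℕ) = 0 + 1 from rfl, coeff_succ_X_mul, coeff_succ_X_mul]
    simp
  · simp only [shiftedInv, map_add, coeff_smul, coeff_succ_X_mul, coeff_mk, coeff_X]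
    simp [pow_succ, mul_comm]

theorem shiftedInv_rec (η : R) (m s : ℕ) :
    coeff (m + 1) (shiftedInv η ^ (s + 1))
      = coeff m (shiftedInv η ^ s) + η * coeff m (shiftedInv η ^ (s + 1)) := by
  have : shiftedInv η ^ (s + 1) = X * (shiftedInv η ^ s + η • shiftedInv η ^ (s + 1)) := by
    conv_lhs => rw [pow_succ, shiftedInv_eq η]
    rw [mul_add, mul_smul_comm, mul_add, mul_smul_comm, ← shiftedInv_eq, pow_succ]
    congr 1
    · ring
    · congr 1; ring
  conv_lhs => rw [this]
  rw [coeff_succ_X_mul, map_add, coeff_smul, smul_eq_mul]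

theorem yShift_eq (η : R) (a : ℕ → A) {n N : ℕ} (h : n < N) :
    yShift η a n = ∑ s ∈ Finset.range N, coeff n (shiftedInv η ^ s) • a s := by
  refine Finset.sum_subset (Finset.range_subset_range.2 h) fun s _ hs => ?_
  rw [shiftedInv_coeff_lt η (by simpa using hs), zero_smul]

/-- The substitution `u ↦ u - η` on power series in `u⁻¹`. -/
noncomputable def yShiftSer (η : R) (f : A⟦X⟧) : A⟦X⟧ := mk (yShift η fun n => coeff n f)

theorem yShiftSer_mul (η : R) (f g : A⟦X⟧) :
    yShiftSer η (f * g) = yShiftSer η f * yShiftSer η g := by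
  ext n
  have e1 : coeff n (yShiftSer η (f * g)) = ∑ p ∈ Finset.range (n + 1) ×ˢ Finset.range (n + 1),
      coeff n (shiftedInv η ^ (p.1 + p.2)) • (coeff p.1 f * coeff p.2 g) := by
    rw [yShiftSer, coeff_mk, yShift]
    simp only [coeff_mul, Finset.smul_sum]
    rw [Finset.sum_sigma']
    refine Finset.sum_of_injOn (fun x => x.2) ?_ ?_ ?_ ?_
    · rintro ⟨a, b⟩ h1 ⟨c, d⟩ h2 h
      simp only [Finset.coe_sigma, Set.mem_sigma_iff, Finset.mem_coe, Finset.HasAntidiagonal.mem_antidiagonal] at *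
      subst h
      simp [← h1.2, ← h2.2]
    · rintro ⟨a, b⟩ h1
      simp only [Finset.coe_sigma, Set.mem_sigma_iff, Finset.mem_coe, Finset.HasAntidiagonal.mem_antidiagonal,
        Finset.mem_range, Finset.coe_product, Set.mem_prod] at *
      omega
    · rintro ⟨a, b⟩ h1 h2
      rw [shiftedInv_coeff_lt, zero_smul]
      by_contra h3
      exact h2 ⟨⟨a + b, (a, b)⟩, by simp; omega, rfl⟩
    · rintro ⟨a, b⟩ h1
      simp only [Finset.mem_sigma, Finset.HasAntidiagonal.mem_antidiagonal] at h1
      rw [← h1.2]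
  rw [e1, coeff_mul]
  have e2 : ∀ p ∈ Finset.HasAntidiagonal.antidiagonal n,
      coeff p.1 (yShiftSer η f) * coeff p.2 (yShiftSer η g)
      = ∑ r ∈ Finset.range (n + 1) ×ˢ Finset.range (n + 1),
        (coeff p.1 (shiftedInv η ^ r.1) * coeff p.2 (shiftedInv η ^ r.2)) •
          (coeff r.1 f * coeff r.2 g) := by
    intro p hp
    rw [Finset.HasAntidiagonal.mem_antidiagonal] at hp
    rw [yShiftSer, yShiftSer, coeff_mk, coeff_mk, yShift_eq η _ (show p.1 < n + 1 by omega),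
      yShift_eq η _ (show p.2 < n + 1 by omega), Finset.sum_mul_sum, Finset.sum_product]
    simp only [smul_mul_smul_comm]
  rw [Finset.sum_congr rfl e2, Finset.sum_comm]
  refine Finset.sum_congr rfl fun r _ => ?_
  rw [pow_add, coeff_mul, Finset.sum_smul]

theorem yShiftSer_add (η : R) (f g : A⟦X⟧) :
    yShiftSer η (f + g) = yShiftSer η f + yShiftSer η g := by
  ext n; simp [yShiftSer, yShift, Finset.sum_add_distrib]

theorem yShiftSer_smul (η c : R) (f : A⟦X⟧) :
    yShiftSer η (c • f) = c • yShiftSer η f := by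
  ext n
  simp only [yShiftSer, yShift, coeff_mk, coeff_smul, Finset.smul_sum, smul_comm c]

theorem yShift_e (η : R) (n : ℕ) (a : A) :
    yShift η (fun s => if s = 0 then a else 0) n = if n = 0 then a else 0 := by
  rw [yShift, Finset.sum_eq_single 0 (by intro b _ hb; rw [if_neg hb, smul_zero]) (by simp)]
  simp only [pow_zero, coeff_one, if_true]
  split_ifs <;> simp

/-- Summation by parts: specialization of a bivariate difference relation at `v = u - η`. -/
theorem yDiag (η : R) (F G : ℕ → ℕ → A) (h1 : ∀ s, F 0 s = 0) (h2 : ∀ r, F r 0 = 0)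
    (h : ∀ r s, F (r + 1) s - F r (s + 1) = G r s) (n : ℕ) :
    η • ∑ p ∈ Finset.HasAntidiagonal.antidiagonal n, yShift η (F p.1) p.2
      = ∑ p ∈ Finset.HasAntidiagonal.antidiagonal n, yShift η (G p.1) p.2 := by
  have e1 : ∑ p ∈ Finset.HasAntidiagonal.antidiagonal n, yShift η (F (p.1 + 1)) p.2
      = ∑ p ∈ Finset.HasAntidiagonal.antidiagonal (n + 1), yShift η (F p.1) p.2 := by
    rw [Finset.Nat.sum_antidiagonal_succ]
    simp [yShift, h1]
  have e2 : ∑ p ∈ Finset.HasAntidiagonal.antidiagonal n, yShift η (F p.1) (p.2 + 1)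
      = ∑ p ∈ Finset.HasAntidiagonal.antidiagonal (n + 1), yShift η (F p.1) p.2 := by
    rw [Finset.Nat.sum_antidiagonal_succ']
    simp [yShift, h2]
  have e3 : ∀ r m, yShift η (fun s => F r (s + 1)) m = yShift η (F r) (m + 1) - η • yShift η (F r) m := by
    intro r m
    rw [yShift_eq η (F r) (show m + 1 < m + 2 by omega), yShift_eq η (F r) (show m < m + 2 by omega),
      Finset.sum_range_succ', Finset.sum_range_succ' _ (m + 1), h2, smul_zero, smul_zero, add_zero, add_zero, yShift,
      Finset.smul_sum, ← Finset.sum_sub_distrib]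
    refine Finset.sum_congr rfl fun s _ => ?_
    rw [shiftedInv_rec, smul_smul, ← sub_smul, add_sub_cancel_right]
  have e4 : ∀ r m, yShift η (G r) m = yShift η (F (r + 1)) m - yShift η (fun s => F r (s + 1)) m := by
    intro r m
    simp only [yShift, ← Finset.sum_sub_distrib, ← smul_sub, h]
  simp only [e4, e3, Finset.sum_sub_distrib, e1, e2, ← Finset.smul_sum]
  abel

end

section
variable {R A : Type*} [CommRing R] [Ring A] [Algebra R A]
open PowerSeries

theorem yShift_coeff (η : R) (f : A⟦X⟧) (n : ℕ) :
    yShift η (fun n => coeff n f) n = coeff n (yShiftSer η f) := by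
  rw [yShiftSer, coeff_mk]

theorem yShift_mul_left (η : R) (a : A) (b : ℕ → A) (n : ℕ) :
    yShift η (fun s => a * b s) n = a * yShift η b n := by
  simp only [yShift, Finset.mul_sum, mul_smul_comm]
theorem yShift_mul_right (η : R) (a : A) (b : ℕ → A) (n : ℕ) :
    yShift η (fun s => b s * a) n = yShift η b n * a := by
  simp only [yShift, Finset.sum_mul, smul_mul_assoc]
theorem yShift_add (η : R) (a b : ℕ → A) (n : ℕ) :
    yShift η (fun s => a s + b s) n = yShift η a n + yShift η b n := by
  simp only [yShift, smul_add, Finset.sum_add_distrib]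
theorem yShift_sub (η : R) (a b : ℕ → A) (n : ℕ) :
    yShift η (fun s => a s - b s) n = yShift η a n - yShift η b n := by
  simp only [yShift, smul_sub, Finset.sum_sub_distrib]
theorem yShift_smul (η c : R) (a : ℕ → A) (n : ℕ) :
    yShift η (fun s => c • a s) n = c • yShift η a n := by
  simp only [yShift, smul_comm _ c, Finset.smul_sum]
theorem yShift_zero (η : R) (n : ℕ) : yShift η (fun _ => (0 : A)) n = 0 := by
  simp [yShift]

theorem yComm_diag {η : R} {f : Fin 2 → Fin 2 → A⟦X⟧}
    (h : YComm η (fun i j n => coeff n (f i j))) (i j k l : Fin 2) :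
    η • (f i j * yShiftSer η (f k l) - yShiftSer η (f k l) * f i j)
      = yRho η f (fun i j => yShiftSer η (f i j)) i j k l := by
  have h0 : ∀ i j, coeff 0 (f i j) = 0 := h.1
  ext n
  have key := yDiag η
    (fun r s => coeff r (f i j) * coeff s (f k l) - coeff s (f k l) * coeff r (f i j))
    (fun r s => η • (coeff r (f k j) * coeff s (f i l) - coeff s (f k j) * coeff r (f i l))
      + (if k = j then (if r = 0 then coeff s (f i l) else 0)
          - (if s = 0 then coeff r (f i l) else 0) else 0)
      + (if i = l then (if s = 0 then coeff r (f k j) else 0)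
          - (if r = 0 then coeff s (f k j) else 0) else 0))
    (fun s => by simp only [h0, zero_mul, mul_zero, sub_zero])
    (fun s => by simp only [h0, zero_mul, mul_zero, sub_zero]) (h.2 i j k l) n
  have m1 : ∀ F G : A⟦X⟧, ∑ p ∈ Finset.HasAntidiagonal.antidiagonal n,
      coeff p.1 F * coeff p.2 (yShiftSer η G) = coeff n (F * yShiftSer η G) := fun F G => by
    rw [coeff_mul]
  have m2 : ∀ F G : A⟦X⟧, ∑ p ∈ Finset.HasAntidiagonal.antidiagonal n,
      coeff p.2 (yShiftSer η G) * coeff p.1 F = coeff n (yShiftSer η G * F) := fun F G => by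
    rw [coeff_mul, ← Finset.Nat.sum_antidiagonal_swap]; rfl
  have m3 : ∀ F : A⟦X⟧, ∑ p ∈ Finset.HasAntidiagonal.antidiagonal n,
      (if p.1 = 0 then coeff p.2 F else 0) = coeff n F := fun F => by
    rw [Finset.sum_eq_single (0, n)]
    · simp
    · rintro ⟨a, b⟩ h1 h2
      rw [Finset.HasAntidiagonal.mem_antidiagonal] at h1
      rw [if_neg]
      rintro rfl
      simp_all
    · simp
  have m4 : ∀ F : A⟦X⟧, ∑ p ∈ Finset.HasAntidiagonal.antidiagonal n,
      (if p.2 = 0 then coeff p.1 F else 0) = coeff n F := fun F => by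
    rw [Finset.sum_eq_single (n, 0)]
    · simp
    · rintro ⟨a, b⟩ h1 h2
      rw [Finset.HasAntidiagonal.mem_antidiagonal] at h1
      rw [if_neg]
      rintro rfl
      simp_all
    · simp
  have e0 : ∀ (p : Prop) [Decidable p] (F : ℕ → A) (m : ℕ),
      yShift η (fun s => if p then F s else 0) m = if p then yShift η F m else 0 := by
    intro p _ F m
    split_ifs
    · rfl
    · exact yShift_zero η m
  simp only [yShift_add, yShift_sub, yShift_smul, yShift_mul_left, yShift_mul_right, e0, yShift_e,
    yShift_coeff, Finset.sum_add_distrib, Finset.sum_sub_distrib, ← Finset.smul_sum, m1, m2] at key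
  have e5 : ∀ (p : Prop) [Decidable p] (F : ℕ × ℕ → A),
      ∑ x ∈ Finset.HasAntidiagonal.antidiagonal n, (if p then F x else 0)
        = if p then ∑ x ∈ Finset.HasAntidiagonal.antidiagonal n, F x else 0 := by
    intro p _ F
    split_ifs <;> simp
  simp only [e5, Finset.sum_sub_distrib, m3, m4] at key
  rw [coeff_smul, map_sub, key]
  simp only [yRho, map_add, map_sub, coeff_smul, apply_ite (coeff n), map_zero]

theorem yQdet_mul_aux (η : R) (a a' b b' : Fin 2 → Fin 2 → A)
    (hc : ∀ i j k l, b i j * a' k l = a' k l * b i j)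
    (ha : ∀ i j k l, η • (a i j * a' k l - a' k l * a i j) = yRho η a a' i j k l)
    (qa : a 0 0 + a' 1 1 + η • (a 0 0 * a' 1 1 - a 1 0 * a' 0 1) = 0)
    (qb : b 0 0 + b' 1 1 + η • (b 0 0 * b' 1 1 - b 1 0 * b' 0 1) = 0) :
    yMul η a b 0 0 + yMul η a' b' 1 1
      + η • (yMul η a b 0 0 * yMul η a' b' 1 1 - yMul η a b 1 0 * yMul η a' b' 0 1) = 0 := by
  have i0 : a' 1 0 - a 1 0 + η • (a 0 0 * a' 1 0 - a 1 0 * a' 0 0) = 0 := by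
    have := ha 1 0 0 0
    simp only [yRho, smul_sub, if_true, one_ne_zero, if_false, add_zero] at this
    rw [← sub_eq_zero] at this
    rw [← neg_eq_zero, ← this, smul_sub]; abel
  have i1 : a 0 1 - a' 0 1 + η • (a 0 1 * a' 1 1 - a 1 1 * a' 0 1) = 0 := by
    have := ha 1 1 0 1
    simp only [yRho, smul_sub, if_true, zero_ne_one, if_false, add_zero] at this
    rw [← sub_eq_zero] at this
    rw [← neg_eq_zero, ← this, smul_sub]; abel
  have i2 : a 0 0 + a' 1 1 - a 1 1 - a' 0 0
      + η • (a 0 1 * a' 1 0 - a 1 1 * a' 0 0 + a 0 0 * a' 1 1 - a 1 0 * a' 0 1) = 0 := by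
    have h1 := ha 1 0 0 1
    have h2 := ha 1 1 0 0
    simp only [yRho, smul_sub, if_true, zero_ne_one, one_ne_zero, if_false, add_zero] at h1 h2
    rw [← sub_eq_zero] at h1 h2
    rw [← neg_eq_zero, ← add_zero (0 : A)]
    nth_rw 1 [← h1]
    rw [← h2]; simp only [smul_add, smul_sub]; abel
  have hc' : ∀ i j k l z, b i j * (a' k l * z) = a' k l * (b i j * z) := fun i j k l z => by
    rw [← mul_assoc, hc, mul_assoc]
  have key : yMul η a b 0 0 + yMul η a' b' 1 1
      + η • (yMul η a b 0 0 * yMul η a' b' 1 1 - yMul η a b 1 0 * yMul η a' b' 0 1)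
      = (b 0 0 + b' 1 1 + η • (b 0 0 * b' 1 1 - b 1 0 * b' 0 1))
        + (a 0 0 + a' 1 1 + η • (a 0 0 * a' 1 1 - a 1 0 * a' 0 1)) *
          ((1 + η • b 0 0) * (1 + η • b' 1 1) - (η * η) • (b 1 0 * b' 0 1))
        + (a' 1 0 - a 1 0 + η • (a 0 0 * a' 1 0 - a 1 0 * a' 0 0))
          * (η • ((1 + η • b 0 0) * b' 0 1))
        + (a 0 1 - a' 0 1 + η • (a 0 1 * a' 1 1 - a 1 1 * a' 0 1))
          * (η • (b 1 0 * (1 + η • b' 1 1)))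
        + (a 0 0 + a' 1 1 - a 1 1 - a' 0 0
            + η • (a 0 1 * a' 1 0 - a 1 1 * a' 0 0 + a 0 0 * a' 1 1 - a 1 0 * a' 0 1))
          * ((η * η) • (b 1 0 * b' 0 1)) := by
    simp only [yMul, mul_add, add_mul, sub_mul, mul_sub, mul_one, one_mul, smul_mul_assoc,
      mul_smul_comm, smul_add, smul_sub, smul_smul, mul_assoc, hc, hc']
    abel
  rw [key, qa, qb, i0, i1, i2]
  simp

theorem yQdet_coeff (η : R) (f : Fin 2 → Fin 2 → A⟦X⟧) (n : ℕ) :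
    yQdet η (fun i j n => coeff n (f i j)) n = coeff n (f 0 0 + yShiftSer η (f 1 1)
      + η • (f 0 0 * yShiftSer η (f 1 1) - f 1 0 * yShiftSer η (f 0 1))) := by
  simp only [yQdet, map_add, coeff_smul, map_sub, coeff_mul, yShift_coeff, Finset.sum_sub_distrib]

theorem yShiftSer_yMul (η : R) (f g : Fin 2 → Fin 2 → A⟦X⟧) (i j : Fin 2) :
    yShiftSer η (yMul η f g i j) =
      yMul η (fun i j => yShiftSer η (f i j)) (fun i j => yShiftSer η (g i j)) i j := by
  simp only [yMul, yShiftSer_add, yShiftSer_smul, yShiftSer_mul]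

theorem yQdet_mul {η : R} {f g : Fin 2 → Fin 2 → A⟦X⟧}
    (hfg : ∀ i j k l r s, Commute (coeff r (f i j)) (coeff s (g k l)))
    (hf : YComm η (fun i j n => coeff n (f i j)))
    (qf : ∀ n, yQdet η (fun i j n => coeff n (f i j)) n = 0)
    (qg : ∀ n, yQdet η (fun i j n => coeff n (g i j)) n = 0) (n : ℕ) :
    yQdet η (fun i j n => coeff n (yMul η f g i j)) n = 0 := by
  simp only [yQdet_coeff] at qf qg ⊢
  rw [yShiftSer_yMul, yShiftSer_yMul, yQdet_mul_aux η _ _ _ _ ?_ (yComm_diag hf), map_zero]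
  · ext n; simpa using qf n
  · ext n; simpa using qg n
  · intro i j k l
    ext n
    rw [coeff_mul, coeff_mul, ← Finset.Nat.sum_antidiagonal_swap]
    refine Finset.sum_congr rfl fun p _ => ?_
    simp only [Prod.fst_swap, Prod.snd_swap, yShiftSer, coeff_mk, yShift, Finset.sum_mul,
      Finset.mul_sum, mul_smul_comm, smul_mul_assoc, (hfg _ _ _ _ _ _).eq]

theorem yMul_assoc (η : R) (a b c : Fin 2 → Fin 2 → A) (i j : Fin 2) :
    yMul η (yMul η a b) c i j = yMul η a (yMul η b c) i j := by
  simp only [yMul, mul_add, add_mul, smul_mul_assoc, mul_smul_comm, smul_add, smul_smul, mul_assoc]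
  abel
end

/-- The generators `t_ij^{(r)}` in the free algebra. -/
abbrev yFree (R : Type u) [CommRing R] (i j : Fin 2) (r : ℕ) :
    FreeAlgebra R (Fin 2 × Fin 2 × ℕ) :=
  FreeAlgebra.ι R (i, j, r)

/-- The defining relations of `Y(sl₂)`. -/
inductive YRel (R : Type u) [CommRing R] (η : R) :
    FreeAlgebra R (Fin 2 × Fin 2 × ℕ) → FreeAlgebra R (Fin 2 × Fin 2 × ℕ) → Prop
  | zero (i j : Fin 2) : YRel R η (yFree R i j 0) 0
  | lie (i j k l : Fin 2) (s : ℕ) (hs : 1 ≤ s) : YRel R η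
      (yFree R i j 1 * yFree R k l s - yFree R k l s * yFree R i j 1)
      ((if k = j then yFree R i l s else 0) - (if i = l then yFree R k j s else 0))
  | rtt (i j k l : Fin 2) (r s : ℕ) (hr : 1 ≤ r) (hs : 1 ≤ s) : YRel R η
      ((yFree R i j (r + 1) * yFree R k l s - yFree R k l s * yFree R i j (r + 1))
        - (yFree R i j r * yFree R k l (s + 1) - yFree R k l (s + 1) * yFree R i j r))
      (η • (yFree R k j r * yFree R i l s - yFree R k j s * yFree R i l r))
  | qdet (n : ℕ) : YRel R η (yQdet η (yFree R) n) 0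

/-- The Yangian `Y(sl₂)`. -/
def Yangian (R : Type u) [CommRing R] (η : R) : Type u := RingQuot (YRel R η)

namespace Yangian
open PowerSeries

section
variable (R : Type u) [CommRing R] (η : R)

noncomputable instance instRing : Ring (Yangian R η) :=
  inferInstanceAs (Ring (RingQuot (YRel R η)))

noncomputable instance instAlgebra {S : Type*} [CommRing S] [Algebra S R] :
    Algebra S (Yangian R η) :=
  inferInstanceAs (Algebra S (RingQuot (YRel R η)))

instance instIsScalarTower {S : Type*} [CommRing S] [Algebra S R] :
    IsScalarTower S R (Yangian R η) :=
  inferInstanceAs (IsScalarTower S R (RingQuot (YRel R η)))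

/-- The generators `t_ij^{(r)}`. -/
noncomputable def t (i j : Fin 2) (r : ℕ) : Yangian R η :=
  RingQuot.mkAlgHom R (YRel R η) (yFree R i j r)

end

section
variable {R : Type u} [CommRing R] {η : R}

theorem map_yQdet {A B : Type*} [Ring A] [Algebra R A] [Ring B] [Algebra R B] (f : A →ₐ[R] B)
    (c : Fin 2 → Fin 2 → ℕ → A) (n : ℕ) :
    f (yQdet η c n) = yQdet η (fun i j n => f (c i j n)) n := by
  simp only [yQdet, yShift, map_add, map_smul, map_sum, map_sub, map_mul]

/-- Universal property. -/
noncomputable def lift {A : Type*} [Ring A] [Algebra R A] (f : Fin 2 → Fin 2 → ℕ → A)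
    (hf : YComm η f) (hq : ∀ n, yQdet η f n = 0) : Yangian R η →ₐ[R] A :=
  RingQuot.liftAlgHom R ⟨FreeAlgebra.lift R fun x => f x.1 x.2.1 x.2.2, by
    intro x y h
    cases h with
    | zero i j => simpa using hf.1 i j
    | lie i j k l s hs =>
      have h := hf.2 i j k l 0 s
      simp only [map_sub, map_mul, apply_ite (FreeAlgebra.lift R _), map_zero,
        FreeAlgebra.lift_ι_apply]
      simp only [hf.1, zero_mul, mul_zero, sub_zero, smul_zero, zero_add, if_true,
        if_neg (show ¬ s = 0 by omega), zero_sub] at h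
      rw [h]
      split_ifs <;> abel
    | rtt i j k l r s hr hs =>
      have h := hf.2 i j k l r s
      simp only [map_sub, map_mul, map_smul, FreeAlgebra.lift_ι_apply]
      simp only [if_neg (show ¬ s = 0 by omega), if_neg (show ¬ r = 0 by omega), sub_zero, ite_self,
        add_zero] at h
      rw [h]
    | qdet n =>
      rw [map_yQdet, map_zero, ← hq n]
      simp only [FreeAlgebra.lift_ι_apply]⟩

theorem lift_t {A : Type*} [Ring A] [Algebra R A] (f : Fin 2 → Fin 2 → ℕ → A)
    (hf : YComm η f) (hq : ∀ n, yQdet η f n = 0) (i j : Fin 2) (r : ℕ) :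
    lift f hf hq (t R η i j r) = f i j r := by
  rw [lift, t]
  exact (RingQuot.liftAlgHom_mkAlgHom_apply R _ _ _).trans (FreeAlgebra.lift_ι_apply _ _)

theorem hom_ext {A : Type*} [Ring A] [Algebra R A] {f g : Yangian R η →ₐ[R] A}
    (h : ∀ i j r, f (t R η i j r) = g (t R η i j r)) : f = g :=
  RingQuot.ringQuot_ext' R f g (FreeAlgebra.hom_ext (funext fun x => h x.1 x.2.1 x.2.2))

theorem t_zero (i j : Fin 2) : t R η i j 0 = 0 := by
  have h := RingQuot.mkAlgHom_rel R (YRel.zero (R := R) (η := η) i j)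
  rw [map_zero] at h
  exact h

theorem t_lie (i j k l : Fin 2) {s : ℕ} (hs : 1 ≤ s) :
    t R η i j 1 * t R η k l s - t R η k l s * t R η i j 1
      = (if k = j then t R η i l s else 0) - (if i = l then t R η k j s else 0) := by
  have h := RingQuot.mkAlgHom_rel R (YRel.lie (η := η) i j k l s hs)
  simp only [map_sub, map_mul, apply_ite (RingQuot.mkAlgHom R _), map_zero] at h
  exact h

theorem t_rtt (i j k l : Fin 2) {r s : ℕ} (hr : 1 ≤ r) (hs : 1 ≤ s) :
    (t R η i j (r + 1) * t R η k l s - t R η k l s * t R η i j (r + 1))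
      - (t R η i j r * t R η k l (s + 1) - t R η k l (s + 1) * t R η i j r)
      = η • (t R η k j r * t R η i l s - t R η k j s * t R η i l r) := by
  have h := RingQuot.mkAlgHom_rel R (YRel.rtt (η := η) i j k l r s hr hs)
  simp only [map_sub, map_mul, map_smul] at h
  exact h

theorem t_qdet (n : ℕ) : yQdet η (t R η) n = 0 := by
  have h := RingQuot.mkAlgHom_rel R (YRel.qdet (η := η) n)
  rw [map_yQdet, map_zero] at h
  exact h

theorem t_comm : YComm η (t R η) := by
  refine ⟨t_zero, fun i j k l r s => ?_⟩
  rcases Nat.eq_zero_or_pos r with rfl | hr <;> rcases Nat.eq_zero_or_pos s with rfl | hs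
  · simp [t_zero]
  · rw [zero_add, t_lie i j k l hs]
    simp only [t_zero, zero_mul, mul_zero, sub_zero, smul_zero, zero_add, if_true,
        if_neg (show ¬ s = 0 by omega), zero_sub]
    split_ifs <;> abel
  · have h := t_lie (η := η) k l i j hr
    rw [zero_add, ← neg_sub (t R η k l 1 * _), h]
    simp only [t_zero, zero_mul, mul_zero, sub_zero, smul_zero, zero_add, if_true,
        if_neg (show ¬ r = 0 by omega), zero_sub]
    split_ifs <;> abel
  · rw [t_rtt i j k l hr hs]
    simp only [if_neg (show ¬ s = 0 by omega), if_neg (show ¬ r = 0 by omega), sub_zero, ite_self,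
        add_zero]

/-- The values `Δ(t_ij^{(n)})`, that is `Δ(T_ij(u)) = ∑ₖ T_ik(u) ⊗ T_kj(u)`. -/
noncomputable def comulGen (R : Type u) [CommRing R] (η : R) (i j : Fin 2) (n : ℕ) :
    Yangian R η ⊗[R] Yangian R η :=
  t R η i j n ⊗ₜ 1 + 1 ⊗ₜ t R η i j n
    + η • ∑ k, ∑ p ∈ Finset.HasAntidiagonal.antidiagonal n, t R η i k p.1 ⊗ₜ t R η k j p.2

theorem comulGen_eq (i j : Fin 2) (n : ℕ) : comulGen R η i j n = coeff n (yMul η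
      (fun i j => mk fun n => (t R η i j n ⊗ₜ[R] (1 : Yangian R η)))
      (fun i j => mk fun n => ((1 : Yangian R η) ⊗ₜ[R] t R η i j n)) i j) := by
  simp only [comulGen, map_add, yMul, coeff_smul, coeff_mul, coeff_mk, Fin.sum_univ_two,
    Algebra.TensorProduct.tmul_mul_tmul, mul_one, one_mul]

theorem map_comulGen {A : Type*} [Ring A] [Algebra R A] (f : Yangian R η ⊗[R] Yangian R η →ₐ[R] A)
    (i j : Fin 2) (n : ℕ) : f (comulGen R η i j n) = coeff n (yMul η
      (fun i j => mk fun n => f (t R η i j n ⊗ₜ[R] (1 : Yangian R η)))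
      (fun i j => mk fun n => f ((1 : Yangian R η) ⊗ₜ[R] t R η i j n)) i j) := by
  simp only [comulGen_eq, map_add, map_smul, map_sum, map_mul, yMul, coeff_smul, coeff_mul, coeff_mk]

theorem comulGen_comm : YComm η (comulGen R η) ∧ ∀ n, yQdet η (comulGen R η) n = 0 := by
  have e : comulGen R η = fun i j n => coeff n (yMul η
      (fun i j => mk fun n => (t R η i j n ⊗ₜ[R] (1 : Yangian R η)))
      (fun i j => mk fun n => ((1 : Yangian R η) ⊗ₜ[R] t R η i j n)) i j) := by
    funext i j n
    exact comulGen_eq i j n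
  have hc : ∀ i j k l r s, Commute (t R η i j r ⊗ₜ[R] (1 : Yangian R η))
      ((1 : Yangian R η) ⊗ₜ[R] t R η k l s) := fun i j k l r s => by
    simp [Commute, SemiconjBy]
  have h1 : YComm η (fun i j r => t R η i j r ⊗ₜ[R] (1 : Yangian R η)) := by
    refine ⟨fun i j => by simp [t_zero], fun i j k l r s => ?_⟩
    have h := congrArg (Algebra.TensorProduct.includeLeft : Yangian R η →ₐ[R] _ ⊗[R] Yangian R η)
      (t_comm.2 i j k l r s)
    simpa only [map_sub, map_add, map_mul, map_smul, apply_ite (Algebra.TensorProduct.includeLeft),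
      map_zero, Algebra.TensorProduct.includeLeft_apply] using h
  have h2 : YComm η (fun i j r => (1 : Yangian R η) ⊗ₜ[R] t R η i j r) := by
    refine ⟨fun i j => by simp [t_zero], fun i j k l r s => ?_⟩
    have h := congrArg (Algebra.TensorProduct.includeRight : Yangian R η →ₐ[R] Yangian R η ⊗[R] _)
      (t_comm.2 i j k l r s)
    simpa only [map_sub, map_add, map_mul, map_smul, apply_ite (Algebra.TensorProduct.includeRight),
      map_zero, Algebra.TensorProduct.includeRight_apply] using h
  have q1 : ∀ n, yQdet η (fun i j r => t R η i j r ⊗ₜ[R] (1 : Yangian R η)) n = 0 := fun n => by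
    have h := congrArg (Algebra.TensorProduct.includeLeft : Yangian R η →ₐ[R] _ ⊗[R] Yangian R η)
      (t_qdet n)
    rwa [map_yQdet, map_zero] at h
  have q2 : ∀ n, yQdet η (fun i j r => (1 : Yangian R η) ⊗ₜ[R] t R η i j r) n = 0 := fun n => by
    have h := congrArg (Algebra.TensorProduct.includeRight : Yangian R η →ₐ[R] Yangian R η ⊗[R] _)
      (t_qdet n)
    rwa [map_yQdet, map_zero] at h
  rw [e]
  exact ⟨yComm_mul (fun i j => by simp [t_zero]) (fun i j => by simp [t_zero])
      (fun i j k l r s => by simpa only [coeff_mk] using hc i j k l r s)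
      (by simpa only [coeff_mk] using h1) (by simpa only [coeff_mk] using h2),
    yQdet_mul (fun i j k l r s => by simpa only [coeff_mk] using hc i j k l r s)
      (by simpa only [coeff_mk] using h1)
      (by simpa only [coeff_mk] using q1) (by simpa only [coeff_mk] using q2)⟩

theorem counit_comm : YComm η (fun _ _ _ => (0 : R)) ∧
    ∀ n, yQdet η (fun _ _ _ => (0 : R)) n = 0 := by
  refine ⟨⟨fun _ _ => rfl, by simp⟩, by simp [yQdet, yShift]⟩

theorem comulGen_coassoc (Δ : Yangian R η →ₐ[R] Yangian R η ⊗[R] Yangian R η)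
    (hΔ : ∀ i j n, Δ (t R η i j n) = comulGen R η i j n) (i j : Fin 2) (n : ℕ) :
    Algebra.TensorProduct.assoc R R R (Yangian R η) (Yangian R η) (Yangian R η)
      (Algebra.TensorProduct.map Δ (.id R (Yangian R η)) (comulGen R η i j n))
    = Algebra.TensorProduct.map (.id R (Yangian R η)) Δ (comulGen R η i j n) := by
  have h1 := map_comulGen ((Algebra.TensorProduct.assoc R R R (Yangian R η) (Yangian R η)
    (Yangian R η)).toAlgHom.comp (Algebra.TensorProduct.map Δ (.id R (Yangian R η)))) i j n
  have h2 := map_comulGen (Algebra.TensorProduct.map (.id R (Yangian R η)) Δ) i j n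
  have h3 := map_comulGen ((Algebra.TensorProduct.assoc R R R (Yangian R η) (Yangian R η)
    (Yangian R η)).toAlgHom.comp (Algebra.TensorProduct.includeLeft :
      (Yangian R η ⊗[R] Yangian R η) →ₐ[R] _ ⊗[R] (Yangian R η)))
  have h4 := map_comulGen (Algebra.TensorProduct.includeRight :
      (Yangian R η ⊗[R] Yangian R η) →ₐ[R] (Yangian R η) ⊗[R] _)
  simp only [AlgHom.comp_apply, Algebra.TensorProduct.map_tmul, hΔ, map_one, AlgHom.id_apply,
    Algebra.TensorProduct.includeLeft_apply, Algebra.TensorProduct.includeRight_apply] at h1 h2 h3 h4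
  simp only [h3] at h1
  simp only [h4] at h2
  refine h1.trans (Eq.trans ?_ h2.symm)
  have e : ∀ F : Fin 2 → Fin 2 → (Yangian R η ⊗[R] (Yangian R η ⊗[R] Yangian R η))⟦X⟧,
      (fun i j => mk fun n => coeff n (F i j)) = F := fun F => by
    funext i j; ext n; rw [coeff_mk]
  rw [e, e, yMul_assoc]
  rfl

noncomputable instance instBialgebra (R : Type u) [CommRing R] (η : R) :
    Bialgebra R (Yangian R η) :=
  Bialgebra.ofAlgHom (lift (comulGen R η) comulGen_comm.1 comulGen_comm.2)
    (lift (fun _ _ _ => (0 : R)) counit_comm.1 counit_comm.2)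
    (hom_ext fun i j n => by
      simp only [AlgHom.comp_apply, lift_t]
      exact comulGen_coassoc _ (lift_t _ _ _) i j n)
    (hom_ext fun i j n => by
      simp [lift_t, comulGen])
    (hom_ext fun i j n => by
      simp [lift_t, comulGen])
end
end Yangian

/-- The element `(1 - (2)_{q²} (a 1 ⊗ e_{δ-α} + b q^{-h} ⊗ q^{-h} e_{-α}))_{q²}^{(-h ⊗ 1 / 2)}`
with `a`, `b` replaced by `a X`, `b X`; here `(h/2)_{q²} = (q^h - 1)/(q² - 1)`. -/
noncomputable def twistU {R : Type u} [CommRing R] (q : Rˣ) (a b : R) :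
    PowerSeries (Uq R q ⊗[R] Uq R q) :=
  qPower ((q : R) ^ 2)
    ((Ring.inverse ((q : R) ^ 2 - 1) • (Uq.gen R q .K - 1)) ⊗ₜ 1)
    (qNum ((q : R) ^ 2) 2 • (a • (1 ⊗ₜ Uq.gen R q .eDA)
      + b • (Uq.gen R q .K' ⊗ₜ (Uq.gen R q .K' * Uq.gen R q .eNA))))

/-- The element `(1 - (2)_{q²} ξ (1 ⊗ f₁ + η (h/2)_{q^{-2}} ⊗ f₀))_{q²}^{(-h ⊗ 1 / 2)}` with `ξ`
replaced by `ξ X`; here `(h/2)_{q²} = q^{-2} q^h (h/2)_{q^{-2}}`. -/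
noncomputable def twistB {R : Type u} [CommRing R] (q : Rˣ) (η ξ : R) :
    PowerSeries (Bq R q η ⊗[R] Bq R q η) :=
  qPower ((q : R) ^ 2)
    (((↑q⁻¹ : R) ^ 2 • (Bq.gen R q η .K * Bq.gen R q η .H)) ⊗ₜ 1)
    ((qNum ((q : R) ^ 2) 2 * ξ) • (1 ⊗ₜ Bq.gen R q η .f1
      + η • (Bq.gen R q η .H ⊗ₜ Bq.gen R q η .f0)))

namespace Yangian
variable (R : Type u) [CommRing R] (η : R)

/-- `h/2`, where `h = t₁₁^{(1)} - t₂₂^{(1)}`. -/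
noncomputable def halfH : Yangian R η := Ring.inverse (2 : R) • (t R η 0 0 1 - t R η 1 1 1)

/-- `f₀ = t₂₁^{(1)}`. -/
noncomputable def f0 : Yangian R η := t R η 1 0 1

/-- `f₁ = -t₂₁^{(2)} + η f₀ h/2`; then `[h, f₁] = -2 f₁`, `[f₁, f₀] = -η f₀²` and
`Δ(f₁) = f₁ ⊗ 1 + 1 ⊗ f₁ + η h ⊗ f₀`. -/
noncomputable def f1 : Yangian R η := -t R η 1 0 2 + η • (f0 R η * halfH R η)

end Yangian

/-- The element `(1 - 2 ξ (1 ⊗ f₁ + η h/2 ⊗ f₀))^{-h ⊗ 1 / 2}` with `ξ` replaced by `ξ X`. -/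
noncomputable def twistY {R : Type u} [CommRing R] (η ξ : R) :
    PowerSeries (Yangian R η ⊗[R] Yangian R η) :=
  qPower (1 : R) (Yangian.halfH R η ⊗ₜ 1)
    ((2 * ξ) • (1 ⊗ₜ Yangian.f1 R η + η • (Yangian.halfH R η ⊗ₜ Yangian.f0 R η)))

section BaseChange
variable {S R A A' : Type*} [CommRing S] [CommRing R] [Algebra S R] [Ring A] [Ring A']

/-- `f ⊗ f : A ⊗_S A → A' ⊗_R A'` for an `S`-algebra map `f` from `A` to an `R`-algebra `A'`. -/
noncomputable def tensorSq [Algebra S A] [Algebra R A'] [Algebra S A'] [IsScalarTower S R A']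
    (f : A →ₐ[S] A') : A ⊗[S] A →ₐ[S] A' ⊗[R] A' :=
  Algebra.TensorProduct.lift
    ((Algebra.TensorProduct.includeLeft : A' →ₐ[S] A' ⊗[R] A').comp f)
    (((Algebra.TensorProduct.includeRight : A' →ₐ[R] A' ⊗[R] A').restrictScalars S).comp f)
    (fun x y => by simp [Commute, SemiconjBy])

/-- `f` respects comultiplications and counits. -/
structure IsBialgMap [Bialgebra S A] [Bialgebra R A'] [Algebra S A'] [IsScalarTower S R A']
    (f : A →ₐ[S] A') : Prop where
  map_comul : ∀ x, Coalgebra.comul (R := R) (f x)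
    = tensorSq (R := R) f (Coalgebra.comul (R := S) x)
  map_counit : ∀ x, Coalgebra.counit (R := R) (f x)
    = algebraMap S R (Coalgebra.counit (R := S) x)

end BaseChange

/-! All three twists come from one construction. Write q, t for mutually inverse scalars (q², q⁻² in
the applications) and let K, K', H, f₀, f₁ be elements of a bialgebra forming an `IsBorelSystem`.
Put m = t K H. One should think of K as q^z for a variable z; then K' = t^z, H = (z)_t and m =
(z)_q. The relations say that f₀ and f₁ move z to z + 1, and the twist is F = (1 - X c (1 ⊗ f₁ + η
(z)_t ⊗ f₀))_q^{(-z)} with z in the first leg.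

In the cocycle equation the first of the three legs enters only through the commuting elements K,
K', H, that is, through z. Specialize z to a natural number n. Let P_n (`twistValue`) be the
resulting value of F, and let F_n (`twist`) be F with z replaced by z + n. The equation becomes (P_n
⊗ 1) F_n = F_0 Δ(P_n), which is `twist_mul_comul_twistValue`. It is proved by induction on n,
starting from P_0 = 1, by means of three facts about an explicit element r_n (`twistRatio`): P_n =
P_{n+1} (1 - X r_n); F_n = F_{n+1} (1 - X s_n), where Δ(r_n) = r_n ⊗ 1 + s_n; (r_n ⊗ 1) F_n =
F_{n+1} (r_n ⊗ 1). They give ((1 - X r_n) ⊗ 1) F_n = F_{n+1} Δ(1 - X r_n), and the unit Δ(1 - X r_n)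
can be cancelled. The two factorizations are cases of one identity for q-powers on a quantum plane,
`qPower_shift`.

To return from the integers to the variable z, each coefficient of the cocycle equation is a Laurent
expression in q^z and a polynomial in (z)_t. After multiplication by a power of t^z it is a
polynomial in (z)_t that vanishes at all (n)_t. Differences of these values are units, so
Vandermonde determinants force the polynomial to be zero (`fst_eq_zero_of_mem_evalSubalgebra`).

The remaining twist axioms follow from the cocycle and counit conditions. Both U_q and the Yangian
contain Borel systems (at q = 1 in the Yangian), which gives their twists; the same systems define
the maps out of `Bq`, and these carry one twist to another. -/

section QPower

variable {R A B : Type*} [CommRing R] [Ring A] [Algebra R A] [Ring B]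

/-! ### q-numbers and q-powers. -/

theorem qNum_succ (q : R) (n : ℕ) : qNum q (n + 1) = qNum q n + q ^ n :=
  Finset.sum_range_succ _ _

theorem qNum_succ' (q : R) (n : ℕ) : qNum q (n + 1) = 1 + q * qNum q n := by
  rw [qNum, Finset.sum_range_succ', pow_zero, add_comm, qNum, Finset.mul_sum]
  simp only [pow_succ']

theorem qNum_mul_sub_one (q : R) (n : ℕ) : qNum q n * (q - 1) = q ^ n - 1 :=
  geom_sum_mul q n

theorem isUnit_qFact {q : R} (hq : ∀ n : ℕ, 0 < n → IsUnit (qNum q n)) (n : ℕ) :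
    IsUnit (qFact q n) := by
  induction n with
  | zero => exact isUnit_one
  | succ n ih => exact ih.mul (hq _ n.succ_pos)

/-- Brings coefficients n and n + 1 of a q-power over the common denominator (n+1)_q!. -/
theorem inverse_qFact {q : R} (hq : ∀ n : ℕ, 0 < n → IsUnit (qNum q n)) (n : ℕ) :
    Ring.inverse (qFact q n) = Ring.inverse (qFact q (n + 1)) * qNum q (n + 1) := by
  have h1 := Ring.inverse_mul_cancel _ (isUnit_qFact hq n)
  have h2 := Ring.inverse_mul_cancel _ (isUnit_qFact hq (n + 1))
  calc Ring.inverse (qFact q n)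
      = Ring.inverse (qFact q n) * (Ring.inverse (qFact q (n + 1)) * qFact q (n + 1)) := by
        rw [h2, mul_one]
    _ = Ring.inverse (qFact q n) * qFact q n
          * (Ring.inverse (qFact q (n + 1)) * qNum q (n + 1)) := by
        rw [qFact]; ring
    _ = _ := by rw [h1, one_mul]

/-- Splitting off the first factor rather than the last turns the remaining product into the one for
z + 1, which is what compares the exponents -z and -z - 1. -/
theorem qRising_succ' (q : R) (m : A) (n : ℕ) :
    qRising q m (n + 1) = m * qRising q (1 + q • m) n := by
  induction n with
  | zero => simp [qRising, qNum]
  | succ n ih =>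
    have e : algebraMap R A (qNum q (n + 1)) + q ^ (n + 1) • m
        = algebraMap R A (qNum q n) + q ^ n • (1 + q • m) := by
      rw [qNum_succ, map_add, smul_add, smul_smul, ← pow_succ,
        Algebra.algebraMap_eq_smul_one (q ^ n), add_assoc]
    rw [qRising, ih, qRising, mul_assoc, e]

theorem coeff_qPower (q : R) (m u : A) (n : ℕ) :
    PowerSeries.coeff n (qPower q m u)
      = Ring.inverse (qFact q n) • (qRising q m n * u ^ n) :=
  PowerSeries.coeff_mk _ _

theorem constantCoeff_qPower (q : R) (m u : A) :
    PowerSeries.constantCoeff (qPower q m u) = 1 := by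
  rw [← PowerSeries.coeff_zero_eq_constantCoeff_apply, coeff_qPower]
  simp [qRising, qFact]

theorem isUnit_qPower (q : R) (m u : A) : IsUnit (qPower q m u) :=
  PowerSeries.isUnit_iff_constantCoeff.2 (by rw [constantCoeff_qPower]; exact isUnit_one)

theorem qPower_zero_left (q : R) (u : A) : qPower q 0 u = 1 := by
  ext n
  rw [coeff_qPower]
  cases n with
  | zero => simp [qRising, qFact]
  | succ n => rw [qRising_succ', zero_mul, zero_mul, smul_zero]; simp [PowerSeries.coeff_one]

theorem qPower_zero_right (q : R) (m : A) : qPower q m 0 = 1 := by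
  ext n
  rw [coeff_qPower]
  cases n with
  | zero => simp [qRising, qFact]
  | succ n => rw [zero_pow n.succ_ne_zero, mul_zero, smul_zero]; simp [PowerSeries.coeff_one]

end QPower

/-! ### Functoriality of q-powers under change of scalars. -/

section BaseChangeQPower

variable {S R A B : Type*} [CommRing S] [CommRing R] [Ring A] [Ring B] [Algebra S R] [Algebra S A]
  [Algebra R B] [Algebra S B] [IsScalarTower S R B]

theorem map_qRising (θ : A →ₐ[S] B) (q : S) (m : A) (n : ℕ) :
    θ (qRising q m n) = qRising (algebraMap S R q) (θ m) n := by
  induction n with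
  | zero => exact map_one θ
  | succ n ih =>
    rw [qRising, map_mul, ih, map_add, AlgHom.commutes, map_smul, qRising,
      IsScalarTower.algebraMap_apply S R B, ← map_pow, algebraMap_smul]
    simp only [qNum, map_sum, map_pow]

/-- Base change of `q`-powers. -/
theorem map_qPower_baseChange {q : S} (hq : ∀ n : ℕ, 0 < n → IsUnit (qNum q n))
    (θ : A →ₐ[S] B) (m u : A) :
    PowerSeries.map (θ : A →+* B) (qPower q m u)
      = qPower (algebraMap S R q) (θ m) (θ u) := by
  have hf : ∀ n, algebraMap S R (qFact q n) = qFact (algebraMap S R q) n := fun n => by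
    induction n with
    | zero => exact map_one _
    | succ n ih => simp only [qFact, map_mul, ih, qNum, map_sum, map_pow]
  ext n
  rw [PowerSeries.coeff_map, coeff_qPower, coeff_qPower, AlgHom.coe_toRingHom, map_smul, map_mul,
    map_pow, map_qRising (R := R), ← hf, ← algebraMap_smul R (Ring.inverse (qFact q n))]
  congr 1
  -- `Ring.inverse` is preserved by a ring homomorphism at units; this is where invertibility of the
  -- q-numbers enters.
  have hu := isUnit_qFact hq n
  obtain ⟨x, hx⟩ := hu
  rw [← hx, Ring.inverse_unit]
  exact (Ring.inverse_unit (Units.map (algebraMap S R : S →* R) x)).symm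

end BaseChangeQPower

/-! ### Functoriality and commutation of q-powers; a factorization criterion. -/

section QPower

variable {R A B : Type*} [CommRing R] [Ring A] [Algebra R A] [Ring B]

theorem map_qPower [Algebra R B] (θ : A →ₐ[R] B) (q : R) (m u : A) :
    PowerSeries.map (θ : A →+* B) (qPower q m u) = qPower q (θ m) (θ u) := by
  ext n
  rw [PowerSeries.coeff_map, coeff_qPower, coeff_qPower, AlgHom.coe_toRingHom, map_smul, map_mul,
    map_pow, map_qRising (R := R), Algebra.algebraMap_self_apply]

theorem mapAlgHom_qPower [Algebra R B] (θ : A →ₐ[R] B) (q : R) (m u : A) :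
    PowerSeries.mapAlgHom θ (qPower q m u) = qPower q (θ m) (θ u) := by
  rw [PowerSeries.mapAlgHom_apply]
  exact map_qPower θ q m u

theorem SemiconjBy.qRising {q : R} {w m m' : A} (h : SemiconjBy w m m') (n : ℕ) :
    SemiconjBy w (qRising q m n) (qRising q m' n) := by
  induction n with
  | zero => exact SemiconjBy.one_right w
  | succ n ih =>
    refine ih.mul_right (SemiconjBy.add_right ?_ ?_)
    · exact (Algebra.commutes _ _).symm
    · change w * _ = _ * w
      rw [mul_smul_comm, smul_mul_assoc, h.eq]

theorem SemiconjBy.qPower {q : R} {w m m' u u' : A} (h : SemiconjBy w m m')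
    (hu : SemiconjBy w u u') :
    SemiconjBy (PowerSeries.C w) (qPower q m u) (qPower q m' u') := by
  ext n
  rw [PowerSeries.coeff_C_mul, PowerSeries.coeff_mul_C, coeff_qPower, coeff_qPower,
    mul_smul_comm, smul_mul_assoc, ((h.qRising n).mul_right (hu.pow_right n)).eq]

/-- If `m u₀^{j+1} = u₁^j ((c+j+1)_q u₁ - (j+1)_q v)`, `m = (c)_q`, then
`(1 - X u₀)_q^{(-c)} = (1 - X u₁)_q^{(-c-1)} (1 - X v)`. -/
theorem qPower_eq_mul_of_pow {q : R} (hq : ∀ n : ℕ, 0 < n → IsUnit (qNum q n)) {m u₀ u₁ v : A}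
    (h : ∀ j : ℕ, m * u₀ ^ (j + 1) = (algebraMap R A (qNum q (j + 1)) + q ^ (j + 1) • m)
      * u₁ ^ (j + 1) - qNum q (j + 1) • (u₁ ^ j * v)) :
    qPower q m u₀
      = qPower q (1 + q • m) u₁ * (1 - PowerSeries.X * PowerSeries.C v) := by
  ext n
  rw [mul_sub, mul_one, map_sub, ← mul_assoc, PowerSeries.coeff_mul_C]
  cases n with
  | zero => simp [coeff_qPower, qRising, qFact]
  | succ n =>
    -- In degree n + 1 all three terms contain (z+1)_q ⋯ (z+n)_q / (n+1)_q!. Once this is taken out,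
    -- hypothesis `h` at j = n remains.
    rw [PowerSeries.coeff_succ_mul_X, coeff_qPower, coeff_qPower, coeff_qPower, inverse_qFact hq n,
      mul_smul, smul_mul_assoc, ← smul_sub, qRising_succ', qRising, pow_succ' u₀]
    congr 1
    have hr : Commute m (qRising q (1 + q • m) n) :=
      SemiconjBy.qRising (SemiconjBy.add_right (Commute.one_right m) ((Commute.refl m).smul_right q)) n
    have e2 : algebraMap R A (qNum q n) + q ^ n • (1 + q • m)
        = algebraMap R A (qNum q (n + 1)) + q ^ (n + 1) • m := by
      rw [qNum_succ, map_add, smul_add, smul_smul, ← pow_succ, Algebra.algebraMap_eq_smul_one (q ^ n)]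
      abel
    rw [hr.eq, mul_assoc, ← pow_succ', h, e2, mul_sub, mul_assoc, mul_smul_comm, smul_mul_assoc, mul_assoc]

end QPower

/-! ### The shift identity for q-powers on a quantum plane. -/

section Shift

variable {R A : Type*} [CommRing R] [Ring A] [Algebra R A]

/-- With u₀ = g + η h f, u₁ = g + η (1 + t h) f and the scalar c set aside, this reads w u₀ = u₁ w₀.
Since k and h commute with f, g and with each other, it suffices to reorder g f as t f g - η f² and
compare the coefficients of g², f g and f²; no relation between k and h is involved. -/
theorem qPlane_exchange {t η : R} {f g k h : A} (hgf : g * f = t • (f * g) - η • f ^ 2)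
    (hkh : h * k = k * h) (hkf : f * k = k * f) (hkg : g * k = k * g) (hhf : f * h = h * f)
    (hhg : g * h = h * g) (c : R) :
    (c • (k * g + η • ((k + t • (k * h) + t • h) * f))) * (c • (g + η • (h * f)))
      = (c • (g + η • ((1 + t • h) * f))) * (c • (k * g + η • ((k * h + h) * f))) := by
  have hkh' : ∀ z, h * (k * z) = k * (h * z) := fun z => by rw [← mul_assoc, hkh, mul_assoc]
  have hkf' : ∀ z, f * (k * z) = k * (f * z) := fun z => by rw [← mul_assoc, hkf, mul_assoc]
  have hkg' : ∀ z, g * (k * z) = k * (g * z) := fun z => by rw [← mul_assoc, hkg, mul_assoc]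
  have hhf' : ∀ z, f * (h * z) = h * (f * z) := fun z => by rw [← mul_assoc, hhf, mul_assoc]
  have hhg' : ∀ z, g * (h * z) = h * (g * z) := fun z => by rw [← mul_assoc, hhg, mul_assoc]
  rw [smul_mul_smul_comm, smul_mul_smul_comm]
  congr 1
  simp only [mul_add, add_mul, smul_mul_assoc, mul_smul_comm, smul_add, smul_sub, mul_assoc, hgf,
    hkh', hkf', hkg', hhf', hhg', one_mul, mul_sub, pow_two]
  module

/-- Here k = q^z, m = (z)_q, h = (z)_t; the hypotheses `hk` and `hm` express these interpretations
without division by q - 1, so that q = 1 is allowed. Although the base u₀ itself depends on z,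
raising z by one changes the q-power only by a factor linear in X. By `qPower_eq_mul_of_pow` this
amounts to a formula for (z)_q u₀^{j+1}, which is obtained by induction from the exchange rule and
an identity linear in f, g. -/
theorem qPower_shift {q t η : R} (hq : ∀ n : ℕ, 0 < n → IsUnit (qNum q n)) (hqt : q * t = 1)
    {f g k m h : A}
    (hgf : g * f = t • (f * g) - η • f ^ 2)
    (hkh : h * k = k * h) (hkf : f * k = k * f) (hkg : g * k = k * g) (hhf : f * h = h * f)
    (hhg : g * h = h * g) (hmh : h * m = m * h) (hmf : f * m = m * f) (hmg : g * m = m * g)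
    (hk : k = 1 + (q - 1) • m) (hm : m = t • h + (1 - t) • (m * h)) (c : R) :
    qPower q m (c • (g + η • (h * f)))
      = qPower q (1 + q • m) (c • (g + η • ((1 + t • h) * f)))
        * (1 - PowerSeries.X * PowerSeries.C (c • (k * g + η • ((k + t • (k * h) + t • h) * f)))) := by
  have key := qPlane_exchange hgf hkh hkf hkg hhf hhg c
  -- In short: (z+j)_q u₀ - (j)_q w₀ = (z+j+1)_q u₁ - (j+1)_q w. It is linear in f and g, so it
  -- reduces to relations among k, m, h; j = 0 is also the base case of the induction.
  have lin : ∀ j : ℕ, (algebraMap R A (qNum q j) + q ^ j • m) * (c • (g + η • (h * f)))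
        - qNum q j • (c • (k * g + η • ((k * h + h) * f)))
      = (algebraMap R A (qNum q (j + 1)) + q ^ (j + 1) • m) * (c • (g + η • ((1 + t • h) * f)))
        - qNum q (j + 1) • (c • (k * g + η • ((k + t • (k * h) + t • h) * f))) := fun j => by
    have hj : q ^ j = 1 + (q - 1) * qNum q j := by rw [mul_comm, qNum_mul_sub_one]; ring
    have hmf' : m * f = t • (h * f) + (1 - t) • (m * (h * f)) := by
      conv_lhs => rw [hm]
      rw [add_mul, smul_mul_assoc, smul_mul_assoc, mul_assoc]
    rw [mul_smul_comm, mul_smul_comm, smul_comm _ c, smul_comm _ c, ← smul_sub, ← smul_sub]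
    congr 1
    simp only [Algebra.algebraMap_eq_smul_one, qNum_succ', pow_succ, hj, hk, mul_add, add_mul,
      smul_mul_assoc, mul_smul_comm, smul_add, mul_assoc, one_mul, hmf']
    match_scalars <;> (clear * -hqt; grind)
  refine qPower_eq_mul_of_pow hq fun j => ?_
  generalize c • (g + η • (h * f)) = u₀ at *
  generalize hu₁ : c • (g + η • ((1 + t • h) * f)) = u₁ at *
  generalize c • (k * g + η • ((k + t • (k * h) + t • h) * f)) = w at *
  generalize c • (k * g + η • ((k * h + h) * f)) = w₀ at *
  have hmu : Commute u₁ m := by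
    rw [← hu₁]
    change _ * _ = _ * _
    have hmh' : ∀ z, h * (m * z) = m * (h * z) := fun z => by rw [← mul_assoc, hmh, mul_assoc]
    simp only [mul_add, add_mul, smul_mul_assoc, mul_smul_comm, smul_add, mul_assoc, hmf, hmg, hmh',
      one_mul]
  induction j with
  | zero => simpa [qNum] using lin 0
  | succ j ih =>
    have hc : ∀ n, Commute (u₁ ^ n) (algebraMap R A (qNum q n) + q ^ n • m) := fun n =>
      Commute.add_right (Algebra.commutes _ _).symm ((hmu.pow_left n).smul_right _)
    have hc' : Commute (u₁ ^ (j + 1))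
        (algebraMap R A (qNum q (j + 1 + 1)) + q ^ (j + 1 + 1) • m) :=
      Commute.add_right (Algebra.commutes _ _).symm ((hmu.pow_left _).smul_right _)
    -- The extra factor u₀ on the right is absorbed by w u₀ = u₁ w₀, which moves u₁ to the left;
    -- then `lin` at j + 1 replaces u₀, w₀ by u₁, w.
    calc m * u₀ ^ (j + 1 + 1)
        = u₁ ^ (j + 1) * ((algebraMap R A (qNum q (j + 1)) + q ^ (j + 1) • m) * u₀
            - qNum q (j + 1) • w₀) := by
          rw [pow_succ, ← mul_assoc, ih, sub_mul, ← (hc (j + 1)).eq, smul_mul_assoc, mul_assoc,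
            mul_assoc, key, mul_sub, mul_smul_comm, pow_succ u₁ j]
          simp only [mul_assoc]
      _ = _ := by
          rw [lin, mul_sub, ← mul_assoc, hc'.eq, mul_assoc, ← pow_succ, mul_smul_comm]

end Shift

/-! ### Identities in a variable exponent follow from natural exponents. -/

section Density

variable {S E T : Type*} [CommRing S] [Ring E] [Algebra S E] [Ring T] [Algebra S T]

/-- A polynomial over a noncommutative algebra vanishes if it vanishes at scalars whose pairwise
differences are units. -/
theorem Polynomial.eq_zero_of_eval_algebraMap {a : ℕ → S}
    (ha : ∀ i j, i < j → IsUnit (a j - a i)) {P : Polynomial E}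
    (hP : ∀ n, P.eval (algebraMap S E (a n)) = 0) : P = 0 := by
  let M : Matrix (Fin (P.natDegree + 1)) (Fin (P.natDegree + 1)) S :=
    Matrix.vandermonde fun i => a i
  have hM : IsUnit M.det := by
    rw [Matrix.det_vandermonde]
    refine IsUnit.prod_iff.2 fun i _ => IsUnit.prod_iff.2 fun j hj =>
      ha _ _ (Fin.lt_def.1 (Finset.mem_Ioi.1 hj))
  -- The evaluation points are central, so evaluation is a row of a scalar matrix acting on the
  -- coefficient vector, and Cramer's rule applies although the coefficients do not commute.
  have h1 : ∀ i, ∑ j, M i j • P.coeff j = 0 := fun i => by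
    have h := hP i
    rw [Polynomial.eval_eq_sum_range, ← Fin.sum_univ_eq_sum_range
      (fun j => P.coeff j * algebraMap S E (a i) ^ j)] at h
    rw [← h]
    refine Finset.sum_congr rfl fun j _ => ?_
    rw [← map_pow, ← Algebra.commutes, ← Algebra.smul_def]
    rfl
  have h2 : ∀ k : Fin (P.natDegree + 1), P.coeff k = 0 := fun k => by
    have h3 : ∑ i, M.adjugate k i • ∑ j, M i j • P.coeff j = M.det • P.coeff k := by
      simp only [Finset.smul_sum, smul_smul]
      rw [Finset.sum_comm]
      simp only [← Finset.sum_smul, ← Matrix.mul_apply, Matrix.adjugate_mul, Matrix.smul_apply,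
        Matrix.one_apply, smul_eq_mul, mul_ite, mul_one, mul_zero, ite_smul, zero_smul,
        Finset.sum_ite_eq, Finset.mem_univ, if_true]
    simp only [h1, smul_zero, Finset.sum_const_zero] at h3
    exact (hM.smul_eq_zero).1 h3.symm
  ext k
  by_cases hk : k < P.natDegree + 1
  · exact h2 ⟨k, hk⟩
  · exact Polynomial.coeff_eq_zero_of_natDegree_lt (by omega)

/-- The difference is t^i (j-i)_t, and (n+1)_q = q^n (n+1)_t makes the t-numbers invertible together
with the q-numbers. -/
theorem isUnit_qNum_sub {q t : S} (hqt : q * t = 1) (hq : ∀ n : ℕ, 0 < n → IsUnit (qNum q n))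
    {i j : ℕ} (hij : i < j) : IsUnit (qNum t j - qNum t i) := by
  obtain ⟨n, rfl⟩ := Nat.exists_eq_add_of_lt hij
  have ht : IsUnit t := IsUnit.of_mul_eq_one q ((mul_comm _ _).trans hqt)
  have h1 : ∀ n, q ^ n * qNum t (n + 1) = qNum q (n + 1) := fun n => by
    induction n with
    | zero => simp [qNum]
    | succ n ih =>
      rw [qNum_succ' t, qNum_succ q, ← ih, pow_succ]
      linear_combination q ^ n * qNum t (n + 1) * hqt
  have h2 : qNum t (i + n + 1) - qNum t i = t ^ i * (t ^ n * qNum q (n + 1)) := by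
    rw [← h1, ← mul_assoc (t ^ n), ← mul_pow, mul_comm t q, hqt, one_pow, one_mul, add_assoc, qNum,
      Finset.sum_range_add, qNum, add_sub_cancel_left, qNum, Finset.mul_sum]
    simp only [pow_add]
  rw [h2]
  exact (ht.pow i).mul ((ht.pow n).mul (hq _ n.succ_pos))

/-- The subalgebra of pairs consisting of an element of `T`, thought of as a Laurent polynomial in
`κ = q^c` and `h = (c)_t` with coefficients in `E`, and of its values at `c = 0, 1, 2, …`. -/
def evalSubalgebra (ι : E →ₐ[S] T) (h κ κ' : T) (q t : S) : Subalgebra S (T × (ℕ → E)) :=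
  Algebra.adjoin S (Set.range (fun e => (ι e, fun _ => e)) ∪
    {(h, fun n => algebraMap S E (qNum t n)), (κ, fun n => algebraMap S E (q ^ n)),
      (κ', fun n => algebraMap S E (t ^ n))})

/-- Among the generators only κ is not polynomial in h, since κ' = 1 + (t - 1) h, and κ is cleared
by multiplying by κ'. Pairs are used because T need not be free over h: specialization at z = n may
not be a map on T, while the two components of a pair always come from the same polynomial P. -/
theorem exists_polynomial_of_mem_evalSubalgebra {ι : E →ₐ[S] T} {h κ κ' : T} {q t : S}
    (hι : ∀ e, Commute (ι e) h) (hκ' : κ' = 1 + (t - 1) • h) (hκκ : κ' * κ = 1) (hqt : q * t = 1)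
    {z : T × (ℕ → E)} (hz : z ∈ evalSubalgebra ι h κ κ' q t) :
    ∃ (N : ℕ) (P : Polynomial E), κ' ^ N * z.1 = P.eval₂ (ι : E →+* T) h ∧
      ∀ n, algebraMap S E ((t ^ n) ^ N) * z.2 n = P.eval (algebraMap S E (qNum t n)) := by
  let θ : Polynomial E →+* T := Polynomial.eval₂RingHom' (ι : E →+* T) h hι
  let ev : ℕ → Polynomial E →+* E := fun n => Polynomial.eval₂RingHom' (RingHom.id E)
    (algebraMap S E (qNum t n)) (fun e => (Algebra.commutes _ e).symm)
  have hθ : ∀ P, P.eval₂ (ι : E →+* T) h = θ P := fun _ => rfl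
  have hev : ∀ n (P : Polynomial E), P.eval (algebraMap S E (qNum t n)) = ev n P := fun _ _ => rfl
  simp only [hθ, hev]
  have hθX : θ Polynomial.X = h := Polynomial.eval₂_X _ _
  have hθC : ∀ e, θ (Polynomial.C e) = ι e := fun e => Polynomial.eval₂_C _ _
  have hevX : ∀ n, ev n Polynomial.X = algebraMap S E (qNum t n) := fun n => Polynomial.eval₂_X _ _
  have hevC : ∀ n e, ev n (Polynomial.C e) = e := fun n e => Polynomial.eval₂_C _ _
  -- The polynomial representing κ' = t^z; its coefficients are central, so it commutes with every
  -- polynomial.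
  let κX : Polynomial E := 1 + Polynomial.C (algebraMap S E (t - 1)) * Polynomial.X
  have hθκ : θ κX = κ' := by
    rw [map_add, map_one, map_mul, hθX, hθC, AlgHom.commutes, hκ', Algebra.smul_def]
  have hevκ : ∀ n, ev n κX = algebraMap S E (t ^ n) := fun n => by
    rw [map_add, map_one, map_mul, hevX, hevC, ← map_mul, mul_comm (t - 1), qNum_mul_sub_one,
      map_sub, map_one]
    abel
  have hevκN : ∀ n N, ev n (κX ^ N) = algebraMap S E ((t ^ n) ^ N) := fun n N => by
    rw [map_pow, hevκ, ← map_pow]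
  have hκX : ∀ P : Polynomial E, Commute κX P := fun P => by
    refine Commute.add_left (Commute.one_left P) (Commute.mul_left ?_ ?_)
    · rw [← Polynomial.algebraMap_apply]
      exact Algebra.commutes _ _
    · exact Polynomial.X_mul
  induction hz using Algebra.adjoin_induction with
  | mem z hz =>
    rcases hz with ⟨e, rfl⟩ | rfl | rfl | rfl
    · exact ⟨0, Polynomial.C e, by simp [hθC], by simp [hevC]⟩
    · exact ⟨0, Polynomial.X, by simp [hθX], by simp [hevX]⟩
    · refine ⟨1, 1, by simp [hκκ], fun n => ?_⟩
      rw [pow_one, ← map_mul, ← mul_pow, mul_comm, hqt, one_pow, map_one, map_one]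
    · exact ⟨0, κX, by simp [hθκ], by simp [hevκ]⟩
  | algebraMap r =>
    refine ⟨0, Polynomial.C (algebraMap S E r), ?_, fun n => ?_⟩
    · rw [hθC, AlgHom.commutes, pow_zero, one_mul]; rfl
    · rw [hevC, pow_zero, map_one, one_mul]; rfl
  | add x y _ _ hx hy =>
    obtain ⟨N₁, P₁, h1, h1'⟩ := hx
    obtain ⟨N₂, P₂, h2, h2'⟩ := hy
    -- Common denominator for the two summands.
    refine ⟨N₁ + N₂, κX ^ N₂ * P₁ + κX ^ N₁ * P₂, ?_, fun n => ?_⟩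
    · rw [map_add, map_mul, map_mul, map_pow, map_pow, hθκ, ← h1, ← h2, ← mul_assoc, ← mul_assoc,
        ← pow_add, ← pow_add, add_comm N₂, Prod.fst_add, mul_add]
    · rw [map_add, map_mul, map_mul, hevκN, hevκN, ← h1', ← h2', ← mul_assoc, ← mul_assoc, ← map_mul, ← map_mul, ← pow_add, ← pow_add, add_comm N₂, Prod.snd_add,
        Pi.add_apply, mul_add]
  | mul x y _ _ hx hy =>
    obtain ⟨N₁, P₁, h1, h1'⟩ := hx
    obtain ⟨N₂, P₂, h2, h2'⟩ := hy
    refine ⟨N₁ + N₂, P₁ * P₂, ?_, fun n => ?_⟩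
    -- The power κ'^{N₂} has to pass the first factor to reach the second; centrality of κX allows
    -- this once the first factor has become θ P₁.
    · have := congrArg θ ((hκX P₁).pow_left N₂).eq
      rw [map_mul, map_mul, map_pow, hθκ, ← h1, ← mul_assoc, ← pow_add, add_comm] at this
      rw [map_mul, Prod.fst_mul, ← mul_assoc, this, mul_assoc, h2, h1]
    · rw [map_mul, ← h1', ← h2', Prod.snd_mul, Pi.mul_apply, pow_add, map_mul, mul_assoc, mul_assoc,
        ← mul_assoc _ (x.2 n), Algebra.commutes _ (x.2 n), mul_assoc]

/-- If all specializations vanish, then so does the polynomial P of the pair, having the roots (n)_t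
with invertible differences. Hence κ'^N z.1 = 0, and κ' is invertible. -/
theorem fst_eq_zero_of_mem_evalSubalgebra {ι : E →ₐ[S] T} {h κ κ' : T} {q t : S}
    (hι : ∀ e, Commute (ι e) h) (hκ' : κ' = 1 + (t - 1) • h) (hκκ : κ' * κ = 1)
    (hκκ' : κ * κ' = 1) (hqt : q * t = 1) (hq : ∀ n : ℕ, 0 < n → IsUnit (qNum q n))
    {z : T × (ℕ → E)} (hz : z ∈ evalSubalgebra ι h κ κ' q t) (hz2 : z.2 = 0) : z.1 = 0 := by
  obtain ⟨N, P, h1, h2⟩ := exists_polynomial_of_mem_evalSubalgebra hι hκ' hκκ hqt hz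
  have hP : P = 0 := Polynomial.eq_zero_of_eval_algebraMap
    (fun i j hij => isUnit_qNum_sub hqt hq hij) fun n => by rw [← h2, hz2]; simp
  rw [hP, Polynomial.eval₂_zero] at h1
  have hc : Commute κ κ' := hκκ'.trans hκκ.symm
  calc z.1 = κ ^ N * (κ' ^ N * z.1) := by
        rw [← mul_assoc, ← hc.mul_pow, hκκ', one_pow, one_mul]
    _ = 0 := by rw [h1, mul_zero]

theorem coeff_qPower_mem {R A : Type*} [CommRing R] [Ring A] [Algebra R A] (C : Subalgebra R A)
    (q : R) {m u : A} (hm : m ∈ C) (hu : u ∈ C) (n : ℕ) :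
    PowerSeries.coeff n (qPower q m u) ∈ C := by
  have hr : ∀ n, qRising q m n ∈ C := fun n => by
    induction n with
    | zero => exact one_mem _
    | succ n ih => exact mul_mem ih (add_mem (C.algebraMap_mem _) (C.smul_mem hm _))
  rw [coeff_qPower]
  exact C.smul_mem (mul_mem (hr n) (pow_mem hu n)) _

theorem coeff_mul_mem {R A : Type*} [CommRing R] [Ring A] [Algebra R A] (C : Subalgebra R A)
    {F G : PowerSeries A} (hF : ∀ n, PowerSeries.coeff n F ∈ C)
    (hG : ∀ n, PowerSeries.coeff n G ∈ C) (n : ℕ) : PowerSeries.coeff n (F * G) ∈ C := by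
  rw [PowerSeries.coeff_mul]
  exact sum_mem fun _ _ => mul_mem (hF _) (hG _)

end Density

/-! ### The shift identity with z replaced by z + n. -/

section ShiftNat

variable {R A : Type*} [CommRing R] [Ring A] [Algebra R A]

/-- `(c + n)_q` in terms of `m = (c)_q`. -/
def qNumAdd (q : R) (m : A) (n : ℕ) : A := algebraMap R A (qNum q n) + q ^ n • m

theorem qNumAdd_zero (q : R) (m : A) : qNumAdd q m 0 = m := by simp [qNumAdd, qNum]

theorem qNumAdd_zero_right (q : R) (n : ℕ) :
    qNumAdd q (0 : A) n = algebraMap R A (qNum q n) := by simp [qNumAdd]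

theorem qNumAdd_succ (q : R) (m : A) (n : ℕ) :
    qNumAdd q m (n + 1) = 1 + q • qNumAdd q m n := by
  simp only [qNumAdd, qNum_succ', map_add, map_one, map_mul, smul_add, smul_smul, pow_succ',
    ← Algebra.smul_def, add_assoc]

theorem qNumAdd_succ' (q : R) (m : A) (n : ℕ) :
    qNumAdd q m (n + 1) = qNumAdd q (1 + q • m) n := by
  simp only [qNumAdd, qNum_succ, map_add, smul_add, smul_smul, pow_succ,
    Algebra.algebraMap_eq_smul_one (q ^ n), add_assoc]

theorem commute_qNumAdd {q : R} {x m : A} (h : Commute x m) (n : ℕ) :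
    Commute x (qNumAdd q m n) :=
  Commute.add_right (Algebra.commutes _ _).symm (h.smul_right _)

theorem semiconjBy_qNumAdd {q : R} {x m : A} (h : SemiconjBy x m (1 + q • m)) (n : ℕ) :
    SemiconjBy x (qNumAdd q m n) (qNumAdd q m (n + 1)) := by
  rw [qNumAdd_succ']
  refine SemiconjBy.add_right (Algebra.commutes _ _).symm ?_
  change x * _ = _ * x
  rw [mul_smul_comm, smul_mul_assoc, h.eq]

theorem map_qNumAdd {B : Type*} [Ring B] [Algebra R B] (θ : A →ₐ[R] B) (q : R) (m : A) (n : ℕ) :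
    θ (qNumAdd q m n) = qNumAdd q (θ m) n := by
  rw [qNumAdd, map_add, AlgHom.commutes, map_smul, qNumAdd]

/-- The triple q^n k, (z+n)_q, (z+n)_t satisfies the same relations as k, (z)_q, (z)_t, so
`qPower_shift` applies to it. -/
theorem qPower_shift_nat {q t η : R} (hq : ∀ n : ℕ, 0 < n → IsUnit (qNum q n)) (hqt : q * t = 1)
    {f g k m h : A} (hgf : g * f = t • (f * g) - η • f ^ 2)
    (hkh : Commute h k) (hkf : Commute f k) (hkg : Commute g k) (hhf : Commute f h)
    (hhg : Commute g h) (hmh : Commute h m) (hmf : Commute f m) (hmg : Commute g m)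
    (hk : k = 1 + (q - 1) • m) (hm : m = t • h + (1 - t) • (m * h)) (c : R) (n : ℕ) :
    qPower q (qNumAdd q m n) (c • (g + η • (qNumAdd t h n * f)))
      = qPower q (qNumAdd q m (n + 1)) (c • (g + η • (qNumAdd t h (n + 1) * f)))
        * (1 - PowerSeries.X * PowerSeries.C (c • (q ^ n • k * g
          + η • ((q ^ n • k + t • (q ^ n • k * qNumAdd t h n) + t • qNumAdd t h n) * f)))) := by
  have hk' : q ^ n • k = 1 + (q - 1) • qNumAdd q m n := by
    induction n with
    | zero => rw [qNumAdd_zero, pow_zero, one_smul, hk]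
    | succ n ih =>
      rw [qNumAdd_succ, pow_succ', mul_smul, ih]
      module
  have hm' : qNumAdd q m n = t • qNumAdd t h n + (1 - t) • (qNumAdd q m n * qNumAdd t h n) := by
    induction n with
    | zero => rw [qNumAdd_zero, qNumAdd_zero, ← hm]
    | succ n ih =>
      -- The induction hypothesis needs the formula for q^n k; it is recovered from the one for
      -- q^{n+1} k by multiplying by t.
      have ih' := ih (by
        have h1 := hk'
        rw [qNumAdd_succ, pow_succ', mul_smul] at h1
        have h2 := congrArg (t • ·) h1
        simp only [smul_add, smul_smul] at h2
        rw [← mul_assoc, mul_comm t q, hqt, one_mul] at h2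
        rw [h2]
        match_scalars <;> (clear * -hqt; grind))
      rw [qNumAdd_succ, qNumAdd_succ]
      simp only [mul_add, add_mul, mul_one, one_mul, smul_mul_assoc, mul_smul_comm]
      generalize qNumAdd q m n = M at *
      generalize qNumAdd t h n = N at *
      generalize M * N = P at *
      rw [ih']
      match_scalars <;> (clear * -hqt; grind)
  rw [qNumAdd_succ, qNumAdd_succ]
  exact qPower_shift hq hqt hgf ((commute_qNumAdd hkh.symm n).symm.smul_right _)
    (hkf.smul_right _) (hkg.smul_right _) (commute_qNumAdd hhf n) (commute_qNumAdd hhg n)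
    (commute_qNumAdd (commute_qNumAdd hmh.symm n).symm n) (commute_qNumAdd hmf n)
    (commute_qNumAdd hmg n) hk' hm' c

end ShiftNat

/-- A family of elements of a bialgebra satisfying the relations and having the comultiplications
and counits of the generators of `Bq`, with `q` and `t` in place of `q²` and `q⁻²`. -/
structure IsBorelSystem {S A : Type*} [CommRing S] [Ring A] [Bialgebra S A] (q t η : S)
    (x : BqGen → A) : Prop where
  K_mul_K' : x .K * x .K' = 1
  K'_mul_K : x .K' * x .K = 1
  K'_eq : x .K' = 1 + (t - 1) • x .H
  H_K : x .H * x .K = x .K * x .H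
  K_f0 : x .K * x .f0 = t • (x .f0 * x .K)
  K_f1 : x .K * x .f1 = t • (x .f1 * x .K)
  H_f0 : x .H * x .f0 = q • (x .f0 * x .H - x .f0)
  H_f1 : x .H * x .f1 = q • (x .f1 * x .H - x .f1)
  f1_f0 : x .f1 * x .f0 = t • (x .f0 * x .f1) - η • x .f0 ^ 2
  comul_K : Coalgebra.comul (R := S) (x .K) = x .K ⊗ₜ x .K
  comul_K' : Coalgebra.comul (R := S) (x .K') = x .K' ⊗ₜ x .K'
  comul_H : Coalgebra.comul (R := S) (x .H) = x .H ⊗ₜ 1 + x .K' ⊗ₜ x .H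
  comul_f0 : Coalgebra.comul (R := S) (x .f0) = x .f0 ⊗ₜ 1 + x .K' ⊗ₜ x .f0
  comul_f1 : Coalgebra.comul (R := S) (x .f1)
    = x .f1 ⊗ₜ 1 + x .K ⊗ₜ x .f1 + η • (x .H * (1 + x .K)) ⊗ₜ x .f0
  counit_K : Coalgebra.counit (R := S) (x .K) = 1
  counit_K' : Coalgebra.counit (R := S) (x .K') = 1
  counit_H : Coalgebra.counit (R := S) (x .H) = 0
  counit_f0 : Coalgebra.counit (R := S) (x .f0) = 0
  counit_f1 : Coalgebra.counit (R := S) (x .f1) = 0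

/-! ### The twist of a Borel system and its values at natural exponents. -/

namespace IsBorelSystem

variable {S A : Type*} [CommRing S] [Ring A] [Bialgebra S A] {q t η : S} {x : BqGen → A}

theorem K_eq (hx : IsBorelSystem q t η x) : x .K = 1 - (t - 1) • (x .K * x .H) := by
  have h : x .K * x .K' = 1 := hx.K_mul_K'
  rw [hx.K'_eq, mul_add, mul_one, mul_smul_comm] at h
  exact eq_sub_of_add_eq h

/-- With m = t K H in the role of (z)_q, this is q^z = 1 + (q - 1)(z)_q; together with `m_eq` it
supplies the hypotheses `hk` and `hm` of the shift identity. -/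
theorem K_eq' (hx : IsBorelSystem q t η x) (hqt : q * t = 1) :
    x .K = 1 + (q - 1) • (t • (x .K * x .H)) := by
  conv_lhs => rw [hx.K_eq]
  match_scalars <;> (clear * -hqt; grind)

theorem m_eq (hx : IsBorelSystem q t η x) (hqt : q * t = 1) :
    t • (x .K * x .H) = t • x .H + (1 - t) • ((t • (x .K * x .H)) * x .H) := by
  conv_lhs => rw [hx.K_eq' hqt]
  rw [add_mul, one_mul, smul_mul_assoc, smul_add]
  match_scalars <;> (clear * -hqt; grind)

/-- Moving f to the right past (z)_t turns it into (z+1)_t; `semiconjBy_m` is the same for (z)_q. -/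
theorem semiconjBy_H (hqt : q * t = 1) {f h : A} (hf : h * f = q • (f * h - f)) :
    SemiconjBy f h (1 + t • h) := by
  change f * h = (1 + t • h) * f
  rw [add_mul, one_mul, smul_mul_assoc, hf]
  match_scalars <;> (clear * -hqt; grind)

theorem semiconjBy_m (hx : IsBorelSystem q t η x) (hqt : q * t = 1) {f : A}
    (hK : x .K * f = t • (f * x .K)) (hf : x .H * f = q • (f * x .H - f)) :
    SemiconjBy f (t • (x .K * x .H)) (1 + q • (t • (x .K * x .H))) := by
  change f * _ = _ * f
  have h : x .K * (x .H * f) = q • (t • (f * (x .K * x .H)) - t • (f * x .K)) := by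
    rw [hf, mul_smul_comm, mul_sub, ← mul_assoc, hK, smul_mul_assoc, mul_assoc]
  rw [smul_smul, hqt, one_smul, add_mul, one_mul, mul_assoc, h, mul_smul_comm]
  have : f * x .K = f - (t - 1) • (f * (x .K * x .H)) := by
    conv_lhs => rw [hx.K_eq]
    rw [mul_sub, mul_one, mul_smul_comm]
  rw [this]
  match_scalars <;> (clear * -hqt; grind)

theorem commute_KH (hx : IsBorelSystem q t η x) : Commute (x .H) (x .K) := hx.H_K

theorem commute_Hm (hx : IsBorelSystem q t η x) : Commute (x .H) (t • (x .K * x .H)) :=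
  (hx.commute_KH.mul_right (Commute.refl _)).smul_right _

/-- The twist `(1 - X c (1 ⊗ f₁ + η H ⊗ f₀))_q^{(-m ⊗ 1)}`, with `m = (c)_q` shifted to
`(c + n)_q`. -/
noncomputable def twist (q t η c : S) (x : BqGen → A) (n : ℕ) : PowerSeries (A ⊗[S] A) :=
  qPower q (qNumAdd q (t • (x .K * x .H)) n ⊗ₜ 1)
    (c • (1 ⊗ₜ x .f1 + η • (qNumAdd t (x .H) n ⊗ₜ x .f0)))

/-- The value of the twist when the first tensor factor is specialized to the integer `n`. -/
noncomputable def twistValue (q t η c : S) (x : BqGen → A) (n : ℕ) : PowerSeries A :=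
  qPower q (qNumAdd q 0 n) (c • (x .f1 + η • (qNumAdd t 0 n * x .f0)))

/-- The ratio `1 - X twistRatio` of `twistValue n` and `twistValue (n + 1)`. -/
def twistRatio (q t η c : S) (x : BqGen → A) (n : ℕ) : A :=
  c • (q ^ n • (1 : A) * x .f1 + η • ((q ^ n • (1 : A) + t • (q ^ n • (1 : A) * qNumAdd t 0 n)
    + t • qNumAdd t 0 n) * x .f0))

/-- The shift identity at z = 0, that is k = 1 and m = h = 0, where its relations hold trivially.
The unsimplified factors q^n • 1 in `twistRatio` come from this substitution. -/
theorem twistValue_eq (hx : IsBorelSystem q t η x) (hqt : q * t = 1)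
    (hq : ∀ n : ℕ, 0 < n → IsUnit (qNum q n)) (c : S) (n : ℕ) :
    twistValue q t η c x n = twistValue q t η c x (n + 1)
      * (1 - PowerSeries.X * PowerSeries.C (twistRatio q t η c x n)) :=
  qPower_shift_nat (k := 1) hq hqt hx.f1_f0 (Commute.zero_left _) (Commute.one_right _)
    (Commute.one_right _) (Commute.zero_right _) (Commute.zero_right _) (Commute.zero_right _)
    (Commute.zero_right _) (Commute.zero_right _) (by simp) (by simp) c n

theorem qNumAdd_tmul (q : S) (m : A) (n : ℕ) :
    qNumAdd q (m ⊗ₜ[S] (1 : A)) n = qNumAdd q m n ⊗ₜ 1 :=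
  (map_qNumAdd (Algebra.TensorProduct.includeLeft : A →ₐ[S] A ⊗[S] A) q m n).symm

/-- The shift identity with k, m, h in the first leg and f, g in the second, so that all required
commutations hold; the linear factor is the element s_n. -/
theorem twist_eq (hx : IsBorelSystem q t η x) (hqt : q * t = 1)
    (hq : ∀ n : ℕ, 0 < n → IsUnit (qNum q n)) (c : S) (n : ℕ) :
    twist q t η c x n = twist q t η c x (n + 1) * (1 - PowerSeries.X * PowerSeries.C
      (c • ((q ^ n • x .K) ⊗ₜ x .f1 + η • ((q ^ n • x .K + t • (q ^ n • x .K * qNumAdd t (x .H) n)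
        + t • qNumAdd t (x .H) n) ⊗ₜ x .f0)))) := by
  have hc : ∀ a b : A, Commute ((1 : A) ⊗ₜ[S] a) (b ⊗ₜ[S] (1 : A)) := fun a b => by
    simp [Commute, SemiconjBy]
  have hl : ∀ {a b : A}, Commute a b → Commute (a ⊗ₜ[S] (1 : A)) (b ⊗ₜ[S] (1 : A)) := fun h => by
    simp [Commute, SemiconjBy, h.eq]
  have key := qPower_shift_nat (q := q) (t := t) (η := η) (f := (1 : A) ⊗ₜ[S] x .f0)
    (g := (1 : A) ⊗ₜ[S] x .f1)
    (k := x .K ⊗ₜ[S] (1 : A)) (m := (t • (x .K * x .H)) ⊗ₜ[S] (1 : A)) (h := x .H ⊗ₜ[S] (1 : A))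
    hq hqt (by simp [hx.f1_f0, TensorProduct.tmul_sub]) (hl hx.commute_KH)
    (hc _ _) (hc _ _) (hc _ _) (hc _ _) (hl hx.commute_Hm) (hc _ _) (hc _ _)
    (by conv_lhs => rw [hx.K_eq' hqt]
        rw [TensorProduct.add_tmul, ← TensorProduct.smul_tmul', Algebra.TensorProduct.one_def])
    (by conv_lhs => rw [hx.m_eq hqt]
        rw [TensorProduct.add_tmul, ← TensorProduct.smul_tmul', ← TensorProduct.smul_tmul',
          Algebra.TensorProduct.tmul_mul_tmul, one_mul]) c n
  simpa only [qNumAdd_tmul, TensorProduct.smul_tmul', Algebra.TensorProduct.tmul_mul_tmul, one_mul,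
    mul_one, ← TensorProduct.add_tmul, twist] using key

/-- The element r_n is a scalar combination of f₀ and f₁, each of which raises z by one. It acts in
the first leg, where F_n contains only functions of z. -/
theorem semiconjBy_twistRatio (hx : IsBorelSystem q t η x) (hqt : q * t = 1) (c : S) (n : ℕ) :
    SemiconjBy (PowerSeries.C (twistRatio q t η c x n ⊗ₜ[S] (1 : A))) (twist q t η c x n)
      (twist q t η c x (n + 1)) := by
  have h1 : ∀ {y z : A}, SemiconjBy (x .f0) y z → SemiconjBy (x .f1) y z →
      SemiconjBy (twistRatio q t η c x n) y z := by
    intro y z h0 h1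
    change _ * _ = _ * _
    simp only [twistRatio, qNumAdd_zero_right, Algebra.algebraMap_eq_smul_one, smul_mul_assoc,
      one_mul, add_mul, smul_add, mul_smul_comm, mul_add, h0.eq, h1.eq]
  have h2 : ∀ {y z : A} (w : A), SemiconjBy (twistRatio q t η c x n) y z →
      SemiconjBy (twistRatio q t η c x n ⊗ₜ[S] (1 : A)) (y ⊗ₜ w) (z ⊗ₜ w) := by
    intro y z w h
    change _ * _ = _ * _
    simp only [Algebra.TensorProduct.tmul_mul_tmul, one_mul, mul_one, h.eq]
  have h3 : ∀ {y z w : A ⊗[S] A} (r : S), SemiconjBy w y z → SemiconjBy w (r • y) (r • z) := by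
    intro y z w r h
    change _ * _ = _ * _
    rw [mul_smul_comm, smul_mul_assoc, h.eq]
  refine SemiconjBy.qPower (h2 _ (h1 ?_ ?_)) (h3 _ (SemiconjBy.add_right (h2 _
    (SemiconjBy.one_right _)) (h3 _ (h2 _ (h1 ?_ ?_)))))
  · exact semiconjBy_qNumAdd (hx.semiconjBy_m hqt hx.K_f0 hx.H_f0) n
  · exact semiconjBy_qNumAdd (hx.semiconjBy_m hqt hx.K_f1 hx.H_f1) n
  · exact semiconjBy_qNumAdd (semiconjBy_H hqt hx.H_f0) n
  · exact semiconjBy_qNumAdd (semiconjBy_H hqt hx.H_f1) n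

/-- The key compatibility: the part of Δ(r_n) other than r_n ⊗ 1 is precisely the factor s_n
relating F_n to F_{n+1}. The mixed term of Δ(f₁) is what makes the coefficients at f₀ agree. -/
theorem comul_twistRatio (hx : IsBorelSystem q t η x) (hqt : q * t = 1) (c : S) (n : ℕ) :
    Bialgebra.comulAlgHom S A (twistRatio q t η c x n) = twistRatio q t η c x n ⊗ₜ 1
      + c • ((q ^ n • x .K) ⊗ₜ x .f1 + η • ((q ^ n • x .K + t • (q ^ n • x .K * qNumAdd t (x .H) n)
        + t • qNumAdd t (x .H) n) ⊗ₜ x .f0)) := by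
  have hbb : q ^ n * t ^ n = 1 := by rw [← mul_pow, hqt, one_pow]
  have ha : t ^ n = 1 + (t - 1) * qNum t n := by rw [mul_comm, qNum_mul_sub_one]; ring
  -- First leg of the terms ending in f₀. On the right, H(1 + K) comes from the mixed term of Δ(f₁)
  -- and K' from Δ(f₀). For n = 0 this is a consequence of 1 + t (z)_t = (z)_t + t^z.
  have hcoef : q ^ n • x .K + t • (q ^ n • x .K * qNumAdd t (x .H) n) + t • qNumAdd t (x .H) n
      = q ^ n • (x .H * (1 + x .K)) + (q ^ n + t * q ^ n * qNum t n + t * qNum t n) • x .K' := by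
    rw [mul_add, mul_one, hx.H_K, hx.K'_eq]
    simp only [qNumAdd, Algebra.algebraMap_eq_smul_one, mul_add, smul_mul_assoc, mul_smul_comm,
      mul_one]
    generalize hJ : x .K * x .H = J
    rw [show x .K = 1 - (t - 1) • J by rw [← hJ]; exact hx.K_eq]
    generalize q ^ n = b at *
    generalize t ^ n = b' at *
    generalize qNum t n = a at *
    match_scalars <;> (clear * -hqt hbb ha; grind)
  rw [hcoef]
  simp only [twistRatio, qNumAdd_zero_right, Algebra.algebraMap_eq_smul_one, smul_mul_assoc, one_mul,
    map_smul, map_add, Bialgebra.comulAlgHom_apply, hx.comul_f0, hx.comul_f1, add_mul,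
    TensorProduct.add_tmul, ← TensorProduct.smul_tmul', smul_add, mul_smul_comm, mul_one]
  module

/-- The cocycle equation at z = n: F_0 Δ(P_n) = (P_n ⊗ 1) F_n. Passing from n to n + 1 uses P_n =
P_{n+1} (1 - X r_n) and cancels Δ(1 - X r_n), whose constant term is 1. -/
theorem twist_mul_comul_twistValue (hx : IsBorelSystem q t η x) (hqt : q * t = 1)
    (hq : ∀ n : ℕ, 0 < n → IsUnit (qNum q n)) (c : S) (n : ℕ) :
    twist q t η c x 0 * PowerSeries.mapAlgHom (Bialgebra.comulAlgHom S A) (twistValue q t η c x n)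
      = PowerSeries.mapAlgHom (Algebra.TensorProduct.includeLeft : A →ₐ[S] A ⊗[S] A)
        (twistValue q t η c x n) * twist q t η c x n := by
  induction n with
  | zero =>
    have : twistValue q t η c x 0 = 1 := by
      rw [twistValue, qNumAdd_zero, qPower_zero_left]
    rw [this, map_one, map_one, mul_one, one_mul]
  | succ n ih =>
    set y : PowerSeries A := 1 - PowerSeries.X * PowerSeries.C (twistRatio q t η c x n) with hy
    have hyC : ∀ θ : A →ₐ[S] A ⊗[S] A, PowerSeries.mapAlgHom θ y
        = 1 - PowerSeries.X * PowerSeries.C (θ (twistRatio q t η c x n)) := fun θ => by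
      rw [hy, PowerSeries.mapAlgHom_apply]
      simp
    have hu : IsUnit (PowerSeries.mapAlgHom (Bialgebra.comulAlgHom S A) y) := by
      rw [hyC]
      exact PowerSeries.isUnit_iff_constantCoeff.2 (by simp)
    -- Move r_n ⊗ 1 through F_n, write the remaining F_n as F_{n+1} (1 - X s_n), and collect r_n ⊗ 1
    -- + s_n = Δ(r_n).
    have step : PowerSeries.mapAlgHom (Algebra.TensorProduct.includeLeft : A →ₐ[S] A ⊗[S] A) y
        * twist q t η c x n
        = twist q t η c x (n + 1) * PowerSeries.mapAlgHom (Bialgebra.comulAlgHom S A) y := by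
      rw [hyC, hyC, hx.comul_twistRatio hqt, sub_mul, one_mul, mul_assoc,
        Algebra.TensorProduct.includeLeft_apply, (hx.semiconjBy_twistRatio hqt c n).eq, map_add,
        mul_add, mul_sub, mul_add, mul_one]
      conv_lhs => rw [hx.twist_eq hqt hq]
      rw [mul_sub, mul_one, ← mul_assoc PowerSeries.X, ← mul_assoc _ PowerSeries.X,
        ← mul_assoc _ PowerSeries.X, ← (PowerSeries.commute_X (twist q t η c x (n + 1))).eq]
      abel
    rw [hx.twistValue_eq hqt hq, map_mul, map_mul, ← hy, mul_assoc, step, ← mul_assoc,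
      ← mul_assoc] at ih
    exact hu.mul_right_cancel ih

end IsBorelSystem

/-! ### Reduction of the twist axioms to the cocycle and counit conditions. -/

section Twist

variable {R A : Type*} [CommRing R] [Ring A] [Bialgebra R A]

theorem map_ringInverse {M N G : Type*} [MonoidWithZero M] [MonoidWithZero N] [FunLike G M N]
    [MonoidHomClass G M N] (f : G) {a : M} (ha : IsUnit a) : f (Ring.inverse a) = Ring.inverse (f a) := by
  obtain ⟨u, rfl⟩ := ha
  rw [Ring.inverse_unit]
  exact (Ring.inverse_unit (Units.map (MonoidHomClass.toMonoidHom f) u)).symm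

/-- The conditions on `Δ^F` follow from the cocycle and counit conditions on `F`. -/
theorem IsTwist.of_cocycle {F : PowerSeries (A ⊗[R] A)} (hF : IsUnit F)
    (hc : twist12 F * comulLeft F = twist23 F * comulRight F) (hl : counitLeft F = 1)
    (hr : counitRight F = 1) : IsTwist F where
  isUnit := hF
  cocycle := hc
  counit_left := hl
  counit_right := hr
  twisted_coassoc a := by
    have h1 : ∀ θ : A ⊗[R] A →ₐ[R] A ⊗[R] A ⊗[R] A, PowerSeries.mapAlgHom θ (twistedComul F a)
        = PowerSeries.mapAlgHom θ F * PowerSeries.C (θ (Coalgebra.comul (R := R) a))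
          * Ring.inverse (PowerSeries.mapAlgHom θ F) := fun θ => by
      rw [twistedComul, map_mul, map_mul, PowerSeries.mapAlgHom_apply _ (PowerSeries.C _),
        PowerSeries.map_C]
      congr 1
      exact map_ringInverse (PowerSeries.mapAlgHom θ) hF
    -- Successive conjugations by H and G are conjugation by G H. The two iterated coproducts are
    -- thus conjugates by the two sides of the cocycle equation, and coassociativity of Δ identifies
    -- what is conjugated.
    have h2 : ∀ G H : PowerSeries (A ⊗[R] A ⊗[R] A), ∀ z, IsUnit G → IsUnit H →
        G * (H * z * Ring.inverse H) * Ring.inverse G = G * H * z * Ring.inverse (G * H) := by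
      rintro _ _ z ⟨G, rfl⟩ ⟨H, rfl⟩
      rw [← Units.val_mul, Ring.inverse_unit, Ring.inverse_unit, Ring.inverse_unit, mul_inv_rev,
        Units.val_mul, Units.val_mul]
      simp only [mul_assoc]
    have hu : ∀ θ : A ⊗[R] A →ₐ[R] A ⊗[R] A ⊗[R] A, IsUnit (PowerSeries.mapAlgHom θ F) :=
      fun θ => hF.map _
    have hco : (Algebra.TensorProduct.map (Bialgebra.comulAlgHom R A) (AlgHom.id R A))
          (Coalgebra.comul (R := R) a)
        = (Algebra.TensorProduct.assoc R R R A A A).symm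
          ((Algebra.TensorProduct.map (AlgHom.id R A) (Bialgebra.comulAlgHom R A))
            (Coalgebra.comul (R := R) a)) := by
      rw [AlgEquiv.eq_symm_apply]
      exact Coalgebra.coassoc_apply a
    rw [twist12, twist23, comulLeft, comulRight, h1, h1, h2 _ _ _ (hu _) (hu _), h2 _ _ _ (hu _) (hu _), hco]
    change twist12 F * comulLeft F * _ * Ring.inverse (twist12 F * comulLeft F) = _
    rw [hc]
    rfl
  twisted_counit_left a := by
    have hi : counitLeft (Ring.inverse F) = 1 := by
      rw [counitLeft] at hl ⊢
      rw [map_ringInverse _ hF, hl, Ring.inverse_one]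
    rw [counitLeft] at hl hi ⊢
    rw [twistedComul, map_mul, map_mul, hl, hi, one_mul, mul_one, PowerSeries.mapAlgHom_apply,
      PowerSeries.map_C]
    congr 1
    have := congrArg (TensorProduct.lid R A) (Coalgebra.rTensor_counit_comul (R := R) a)
    rw [TensorProduct.lid_tmul, one_smul] at this
    exact this
  twisted_counit_right a := by
    have hi : counitRight (Ring.inverse F) = 1 := by
      rw [counitRight] at hr ⊢
      rw [map_ringInverse _ hF, hr, Ring.inverse_one]
    rw [counitRight] at hr hi ⊢
    rw [twistedComul, map_mul, map_mul, hr, hi, one_mul, mul_one, PowerSeries.mapAlgHom_apply,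
      PowerSeries.map_C]
    congr 1
    have := congrArg (TensorProduct.rid R A) (Coalgebra.lTensor_counit_comul (R := R) a)
    rw [TensorProduct.rid_tmul, one_smul] at this
    exact this

end Twist

/-! ### The cocycle equation for a Borel system. -/

namespace IsBorelSystem

variable {S A : Type*} [CommRing S] [Ring A] [Bialgebra S A] {q t η : S} {x : BqGen → A}

/-- The specialization of m = t K H at z = n: it guarantees that m takes the value (n)_q where H
takes the value (n)_t. -/
theorem mul_pow_mul_qNum (hqt : q * t = 1) (n : ℕ) : t * (q ^ n * qNum t n) = qNum q n := by
  induction n with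
  | zero => simp [qNum]
  | succ n ih =>
    rw [qNum_succ', qNum_succ, ← ih, pow_succ]
    linear_combination (q ^ n + t * q ^ n * qNum t n) * hqt

/-- Multiplying Δ(K) by Δ(H) gives m ⊗ K + 1 ⊗ m. Rewriting K as 1 + (q - 1) m makes z of the first
leg the integer to be specialized: (z + z')_q = (z)_q + q^z (z')_q. -/
theorem comul_m (hx : IsBorelSystem q t η x) (hqt : q * t = 1) :
    Coalgebra.comul (R := S) (t • (x .K * x .H))
      = (t • (x .K * x .H)) ⊗ₜ 1 + x .K ⊗ₜ (t • (x .K * x .H)) := by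
  have e : ∀ y : A, x .K ⊗ₜ[S] y = 1 ⊗ₜ y + (q - 1) • (t • (x .K * x .H)) ⊗ₜ y := fun y => by
    conv_lhs => rw [hx.K_eq' hqt]
    rw [TensorProduct.add_tmul, ← TensorProduct.smul_tmul']
  have e' : ∀ y : A, y ⊗ₜ[S] x .K = y ⊗ₜ 1 + (q - 1) • y ⊗ₜ (t • (x .K * x .H)) := fun y => by
    conv_lhs => rw [hx.K_eq' hqt]
    rw [TensorProduct.tmul_add, TensorProduct.tmul_smul]
  have h : Coalgebra.comul (R := S) (t • (x .K * x .H))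
      = (t • (x .K * x .H)) ⊗ₜ x .K + 1 ⊗ₜ (t • (x .K * x .H)) := by
    rw [map_smul, Bialgebra.comul_mul, hx.comul_K, hx.comul_H, mul_add,
      Algebra.TensorProduct.tmul_mul_tmul, Algebra.TensorProduct.tmul_mul_tmul, hx.K_mul_K', mul_one,
      smul_add, TensorProduct.smul_tmul', TensorProduct.tmul_smul]
  rw [h, e, e']
  abel

/-- The first tensor factor, as a variable `c` with `κ = q^c`, ranges over the nonnegative
integers in `twist_mul_comul_twistValue`; by density the formula holds for the variable itself. -/
theorem twist_cocycle (hx : IsBorelSystem q t η x) (hqt : q * t = 1)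
    (hq : ∀ n : ℕ, 0 < n → IsUnit (qNum q n)) (c : S) :
    twist12 (twist q t η c x 0) * comulLeft (twist q t η c x 0)
      = twist23 (twist q t η c x 0) * comulRight (twist q t η c x 0) := by
  let as : A ⊗[S] (A ⊗[S] A) →ₐ[S] A ⊗[S] A ⊗[S] A :=
    (Algebra.TensorProduct.assoc S S S A A A).symm.toAlgHom
  let ι : A ⊗[S] A →ₐ[S] A ⊗[S] A ⊗[S] A := as.comp Algebra.TensorProduct.includeRight
  let lg : A →ₐ[S] A ⊗[S] A ⊗[S] A := as.comp Algebra.TensorProduct.includeLeft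
  have hlg : ∀ a, lg a = (a ⊗ₜ 1) ⊗ₜ 1 := fun a => by
    simp [lg, as, Algebra.TensorProduct.one_def]
  have hι : ∀ a b, ι (a ⊗ₜ b) = (1 ⊗ₜ a) ⊗ₜ b := fun a b => by simp [ι, as]
  have hcomm : ∀ e a, Commute (ι e) (lg a) := fun e a => by
    change as _ * as _ = as _ * as _
    rw [← map_mul, ← map_mul]
    simp
  let C := evalSubalgebra ι (lg (x .H)) (lg (x .K)) (lg (x .K')) q t
  let cst : A ⊗[S] A → (A ⊗[S] A ⊗[S] A) × (ℕ → A ⊗[S] A) := fun e => (ι e, fun _ => e)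
  let hQ : (A ⊗[S] A ⊗[S] A) × (ℕ → A ⊗[S] A) :=
    (lg (x .H), fun n => algebraMap S _ (qNum t n))
  let κ : (A ⊗[S] A ⊗[S] A) × (ℕ → A ⊗[S] A) := (lg (x .K), fun n => algebraMap S _ (q ^ n))
  let κ' : (A ⊗[S] A ⊗[S] A) × (ℕ → A ⊗[S] A) := (lg (x .K'), fun n => algebraMap S _ (t ^ n))
  have hcst : ∀ e, cst e ∈ C := fun e => Algebra.subset_adjoin (Or.inl ⟨e, rfl⟩)
  have hhQ : hQ ∈ C := Algebra.subset_adjoin (Or.inr (Or.inl rfl))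
  have hκ : κ ∈ C := Algebra.subset_adjoin (Or.inr (Or.inr (Or.inl rfl)))
  have hκ' : κ' ∈ C := Algebra.subset_adjoin (Or.inr (Or.inr (Or.inr rfl)))
  let mQ := t • (κ * hQ)
  have hmQ : mQ ∈ C := C.smul_mem (mul_mem hκ hhQ) t
  let m : A := t • (x .K * x .H)
  -- Lifts of the four factors of the cocycle equation to series of pairs; their coefficients lie in
  -- C because they are built from its generators.
  let L₁ := qPower q mQ (c • (cst (x .f1 ⊗ₜ 1) + η • (hQ * cst (x .f0 ⊗ₜ 1))))
  let L₂ := qPower q (mQ + κ * cst (m ⊗ₜ 1)) (c • (cst (1 ⊗ₜ x .f1)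
    + η • (hQ * cst (1 ⊗ₜ x .f0) + κ' * cst (x .H ⊗ₜ x .f0))))
  let R₁ := qPower q (cst (m ⊗ₜ 1)) (c • (cst (1 ⊗ₜ x .f1) + η • cst (x .H ⊗ₜ x .f0)))
  let R₂ := qPower q mQ (c • (cst (Coalgebra.comul (R := S) (x .f1))
    + η • (hQ * cst (Coalgebra.comul (R := S) (x .f0)))))
  have hL : ∀ n, PowerSeries.coeff n (L₁ * L₂) ∈ C := coeff_mul_mem C
    (coeff_qPower_mem C q hmQ (C.smul_mem (add_mem (hcst _) (C.smul_mem (mul_mem hhQ (hcst _)) _)) _))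
    (coeff_qPower_mem C q (add_mem hmQ (mul_mem hκ (hcst _))) (C.smul_mem (add_mem (hcst _)
      (C.smul_mem (add_mem (mul_mem hhQ (hcst _)) (mul_mem hκ' (hcst _))) _)) _))
  have hR : ∀ n, PowerSeries.coeff n (R₁ * R₂) ∈ C := coeff_mul_mem C
    (coeff_qPower_mem C q (hcst _) (C.smul_mem (add_mem (hcst _) (C.smul_mem (hcst _) _)) _))
    (coeff_qPower_mem C q hmQ (C.smul_mem (add_mem (hcst _) (C.smul_mem (mul_mem hhQ (hcst _)) _)) _))
  let fst : (A ⊗[S] A ⊗[S] A) × (ℕ → A ⊗[S] A) →ₐ[S] A ⊗[S] A ⊗[S] A := AlgHom.fst S _ _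
  let ev : ℕ → (A ⊗[S] A ⊗[S] A) × (ℕ → A ⊗[S] A) →ₐ[S] A ⊗[S] A := fun n =>
    (Pi.evalAlgHom S _ n).comp (AlgHom.snd S _ _)
  have fcst : ∀ e, fst (cst e) = ι e := fun _ => rfl
  have fh : fst hQ = lg (x .H) := rfl
  have fκ : fst κ = lg (x .K) := rfl
  have fκ' : fst κ' = lg (x .K') := rfl
  have fm : fst mQ = lg m := by
    simp only [mQ, m, map_smul, map_mul, fh, fκ]
  have ecst : ∀ n e, ev n (cst e) = e := fun _ _ => rfl
  have eh : ∀ n, ev n hQ = algebraMap S _ (qNum t n) := fun _ => rfl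
  have eκ : ∀ n, ev n κ = algebraMap S _ (q ^ n) := fun _ => rfl
  have eκ' : ∀ n, ev n κ' = algebraMap S _ (t ^ n) := fun _ => rfl
  have em : ∀ n, ev n mQ = algebraMap S _ (qNum q n) := fun n => by
    rw [map_smul, map_mul, eh, eκ, ← map_mul, Algebra.smul_def, ← map_mul, mul_pow_mul_qNum hqt]
  -- The first components give back the four factors over A ⊗ A ⊗ A.
  have m12 : twist12 (twist q t η c x 0) = PowerSeries.mapAlgHom fst L₁ := by
    rw [twist12, twist, mapAlgHom_qPower, mapAlgHom_qPower, fm]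
    simp only [map_smul, map_add, map_mul, fcst, fh, hι, hlg, qNumAdd_zero,
      Algebra.TensorProduct.includeLeft_apply, Algebra.TensorProduct.tmul_mul_tmul, one_mul, mul_one,
      m]
  have mL : comulLeft (twist q t η c x 0) = PowerSeries.mapAlgHom fst L₂ := by
    have hm : Coalgebra.comul (R := S) m = m ⊗ₜ 1 + x .K ⊗ₜ m := hx.comul_m hqt
    rw [comulLeft, twist, mapAlgHom_qPower, mapAlgHom_qPower, map_add, map_mul, fm, qNumAdd_zero,
      qNumAdd_zero, show t • (x .K * x .H) = m from rfl]
    simp only [map_smul, map_add, map_mul, fcst, fh, fκ, fκ', hι, hlg,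
      Algebra.TensorProduct.map_tmul, Algebra.TensorProduct.tmul_mul_tmul, one_mul, mul_one,
      Bialgebra.comulAlgHom_apply, map_one, AlgHom.id_apply, hm, hx.comul_H,
      TensorProduct.add_tmul, Algebra.TensorProduct.one_def]
  have m23 : twist23 (twist q t η c x 0) = PowerSeries.mapAlgHom fst R₁ := by
    rw [twist23, twist, mapAlgHom_qPower, mapAlgHom_qPower]
    simp only [map_smul, map_add, fcst, qNumAdd_zero, m]
    rfl
  have mR : comulRight (twist q t η c x 0) = PowerSeries.mapAlgHom fst R₂ := by
    have hm : ∀ a e, as (a ⊗ₜ e) = lg a * ι e := fun a e => by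
      change _ = as _ * as _
      rw [← map_mul]; simp
    rw [comulRight, twist, mapAlgHom_qPower, mapAlgHom_qPower, fm]
    simp only [map_smul, map_add, map_mul, fcst, fh, qNumAdd_zero, AlgHom.comp_apply,
      Algebra.TensorProduct.map_tmul, AlgHom.id_apply, map_one, Bialgebra.comulAlgHom_apply]
    change qPower q (as _) (c • (as _ + η • as _)) = _
    rw [hm, hm, hm, map_one, map_one, mul_one, one_mul]
  -- At z = n the four factors become P_n ⊗ 1, F_n, F_0 and Δ(P_n). For the second this is Δ(H) = H
  -- ⊗ 1 + K' ⊗ H turning into (n)_t + t^n H = (z+n)_t, and likewise for m.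
  have eL₁ : ∀ n, PowerSeries.mapAlgHom (ev n) L₁ = PowerSeries.mapAlgHom
      (Algebra.TensorProduct.includeLeft : A →ₐ[S] A ⊗[S] A) (twistValue q t η c x n) := fun n => by
    rw [twistValue, mapAlgHom_qPower, mapAlgHom_qPower, em]
    simp only [map_smul, map_add, map_mul, ecst, eh, qNumAdd_zero_right, AlgHom.commutes,
      Algebra.TensorProduct.includeLeft_apply]
  have eL₂ : ∀ n, PowerSeries.mapAlgHom (ev n) L₂ = twist q t η c x n := fun n => by
    rw [twist, mapAlgHom_qPower, map_add, map_mul, em, eκ, ecst,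
      show t • (x .K * x .H) = m from rfl]
    simp only [map_smul, map_add, map_mul, ecst, eh, eκ', qNumAdd, TensorProduct.add_tmul,
      Algebra.algebraMap_eq_smul_one, smul_mul_assoc, one_mul, ← TensorProduct.smul_tmul']
    simp only [Algebra.TensorProduct.one_def]
  have eR₁ : ∀ n, PowerSeries.mapAlgHom (ev n) R₁ = twist q t η c x 0 := fun n => by
    rw [twist, mapAlgHom_qPower]
    simp only [map_smul, map_add, ecst, qNumAdd_zero, m]
  have eR₂ : ∀ n, PowerSeries.mapAlgHom (ev n) R₂ = PowerSeries.mapAlgHom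
      (Bialgebra.comulAlgHom S A) (twistValue q t η c x n) := fun n => by
    rw [twistValue, mapAlgHom_qPower, mapAlgHom_qPower, em]
    simp only [map_smul, map_add, map_mul, ecst, eh, qNumAdd_zero_right, AlgHom.commutes,
      Bialgebra.comulAlgHom_apply]
  rw [m12, mL, m23, mR, ← map_mul, ← map_mul]
  ext k
  rw [PowerSeries.mapAlgHom_apply, PowerSeries.mapAlgHom_apply, PowerSeries.coeff_map,
    PowerSeries.coeff_map, ← sub_eq_zero, ← map_sub]
  refine fst_eq_zero_of_mem_evalSubalgebra (fun e => hcomm e _) ?_ ?_ ?_ hqt hq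
    (sub_mem (hL k) (hR k)) ?_
  · rw [hx.K'_eq, map_add, map_one, map_smul]
  · rw [← map_mul, hx.K'_mul_K, map_one]
  · rw [← map_mul, hx.K_mul_K', map_one]
  · funext n
    have h := congrArg (PowerSeries.coeff k) (hx.twist_mul_comul_twistValue hqt hq c n)
    rw [← eL₁, ← eR₁ n, ← eL₂, ← eR₂, ← map_mul, ← map_mul, PowerSeries.mapAlgHom_apply,
      PowerSeries.mapAlgHom_apply, PowerSeries.coeff_map, PowerSeries.coeff_map] at h
    have h' : ev n (PowerSeries.coeff k (L₁ * L₂) - PowerSeries.coeff k (R₁ * R₂)) = 0 := by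
      rw [map_sub, sub_eq_zero]
      exact h.symm
    exact h'

/-- For the counits: ε(H) = 0 makes the exponent vanish on the left, and ε(f₀) = ε(f₁) = 0 makes the
base vanish on the right; either way the q-power is 1. -/
theorem isTwist (hx : IsBorelSystem q t η x) (hqt : q * t = 1)
    (hq : ∀ n : ℕ, 0 < n → IsUnit (qNum q n)) (c : S) :
    IsTwist (qPower q ((t • (x .K * x .H)) ⊗ₜ[S] 1)
      (c • (1 ⊗ₜ[S] x .f1 + η • (x .H ⊗ₜ[S] x .f0)))) := by
  have h := hx.twist_cocycle hqt hq c
  rw [twist, qNumAdd_zero, qNumAdd_zero] at h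
  refine IsTwist.of_cocycle (isUnit_qPower _ _ _) h ?_ ?_
  · rw [counitLeft, mapAlgHom_qPower]
    convert qPower_zero_left q _ using 2
    simp [hx.counit_H]
  · rw [counitRight, mapAlgHom_qPower]
    convert qPower_zero_right q _ using 2
    simp [hx.counit_f0, hx.counit_f1]

end IsBorelSystem

/-! ### The universal Borel system `Bq` and the maps out of it. -/

theorem tensorSq_tmul {S R A A' : Type*} [CommRing S] [CommRing R] [Algebra S R] [Ring A] [Ring A']
    [Algebra S A] [Algebra R A'] [Algebra S A'] [IsScalarTower S R A'] (f : A →ₐ[S] A') (a b : A) :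
    tensorSq (R := R) f (a ⊗ₜ b) = f a ⊗ₜ f b :=
  (Algebra.TensorProduct.lift_tmul _ _ _ _ _).trans (by simp)

theorem Bq.comul_gen {R : Type u} [CommRing R] (q : Rˣ) (η : R) (g : BqGen) :
    Coalgebra.comul (R := R) (gen R q η g) = comulGen R q η g :=
  lift_gen _ comulGen_rel g

theorem Bq.counit_gen {R : Type u} [CommRing R] (q : Rˣ) (η : R) (g : BqGen) :
    Coalgebra.counit (R := R) (gen R q η g) = counitGen R g :=
  lift_gen _ counitGen_rel g

theorem Bq.isBorelSystem {R : Type u} [CommRing R] (q : Rˣ) (η : R) :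
    IsBorelSystem ((q : R) ^ 2) ((↑q⁻¹ : R) ^ 2) η (gen R q η) where
  K_mul_K' := K_mul_K'
  K'_mul_K := K'_mul_K
  K'_eq := K'_eq
  H_K := H_K
  K_f0 := K_f0
  K_f1 := K_f1
  H_f0 := H_f0
  H_f1 := H_f1
  f1_f0 := f1_f0
  comul_K := comul_gen _ _ _
  comul_K' := comul_gen _ _ _
  comul_H := comul_gen _ _ _
  comul_f0 := comul_gen _ _ _
  comul_f1 := comul_gen _ _ _
  counit_K := counit_gen _ _ _
  counit_K' := counit_gen _ _ _
  counit_H := counit_gen _ _ _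
  counit_f0 := counit_gen _ _ _
  counit_f1 := counit_gen _ _ _

section Hom

variable {S : Type u} {R A' : Type*} [CommRing S] [CommRing R] [Algebra S R] [Ring A']
  [Bialgebra R A'] [Algebra S A'] [IsScalarTower S R A']

/-- A Borel system over R is a solution in A' of the defining relations of `Bq` after extension of
scalars along S → R. Compatibility with comultiplication and counit compares S-algebra maps, so
generators suffice. -/
theorem IsBorelSystem.exists_hom {q : Sˣ} {p : Rˣ} (hqp : algebraMap S R q = p) {η : S}
    {x : BqGen → A'}
    (hx : IsBorelSystem ((p : R) ^ 2) ((↑p⁻¹ : R) ^ 2) (algebraMap S R η) x) :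
    ∃ ψ : Bq S q η →ₐ[S] A', IsBialgMap (R := R) ψ ∧ ∀ g, ψ (Bq.gen S q η g) = x g := by
  have hp : p = Units.map (algebraMap S R : S →* R) q := Units.ext hqp.symm
  have hinv : algebraMap S R (↑q⁻¹ : S) = (↑p⁻¹ : R) := by rw [hp]; rfl
  have hrel : ∀ ⦃y z⦄, BqRel S q η y z → FreeAlgebra.lift S x y = FreeAlgebra.lift S x z := by
    intro y z h
    cases h <;> simp only [map_sub, map_add, map_one, map_mul, map_smul, map_pow,
      FreeAlgebra.lift_ι_apply] <;>
      try simp only [← algebraMap_smul R (_ : S) (_ : A'), map_sub, map_pow, map_one, hinv, hqp]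
    exacts [hx.K_mul_K', hx.K'_mul_K, hx.K'_eq, hx.H_K, hx.K_f0, hx.K_f1, hx.H_f0, hx.H_f1, hx.f1_f0]
  have hψ : ∀ g, Bq.lift x hrel (Bq.gen S q η g) = x g := Bq.lift_gen x hrel
  refine ⟨Bq.lift x hrel, ⟨fun a => ?_, fun a => ?_⟩, hψ⟩
  · have h : ((Bialgebra.comulAlgHom R A').restrictScalars S).comp (Bq.lift x hrel)
        = (tensorSq (R := R) (Bq.lift x hrel)).comp (Bialgebra.comulAlgHom S (Bq S q η)) := by
      refine Bq.hom_ext fun g => ?_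
      rw [AlgHom.comp_apply, AlgHom.comp_apply, AlgHom.restrictScalars_apply, hψ,
        Bialgebra.comulAlgHom_apply, Bialgebra.comulAlgHom_apply, Bq.comul_gen]
      cases g <;> simp only [Bq.comulGen, map_add, map_smul, tensorSq_tmul, hψ, map_mul, map_one]
      · exact hx.comul_K
      · exact hx.comul_K'
      · exact hx.comul_H
      · exact hx.comul_f0
      · rw [hx.comul_f1, ← algebraMap_smul R η]
    exact DFunLike.congr_fun h a
  · have h : ((Bialgebra.counitAlgHom R A').restrictScalars S).comp (Bq.lift x hrel)
        = (Algebra.ofId S R).comp (Bialgebra.counitAlgHom S (Bq S q η)) := by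
      refine Bq.hom_ext fun g => ?_
      rw [AlgHom.comp_apply, AlgHom.comp_apply, AlgHom.restrictScalars_apply, hψ,
        Bialgebra.counitAlgHom_apply, Bialgebra.counitAlgHom_apply, Bq.counit_gen]
      cases g <;> simp [Bq.counitGen, hx.counit_K, hx.counit_K', hx.counit_H, hx.counit_f0,
        hx.counit_f1]
    exact DFunLike.congr_fun h a

theorem map_twistB {q : Sˣ} {p : Rˣ} (hqp : algebraMap S R q = p) {η : S} {x : BqGen → A'}
    (hq : ∀ n : ℕ, 0 < n → IsUnit (qNum ((q : S) ^ 2) n)) {ψ : Bq S q η →ₐ[S] A'}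
    (hψ : ∀ g, ψ (Bq.gen S q η g) = x g) (ξ : S) :
    PowerSeries.map (tensorSq (R := R) ψ : _ →+* _) (twistB q η ξ)
      = qPower ((p : R) ^ 2) (((↑p⁻¹ : R) ^ 2 • (x .K * x .H)) ⊗ₜ[R] 1)
        ((qNum ((p : R) ^ 2) 2 * algebraMap S R ξ) • (1 ⊗ₜ[R] x .f1
          + algebraMap S R η • (x .H ⊗ₜ[R] x .f0))) := by
  have hp : p = Units.map (algebraMap S R : S →* R) q := Units.ext hqp.symm
  have hinv : algebraMap S R (↑q⁻¹ : S) = (↑p⁻¹ : R) := by rw [hp]; rfl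
  have h2 : algebraMap S R (qNum ((q : S) ^ 2) 2) = qNum ((p : R) ^ 2) 2 := by
    simp only [qNum, map_sum, map_pow, hqp]
  rw [twistB, map_qPower_baseChange (R := R) hq]
  simp only [map_smul, map_add, tensorSq_tmul, map_one, map_mul, hψ]
  simp only [← algebraMap_smul R (_ : S) (_ : A'), ← algebraMap_smul R (_ : S) (_ : A' ⊗[R] A'),
    map_mul, map_pow, hqp, hinv, h2]

end Hom

/-! ### Borel systems in the quantum affine algebra. -/

namespace Uq

variable {R : Type u} [CommRing R] {q : Rˣ}

theorem comul_gen (g : UqGen) : Coalgebra.comul (R := R) (gen R q g) = comulGen R q g :=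
  lift_gen _ comulGen_rel g

theorem counit_gen (g : UqGen) : Coalgebra.counit (R := R) (gen R q g) = counitGen R g :=
  lift_gen _ counitGen_rel g

/-- The elements of `U_q(sl₂^)` generating a quotient of `Bq`. -/
noncomputable def borel (q : Rˣ) (a b : R) : BqGen → Uq R q
  | .K => gen R q .K
  | .K' => gen R q .K'
  | .H => Ring.inverse ((↑q⁻¹ : R) ^ 2 - 1) • (gen R q .K' - 1)
  | .f0 => gen R q .K' * gen R q .eNA
  | .f1 => a • gen R q .eDA + b • (gen R q .K' * gen R q .eNA)

theorem isUnit_inv_sq_sub_one (hq : IsUnit ((q : R) ^ 2 - 1)) : IsUnit ((↑q⁻¹ : R) ^ 2 - 1) := by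
  have h : (↑q⁻¹ : R) ^ 2 - 1 = -(↑q⁻¹ : R) ^ 2 * ((q : R) ^ 2 - 1) := by
    linear_combination q_mul_qinv_sq (q := q)
  rw [h]
  exact ((q⁻¹.isUnit.pow 2).neg).mul hq

/-- The elements f₀ = q^{-h} e_{-α} and e_{δ-α} satisfy e_{δ-α} f₀ = t f₀ e_{δ-α}. Adding b f₀ to a
e_{δ-α} creates the defect b (1 - t) f₀², whence η = b (t - 1). With this η the mixed term of Δ(f₁)
is b (K' - K) ⊗ f₀, the discrepancy between K' ⊗ f₀ and K ⊗ f₀. -/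
theorem isBorelSystem (hq : IsUnit ((q : R) ^ 2 - 1)) (a b : R) :
    IsBorelSystem ((q : R) ^ 2) ((↑q⁻¹ : R) ^ 2) (b * ((↑q⁻¹ : R) ^ 2 - 1)) (borel q a b) := by
  have hst := q_mul_qinv_sq (q := q)
  have hj := Ring.inverse_mul_cancel _ (isUnit_inv_sq_sub_one hq)
  have hKf0 : gen R q .K * (gen R q .K' * gen R q .eNA)
      = (↑q⁻¹ : R) ^ 2 • (gen R q .K' * gen R q .eNA * gen R q .K) := by
    rw [← mul_assoc, K_mul_K', mul_assoc, ← mul_smul_comm, ← K_eNA, ← mul_assoc, K'_mul_K]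
  have hK'f0 : gen R q .K' * (gen R q .K' * gen R q .eNA)
      = (q : R) ^ 2 • (gen R q .K' * gen R q .eNA * gen R q .K') := by
    rw [mul_assoc, ← mul_smul_comm, ← K'_eNA]
  have hH : ∀ f, gen R q .K' * f = (q : R) ^ 2 • (f * gen R q .K') →
      Ring.inverse ((↑q⁻¹ : R) ^ 2 - 1) • (gen R q .K' - 1) * f
        = (q : R) ^ 2 • (f * (Ring.inverse ((↑q⁻¹ : R) ^ 2 - 1) • (gen R q .K' - 1)) - f) := by
    intro f hf
    rw [smul_mul_assoc, mul_smul_comm, sub_mul, mul_sub, hf, one_mul, mul_one]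
    match_scalars
    · ring
    · linear_combination (-(q : R) ^ 2) * hj + Ring.inverse ((↑q⁻¹ : R) ^ 2 - 1) * hst
  have hK'f1 : gen R q .K' * (a • gen R q .eDA + b • (gen R q .K' * gen R q .eNA))
      = (q : R) ^ 2 • ((a • gen R q .eDA + b • (gen R q .K' * gen R q .eNA)) * gen R q .K') := by
    rw [mul_add, add_mul, mul_smul_comm, mul_smul_comm, K'_eDA, hK'f0]
    simp only [smul_mul_assoc, smul_add, smul_comm a, smul_comm b]
  have hef : gen R q .eDA * (gen R q .K' * gen R q .eNA)
      = (↑q⁻¹ : R) ^ 2 • (gen R q .K' * gen R q .eNA * gen R q .eDA) := by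
    rw [mul_assoc, eNA_eDA, ← mul_assoc, ← mul_assoc, K'_eDA, smul_mul_assoc, smul_smul,
      mul_comm ((↑q⁻¹ : R) ^ 2), hst, one_smul]
  have hf0 : Coalgebra.comul (R := R) (gen R q .K' * gen R q .eNA)
      = (gen R q .K' * gen R q .eNA) ⊗ₜ 1 + gen R q .K' ⊗ₜ (gen R q .K' * gen R q .eNA) := by
    rw [Bialgebra.comul_mul, comul_gen, comul_gen, comulGen, comulGen, mul_add,
      Algebra.TensorProduct.tmul_mul_tmul, Algebra.TensorProduct.tmul_mul_tmul, K'_mul_K, mul_one]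
  constructor
  · exact K_mul_K'
  · exact K'_mul_K
  · change gen R q .K' = 1 + ((↑q⁻¹ : R) ^ 2 - 1) • (Ring.inverse _ • (gen R q .K' - 1))
    rw [smul_smul, mul_comm, hj, one_smul]
    abel
  · change (Ring.inverse _ • (gen R q .K' - 1)) * gen R q .K
      = gen R q .K * (Ring.inverse _ • (gen R q .K' - 1))
    rw [smul_mul_assoc, mul_smul_comm, sub_mul, mul_sub, K'_mul_K, K_mul_K', one_mul, mul_one]
  · exact hKf0
  · change gen R q .K * (a • gen R q .eDA + b • (gen R q .K' * gen R q .eNA))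
      = (↑q⁻¹ : R) ^ 2 • ((a • gen R q .eDA + b • (gen R q .K' * gen R q .eNA)) * gen R q .K)
    rw [mul_add, add_mul, mul_smul_comm, mul_smul_comm, K_eDA, hKf0]
    simp only [smul_mul_assoc, smul_add, smul_comm a, smul_comm b]
  · exact hH _ hK'f0
  · exact hH _ hK'f1
  · change (a • gen R q .eDA + b • (gen R q .K' * gen R q .eNA)) * (gen R q .K' * gen R q .eNA)
      = (↑q⁻¹ : R) ^ 2 • ((gen R q .K' * gen R q .eNA)
        * (a • gen R q .eDA + b • (gen R q .K' * gen R q .eNA)))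
        - (b * ((↑q⁻¹ : R) ^ 2 - 1)) • (gen R q .K' * gen R q .eNA) ^ 2
    simp only [add_mul, mul_add, smul_mul_assoc, mul_smul_comm, hef, pow_two]
    module
  · exact comul_gen _
  · exact comul_gen _
  · change Coalgebra.comul (R := R) (Ring.inverse _ • (gen R q .K' - 1))
      = (Ring.inverse _ • (gen R q .K' - 1)) ⊗ₜ 1
        + gen R q .K' ⊗ₜ (Ring.inverse _ • (gen R q .K' - 1))
    rw [map_smul, map_sub, comul_gen, Bialgebra.comul_one, comulGen, TensorProduct.tmul_smul,
      ← TensorProduct.smul_tmul', ← smul_add, TensorProduct.sub_tmul, TensorProduct.tmul_sub,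
      Algebra.TensorProduct.one_def]
    congr 1
    abel
  · exact hf0
  · change Coalgebra.comul (R := R) (a • gen R q .eDA + b • (gen R q .K' * gen R q .eNA))
      = (a • gen R q .eDA + b • (gen R q .K' * gen R q .eNA)) ⊗ₜ 1
        + gen R q .K ⊗ₜ (a • gen R q .eDA + b • (gen R q .K' * gen R q .eNA))
        + (b * ((↑q⁻¹ : R) ^ 2 - 1)) • ((Ring.inverse ((↑q⁻¹ : R) ^ 2 - 1) • (gen R q .K' - 1))
          * (1 + gen R q .K)) ⊗ₜ (gen R q .K' * gen R q .eNA)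
    rw [smul_mul_assoc, ← TensorProduct.smul_tmul', smul_smul, mul_assoc,
      mul_comm (_ - 1) (Ring.inverse _), hj, mul_one, sub_mul, mul_add, K'_mul_K, one_mul, mul_one,
      map_add, map_smul, map_smul, hf0, comul_gen, comulGen]
    simp only [TensorProduct.add_tmul, TensorProduct.tmul_add, TensorProduct.sub_tmul,
      ← TensorProduct.smul_tmul', TensorProduct.tmul_smul]
    module
  · exact counit_gen _
  · exact counit_gen _
  · change Coalgebra.counit (R := R) (Ring.inverse _ • (gen R q .K' - 1)) = 0
    rw [map_smul, map_sub, counit_gen, Bialgebra.counit_one, counitGen, sub_self, smul_zero]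
  · change Coalgebra.counit (R := R) (gen R q .K' * gen R q .eNA) = 0
    rw [Bialgebra.counit_mul, counit_gen, counit_gen]
    simp [counitGen]
  · change Coalgebra.counit (R := R) (a • gen R q .eDA + b • (gen R q .K' * gen R q .eNA)) = 0
    rw [map_add, map_smul, map_smul, Bialgebra.counit_mul, counit_gen, counit_gen, counit_gen]
    simp [counitGen]

/-- Since (t - 1) H = K' - 1, the two f₀-terms 1 ⊗ b f₀ and b (t - 1) H ⊗ f₀ add up to b K' ⊗ f₀.
The extra scalar c serves both uses: c = 1 for arbitrary a, b, and c = ξ, a = 1 for the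
degeneration. -/
theorem twistU_eq (hq : IsUnit ((q : R) ^ 2 - 1)) (a b c : R) :
    twistU q (c * a) (c * b) = qPower ((q : R) ^ 2)
      (((↑q⁻¹ : R) ^ 2 • (borel q a b .K * borel q a b .H)) ⊗ₜ[R] 1)
      ((qNum ((q : R) ^ 2) 2 * c) • (1 ⊗ₜ[R] borel q a b .f1
        + (b * ((↑q⁻¹ : R) ^ 2 - 1)) • (borel q a b .H ⊗ₜ[R] borel q a b .f0))) := by
  have hst := q_mul_qinv_sq (q := q)
  have hj := Ring.inverse_mul_cancel _ (isUnit_inv_sq_sub_one hq)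
  have hi := Ring.inverse_mul_cancel _ hq
  rw [twistU]
  congr 1
  · congr 1
    change _ = (↑q⁻¹ : R) ^ 2 • (gen R q .K * (Ring.inverse _ • (gen R q .K' - 1)))
    rw [mul_smul_comm, mul_sub, K_mul_K', mul_one, smul_smul,
      ← neg_sub (gen R q .K) 1, smul_neg, ← neg_smul]
    congr 1
    generalize Ring.inverse ((q : R) ^ 2 - 1) = i at *
    generalize Ring.inverse ((↑q⁻¹ : R) ^ 2 - 1) = j at *
    generalize (q : R) ^ 2 = s at *
    generalize (↑q⁻¹ : R) ^ 2 = t at *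
    linear_combination (-(j * t)) * hi - i * hj + j * i * hst
  · rw [mul_smul (qNum ((q : R) ^ 2) 2)]
    congr 1
    simp only [borel, TensorProduct.tmul_add, TensorProduct.tmul_smul, ← TensorProduct.smul_tmul',
      TensorProduct.sub_tmul, smul_smul, smul_add, smul_sub, mul_assoc b]
    rw [mul_comm (_ - 1) (Ring.inverse _), hj]
    module

end Uq

/-! ### The Borel system in the Yangian. -/

namespace Yangian

variable {R : Type u} [CommRing R] {η : R}

/-- The elements of `Y(sl₂)` generating a quotient of `Bq` at `q = 1`. -/
noncomputable def borel (R : Type u) [CommRing R] (η : R) : BqGen → Yangian R η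
  | .K => 1
  | .K' => 1
  | .H => halfH R η
  | .f0 => f0 R η
  | .f1 => f1 R η

theorem comul_t (i j : Fin 2) (n : ℕ) :
    Coalgebra.comul (R := R) (t R η i j n) = comulGen R η i j n :=
  lift_t _ _ _ i j n

theorem counit_t (i j : Fin 2) (n : ℕ) : Coalgebra.counit (R := R) (t R η i j n) = 0 :=
  lift_t _ _ _ i j n

/-- The coefficient of u⁻¹ in the quantum determinant relation; the quadratic terms do not
contribute since t_ij^{(0)} = 0. It makes h/2 equal to t₁₁^{(1)}. -/
theorem t00_add_t11 : t R η 0 0 1 + t R η 1 1 1 = 0 := by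
  have h := t_qdet (R := R) (η := η) 1
  rw [yQdet, yShift_eq η _ (show 1 < 2 by omega), Finset.sum_range_succ, Finset.sum_range_one,
    t_zero, smul_zero, zero_add, pow_one, shiftedInv, ← zero_add 1, PowerSeries.coeff_succ_X_mul,
    PowerSeries.coeff_mk, pow_zero, one_smul, Finset.Nat.sum_antidiagonal_eq_sum_range_succ_mk] at h
  simpa [Finset.sum_range_succ, t_zero, yShift] using h

theorem halfH_eq (h2 : IsUnit (2 : R)) : halfH R η = t R η 0 0 1 := by
  have h : t R η 1 1 1 = -t R η 0 0 1 := (neg_eq_of_add_eq_zero_right t00_add_t11).symm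
  rw [halfH, h, sub_neg_eq_add, ← two_smul R, smul_smul, Ring.inverse_mul_cancel _ h2, one_smul]

theorem t11_eq (h2 : IsUnit (2 : R)) : t R η 1 1 1 = -halfH R η := by
  rw [halfH_eq h2]
  exact (neg_eq_of_add_eq_zero_right t00_add_t11).symm

theorem comul_t_one (i j : Fin 2) : Coalgebra.comul (R := R) (t R η i j 1)
    = t R η i j 1 ⊗ₜ 1 + 1 ⊗ₜ t R η i j 1 := by
  rw [comul_t, comulGen]
  simp [Finset.Nat.antidiagonal_succ, t_zero]

theorem comul_t_two (i j : Fin 2) : Coalgebra.comul (R := R) (t R η i j 2)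
    = t R η i j 2 ⊗ₜ 1 + 1 ⊗ₜ t R η i j 2
      + η • (t R η i 0 1 ⊗ₜ t R η 0 j 1 + t R η i 1 1 ⊗ₜ t R η 1 j 1) := by
  rw [comul_t, comulGen]
  simp [Finset.Nat.antidiagonal_succ, t_zero]

/-- At q = t = 1 with K = K' = 1 a Borel system asks that f₀, f₁ have weight -1 for H = h/2, that
[f₁, f₀] = -η f₀², and that Δ(f₁) have mixed term 2 η H ⊗ f₀. -/
theorem isBorelSystem (h2 : IsUnit (2 : R)) (η : R) :
    IsBorelSystem (1 : R) 1 η (borel R η) := by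
  have hHt : ∀ s, 1 ≤ s → halfH R η * t R η 1 0 s = t R η 1 0 s * halfH R η - t R η 1 0 s := by
    intro s hs
    have h := t_lie (η := η) 0 0 1 0 hs
    rw [halfH_eq h2]
    simp only [if_true, one_ne_zero, if_false, zero_sub] at h
    rw [eq_add_of_sub_eq h]
    abel
  have hH0 : halfH R η * f0 R η = f0 R η * halfH R η - f0 R η := hHt 1 le_rfl
  have hH : Coalgebra.comul (R := R) (halfH R η) = halfH R η ⊗ₜ 1 + 1 ⊗ₜ halfH R η := by
    rw [halfH_eq h2, comul_t_one]
  have hf0 : Coalgebra.comul (R := R) (f0 R η) = f0 R η ⊗ₜ 1 + 1 ⊗ₜ f0 R η := comul_t_one _ _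
  constructor
  · exact mul_one _
  · exact mul_one _
  · simp [borel]
  · simp [borel]
  · simp [borel]
  · simp [borel]
  · simpa [borel] using hH0
  · simp only [borel, one_smul, f1, mul_add, add_mul, mul_neg, neg_mul, hHt 2 one_le_two,
      mul_smul_comm, smul_mul_assoc]
    rw [← mul_assoc, hH0, sub_mul]
    module
  -- As t₂₁^{(1)} and t₂₁^{(2)} commute, only the correction η f₀ H contributes, and η f₀ [H, f₀] =
  -- -η f₀².
  · have h := t_lie (η := η) 1 0 1 0 (s := 2) one_le_two
    simp only [one_ne_zero, if_false, sub_zero] at h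
    simp only [borel, one_smul, f1, mul_add, add_mul, mul_neg, neg_mul, mul_smul_comm,
      smul_mul_assoc]
    rw [mul_assoc (f0 R η), hH0, mul_sub, ← mul_assoc, pow_two,
      show f0 R η * t R η 1 0 2 = t R η 1 0 2 * f0 R η from sub_eq_zero.1 h]
    rw [smul_sub, mul_assoc]
    abel
  · simp [borel, Algebra.TensorProduct.one_def]
  · simp [borel, Algebra.TensorProduct.one_def]
  · exact hH
  · exact hf0
  -- The coproduct of -t₂₁^{(2)} contributes -η (f₀ ⊗ H - H ⊗ f₀), and that of η f₀ H contributes η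
  -- (f₀ ⊗ H + H ⊗ f₀). The correction in f₁ thus removes f₀ ⊗ H and doubles H ⊗ f₀.
  · simp only [borel, f1]
    rw [map_add, map_neg, map_smul, Bialgebra.comul_mul, hH, hf0, comul_t_two, t11_eq h2,
      ← halfH_eq h2]
    change -(_ + _ + η • (f0 R η ⊗ₜ halfH R η + (-halfH R η) ⊗ₜ f0 R η)) + _ = _
    simp only [mul_add, add_mul, Algebra.TensorProduct.tmul_mul_tmul, mul_one, one_mul,
      TensorProduct.add_tmul, TensorProduct.tmul_add, TensorProduct.neg_tmul, TensorProduct.tmul_neg,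
      ← TensorProduct.smul_tmul', TensorProduct.tmul_smul]
    module
  · simp [borel]
  · simp [borel]
  · simp [borel, halfH_eq h2, counit_t]
  · simp [borel, f0, counit_t]
  · simp [borel, f1, f0, counit_t]

theorem twistY_eq (ξ : R) : twistY η ξ = qPower (1 : R)
    (((1 : R) • (borel R η .K * borel R η .H)) ⊗ₜ[R] 1)
    ((2 * ξ) • (1 ⊗ₜ[R] borel R η .f1 + η • (borel R η .H ⊗ₜ[R] borel R η .f0))) := by
  simp only [twistY, borel, one_smul, one_mul]

end Yangian

/-! ### Assembly of the three statements. -/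

theorem mainTheorem2 :
    -- the two-parameter twist of `U_q(sl₂^)`
    (∀ (R : Type u) [CommRing R] (q : Rˣ), (∀ n : ℕ, 0 < n → IsUnit ((q : R) ^ (2 * n) - 1)) →
      ∀ a b : R, IsTwist (twistU q a b)) ∧
    -- the twist of the Yangian
    (∀ (R : Type u) [CommRing R], (∀ n : ℕ, 0 < n → IsUnit (n : R)) →
      ∀ η ξ : R, IsTwist (twistY η ξ)) ∧
    -- the degeneration
    (∀ (S : Type u) [CommRing S] (q : Sˣ) (η ξ : S),
      (∀ n : ℕ, 0 < n → IsUnit (qNum ((q : S) ^ 2) n)) →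
      IsTwist (twistB q η ξ) ∧
      (∀ (R : Type v) [CommRing R] [Algebra S R] (p : Rˣ),
        algebraMap S R q = p → IsUnit ((p : R) ^ 2 - 1) →
        ∃ ψ : Bq S q η →ₐ[S] Uq R p, IsBialgMap (R := R) ψ ∧
          ψ (Bq.gen S q η .K) = Uq.gen R p .K ∧
          ψ (Bq.gen S q η .K') = Uq.gen R p .K' ∧
          ψ (Bq.gen S q η .H)
            = Ring.inverse ((↑p⁻¹ : R) ^ 2 - 1) • (Uq.gen R p .K' - 1) ∧
          ψ (Bq.gen S q η .f0) = Uq.gen R p .K' * Uq.gen R p .eNA ∧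
          ψ (Bq.gen S q η .f1) = Uq.gen R p .eDA
            + (algebraMap S R η * Ring.inverse ((↑p⁻¹ : R) ^ 2 - 1)) •
              (Uq.gen R p .K' * Uq.gen R p .eNA) ∧
          PowerSeries.map (tensorSq (R := R) ψ : _ →+* _) (twistB q η ξ)
            = twistU p (algebraMap S R ξ)
              (algebraMap S R (ξ * η) * Ring.inverse ((↑p⁻¹ : R) ^ 2 - 1))) ∧
      (∀ (R : Type v) [CommRing R] [Algebra S R], algebraMap S R q = 1 →
        ∃ ψ : Bq S q η →ₐ[S] Yangian R (algebraMap S R η), IsBialgMap (R := R) ψ ∧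
          ψ (Bq.gen S q η .K) = 1 ∧
          ψ (Bq.gen S q η .K') = 1 ∧
          ψ (Bq.gen S q η .H) = Yangian.halfH R (algebraMap S R η) ∧
          ψ (Bq.gen S q η .f0) = Yangian.f0 R (algebraMap S R η) ∧
          ψ (Bq.gen S q η .f1) = Yangian.f1 R (algebraMap S R η) ∧
          PowerSeries.map (tensorSq (R := R) ψ : _ →+* _) (twistB q η ξ)
            = twistY (algebraMap S R η) (algebraMap S R ξ))) := by
  refine ⟨fun R _ q hq a b => ?_, fun R _ hn η ξ => ?_, fun S _ q η ξ hq =>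
    ⟨(Bq.isBorelSystem q η).isTwist Uq.q_mul_qinv_sq hq _, fun R _ _ p hqp hp => ?_,
      fun R _ _ hq1 => ?_⟩⟩
  -- From q^{2n} - 1 = (n)_{q²} (q² - 1), both factors are units. The factor 1 below is the scalar c
  -- of `Uq.twistU_eq`.
  · have h1 : IsUnit ((q : R) ^ 2 - 1) := by simpa using hq 1 one_pos
    have hq' : ∀ n : ℕ, 0 < n → IsUnit (qNum ((q : R) ^ 2) n) := fun n hn => by
      have h := hq n hn
      rw [pow_mul, ← qNum_mul_sub_one] at h
      exact isUnit_of_mul_isUnit_left h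
    have h := (Uq.isBorelSystem h1 a b).isTwist Uq.q_mul_qinv_sq hq' (qNum ((q : R) ^ 2) 2 * 1)
    rwa [← Uq.twistU_eq h1, one_mul, one_mul] at h
  · have h2 : IsUnit (2 : R) := by simpa using hn 2 two_pos
    rw [Yangian.twistY_eq]
    exact (Yangian.isBorelSystem h2 η).isTwist (one_mul 1)
      (fun n h => by simpa [qNum] using hn n h) _
  · have hj := Ring.inverse_mul_cancel _ (Uq.isUnit_inv_sq_sub_one hp)
    have hη : algebraMap S R η * Ring.inverse ((↑p⁻¹ : R) ^ 2 - 1) * ((↑p⁻¹ : R) ^ 2 - 1)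
        = algebraMap S R η := by rw [mul_assoc, hj, mul_one]
    -- The choice a = 1, b = η/(q⁻² - 1) makes the parameter b (q⁻² - 1) of the Borel system equal
    -- to η.
    have hx := Uq.isBorelSystem hp 1 (algebraMap S R η * Ring.inverse ((↑p⁻¹ : R) ^ 2 - 1))
    rw [hη] at hx
    obtain ⟨ψ, hψ, hg⟩ := hx.exists_hom hqp
    refine ⟨ψ, hψ, hg _, hg _, hg _, hg _, (hg _).trans ?_, ?_⟩
    · rw [Uq.borel, one_smul]
    · have h := Uq.twistU_eq hp 1 (algebraMap S R η * Ring.inverse ((↑p⁻¹ : R) ^ 2 - 1))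
        (algebraMap S R ξ)
      rw [hη, mul_one, ← mul_assoc, ← map_mul] at h
      rw [h]
      exact map_twistB hqp hq hg ξ
  -- At q = 1 the unit (2)_{q²} of S maps to 2, so h/2 makes sense in R.
  · have h2 : IsUnit (2 : R) := by
      have h := (hq 2 two_pos).map (algebraMap S R)
      simpa [qNum, Finset.sum_range_succ, hq1, one_add_one_eq_two] using h
    have hx := Yangian.isBorelSystem h2 (algebraMap S R η)
    obtain ⟨ψ, hψ, hg⟩ := IsBorelSystem.exists_hom (q := q) (p := 1) (η := η) hq1
      (by simpa only [inv_one, Units.val_one, one_pow] using hx)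
    refine ⟨ψ, hψ, hg _, hg _, hg _, hg _, hg _, ?_⟩
    have h := map_twistB (p := 1) hq1 hq hg ξ
    simp only [inv_one, Units.val_one, one_pow] at h
    rw [h, Yangian.twistY_eq]
    simp [qNum]
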